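/- On the torus $\mathbb T=\mathbb R/2\pi\mathbb Z$ write $(u|\mathbf 1)=\frac1{2\pi}\int_{\mathbb T}u\,dx$, $\Pi u=\sum_{k\ge0}\hat u(k)e^{ikx}$, $Su=e^{ix}u$, $S^*u=e^{-ix}(u-(u|\mathbf 1))$, $\|u\|_{H^s}^2=\sum_k(1+k^2)^s|\hat u(k)|^2$. For $\nu>0$, $\alpha,\beta\in\mathbb R$ consider the damped $(\alpha,\beta)$-Szegő equation $$i\partial_tu+i\nu(u|\mathbf 1)=\Pi(|u|^2u)+\alpha(u|\mathbf 1)-\beta S\Pi(|S^*u|^2S^*u),$$ whose solutions are understood in $C(\mathbb R;H^r_+)$ for some $r>\frac12$, where $H^r_+=\{u\in H^r:\hat u(k)=0\text{ for }k<0\}$. Let $$\mathcal W=\Big\{b+\frac{c\,e^{ix}}{1-p\,e^{ix}}:\ b,c,p\in\mathbb C,\ c\ne0,\ |p|<1\Big\},$$ a manifold of real dimension six with global coordinates $(b,c,p)$. For $M>0$ let $\mathcal E_M=\{u\in\mathcal W:\sum_{k\ge1}k|\hat u(k)|^2=M\}$ and $\mathcal C_M=\{c\,e^{ix}:|c|^2=M\}$.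 **Theorem.** Let $\nu>0$, $\alpha,\beta\in\mathbb R$, $M>0$. Every $u_0\in\mathcal E_M$ is the value at $t=0$ of a unique global solution $t\mapsto\mathbb S(t)u_0$, and $\mathbb S(t)u_0\in\mathcal E_M$ for all $t\in\mathbb R$. There exists a (nonempty) three-dimensional embedded $C^\infty$ submanifold $\Sigma\subset\mathcal E_M$, disjoint from $\mathcal C_M$ and invariant under $\mathbb S(t)$, $t\in\mathbb R$, such that $\Sigma\cup\mathcal C_M$ is closed (in $\mathcal W$) and the following holds. 1. If $u_0\in\mathcal E_M\setminus(\Sigma\cup\mathcal C_M)$, then for every $s>\frac12$, as $t\to+\infty$, $$\|\mathbb S(t)u_0\|_{H^s}^2\sim a^2t^{2s-1},\qquad a^2=\Gamma(2s+1)\,M^{4s-1}\Big(\frac{\nu^2+((1-\beta)M-\alpha)^2}{2\nu}\Big)^{1-2s}.$$ 2. If $u_0\in\Sigma$, then for every $s\ge0$ the distance in $H^s$ from $\mathbb S(t)u_0$ to $\mathcal C_M$ tends to $0$ as $t\to+\infty$, and there is a constant $K>0$ (depending on $u_0$ and $s$) such that $$\operatorname{dist}_{H^s}(\mathbb S(t)u_0,\mathcal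 C_M)\sim K\,e^{-\frac{\nu+\sigma}2t},$$ where $$\sigma=\left(\frac{(\nu^2-\alpha^2-4M\alpha)+\sqrt{(\nu^2-\alpha^2-4M\alpha)^2+4\nu^2(2M+\alpha)^2}}2\right)^{1/2}\ge\nu.$$ Here $f\sim g$ means $f(t)/g(t)\to1$ as $t\to+\infty$. -/

import Mathlib

open Real Filter Topology MeasureTheory Asymptotics
open scoped ContDiff

namespace DampedSzego

instance factTwoPiPos : Fact (0 < 2 * π) := ⟨Real.two_pi_pos⟩

/-- The torus `ℝ / 2πℤ`. The character `x ↦ e^{inx}` is `fourier n`, and Fourier coefficients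
`fourierCoeff f n` are taken with respect to the normalized measure `dx / 2π`. -/
abbrev Torus : Type := AddCircle (2 * π)

noncomputable section

/-- The mean value `(u | 1) = (1 / 2π) ∫ u dx`. -/
def mean (u : Torus → ℂ) : ℂ := ∫ x : Torus, u x ∂AddCircle.haarAddCircle

/-- The Szegő projector `Π u = ∑_{k ≥ 0} û(k) e^{ikx}`. -/
def szego (u : Torus → ℂ) : Torus → ℂ :=
  fun x => ∑' k : ℕ, fourierCoeff u (k : ℤ) * fourier (k : ℤ) x

/-- The shift `S u = e^{ix} u`. -/
def shift (u : Torus → ℂ) : Torus → ℂ := fun x => fourier 1 x * u x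

/-- The adjoint of the shift, `S^* u = e^{-ix} (u - (u | 1))`. -/
def shiftAdj (u : Torus → ℂ) : Torus → ℂ := fun x => fourier (-1) x * (u x - mean u)

/-- The pointwise cubic expression `|u|² u`. -/
def cubic (u : Torus → ℂ) : Torus → ℂ := fun x => ((‖u x‖ ^ 2 : ℝ) : ℂ) * u x

/-- The Sobolev norm `‖u‖_{H^s} = (∑_k (1 + k²)^s |û(k)|²)^{1/2}`. -/
def hsNorm (s : ℝ) (u : Torus → ℂ) : ℝ :=
  √(∑' k : ℤ, (1 + (k : ℝ) ^ 2) ^ s * ‖fourierCoeff u k‖ ^ 2)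

/-- The distance in `H^s` from a function to a set of functions. -/
def hsDist (s : ℝ) (u : Torus → ℂ) (A : Set (Torus → ℂ)) : ℝ :=
  sInf ((fun v => hsNorm s (u - v)) '' A)

/-- Membership in `H^r_+ = H^r ∩ L²_+`, for `r > 1/2` (where every class of functions has a
continuous representative). -/
def MemHsPlus (r : ℝ) (u : Torus → ℂ) : Prop :=
  Continuous u ∧ (∀ n : ℤ, n < 0 → fourierCoeff u n = 0) ∧
    Summable fun k : ℤ => (1 + (k : ℝ) ^ 2) ^ r * ‖fourierCoeff u k‖ ^ 2

/-- Global solutions `u ∈ C(ℝ; H^r_+)`, for some `r > 1/2`, of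
`i ∂ₜu + iν (u|1) = Π(|u|²u) + α (u|1) - β S Π(|S^*u|² S^*u)`.
Since `H^r` is an algebra, all terms are continuous functions with absolutely convergent Fourier
series, and the equation is meant at every point. -/
structure IsSolution (ν α β : ℝ) (u : ℝ → Torus → ℂ) : Prop where
  continuous_hs : ∃ r : ℝ, 1 / 2 < r ∧ (∀ t, MemHsPlus r (u t)) ∧
    ∀ t, Tendsto (fun τ => hsNorm r (u τ - u t)) (𝓝 t) (𝓝 0)
  equation : ∀ (t : ℝ) (x : Torus), ∃ d : ℂ, HasDerivAt (fun τ => u τ x) d t ∧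
    Complex.I * d + Complex.I * (ν : ℂ) * mean (u t) =
      szego (cubic (u t)) x + (α : ℂ) * mean (u t)
        - (β : ℂ) * shift (szego (cubic (shiftAdj (u t)))) x

/-- The function `b + c e^{ix} / (1 - p e^{ix})`, for `z = (b, c, p)`. -/
def rankOne (z : ℂ × ℂ × ℂ) : Torus → ℂ :=
  fun x => z.1 + z.2.1 * fourier 1 x / (1 - z.2.2 * fourier 1 x)

/-- The open set of the parameters `(b, c, p)` with `c ≠ 0` and `|p| < 1`. -/
def paramDomain : Set (ℂ × ℂ × ℂ) := {z | z.2.1 ≠ 0 ∧ ‖z.2.2‖ < 1}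

/-- The manifold `𝓦`, of real dimension six; `(b, c, p) ∈ paramDomain` are global coordinates
on it. -/
def rankOneManifold : Set (Torus → ℂ) := rankOne '' paramDomain

/-- The momentum `∑_{k ≥ 1} k |û(k)|²`. -/
def momentum (u : Torus → ℂ) : ℝ := ∑' k : ℕ, (k : ℝ) * ‖fourierCoeff u (k : ℤ)‖ ^ 2

/-- `𝓔_M`, the functions of `𝓦` with momentum `M`. -/
def energyLevel (M : ℝ) : Set (Torus → ℂ) := {u | u ∈ rankOneManifold ∧ momentum u = M}

/-- `𝓒_M`, the circle of the functions `c e^{ix}` with `|c|² = M`. -/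
def circleSet (M : ℝ) : Set (Torus → ℂ) :=
  {u | ∃ c : ℂ, ‖c‖ ^ 2 = M ∧ u = fun x => c * fourier 1 x}

/-- The coordinates `(b, c, p)` of the points of `𝓦` that belong to `A`. -/
def coords (A : Set (Torus → ℂ)) : Set (ℂ × ℂ × ℂ) := {z | z ∈ paramDomain ∧ rankOne z ∈ A}

/-- `N` is an embedded `C^∞` submanifold, of dimension `d`, of the real normed space `E`: near each
of its points, a smooth local diffeomorphism straightens `N` to a `d`-dimensional subspace. -/
def IsSmoothSubmanifold {E : Type*} [NormedAddCommGroup E] [NormedSpace ℝ E] (d : ℕ)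
    (N : Set E) : Prop :=
  ∀ x ∈ N, ∃ (F : Submodule ℝ E) (Φ : OpenPartialHomeomorph E E),
    Module.finrank ℝ F = d ∧ x ∈ Φ.source ∧
    ContDiffOn ℝ ∞ Φ Φ.source ∧ ContDiffOn ℝ ∞ Φ.symm Φ.target ∧
    ∀ y ∈ Φ.source, (y ∈ N ↔ Φ y ∈ F)

/-- The exponent `σ`. -/
def sigma (ν α M : ℝ) : ℝ :=
  √(((ν ^ 2 - α ^ 2 - 4 * M * α) +
    √((ν ^ 2 - α ^ 2 - 4 * M * α) ^ 2 + 4 * ν ^ 2 * (2 * M + α) ^ 2)) / 2)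

end

end DampedSzego

/-!
**Reduction to an ordinary differential equation.** On rational functions
`u = b + c e^{ix} / (1 - p e^{ix})` the Szegő projections of the two cubic terms are computed by
partial fractions, and the right-hand side is tangent to the manifold of these functions
(`field_rankOne`). On the level set `|c|² = M (1 - |p|²)²` of the momentum, the equation becomes a
polynomial differential equation for `(b, c, p)`, with vector field `vf`. Its curves conserve the
momentum and grow at most exponentially, hence are global (`exists_orbit`), and they give solutions
of the equation. For `r > 1/2` a function of `H^r` has absolutely summable Fourier coefficients; the
right-hand side is locally Lipschitz in this Wiener algebra, so there are no other solutions
(`IsSolution.unique`).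

**Dichotomy.** Put `η = 1 - |p|²`. The squared `L²` norm `|b|² + M η` has derivative `-2 ν |b|²`. By
Barbalat's lemma, applied to it and then to `b`, both `b` and `c p̄` tend to zero, so that `η` tends to
`0` or to `1` (`IsOrbit.eta_dichotomy`).

**Blow-up.** If `η → 0`, then `X = b c̄ p / η²` solves a scalar linear equation with convergent
coefficients and a damping of limit `ν`, so it converges (`IsOrbit.tendsto_crossTerm_div`). As
`(1 / η)' = -2 Im X`, the inverse of `η` grows linearly, with an explicit slope. The `H^s` norm is a
weighted geometric series in `|p|² = 1 - η`, whose behaviour as `|p| → 1` is given by Abelian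
asymptotics (`tendsto_weightSum`); this is where `Γ(2s + 1)` comes from.

**Convergence to the circle.** The limit `η → 1` means convergence to `𝓒_M`. The equation is invariant
under `(b, c, p) ↦ (a b, a d c, d p)` with `|a| = |d| = 1`. The coordinates
`q = c p̄ / (√M η)` and `w = i √M b` eliminate the second circle of symmetries; in them `𝓒_M` is the
origin, an equilibrium with a diagonalizable linear part over `ℂ` and a cubic remainder. The real
parts of the two eigenvalues are `-(ν + σ) / 2 < 0` and `(σ - ν) / 2 > 0`. The cone condition for the
difference of two solutions shows that an orbit which stays near the origin is determined by its
stable coordinate; since the first circle of symmetries rotates this coordinate, and time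
translations change its modulus, the orbits which converge to `𝓒_M` are all images of one of them
(`IsStableOrbit.exists_eq_rot`). There is one: orbits through points of the stable axis closer and
closer to the origin, followed backward until they leave a fixed ball, accumulate on an orbit which
never leaves the ball forward in time (`exists_isStableOrbit`). The stable coordinate dominates, and
the remainder divided by it is integrable in time, which gives the exact exponential rate of the distance
(`IsStableOrbit.hsDist_isEquivalent`).

**The invariant manifold.** `Σ` is the union of these orbits. It is parametrized by the time and the two
angles of the symmetries; this is an immersion, and a homeomorphism near each point because the `L²`
norm is invariant under the symmetries and strictly decreasing along the orbit
(`isSmoothSubmanifold_stableSet`). Finally `Σ ∪ 𝓒_M` consists of the points of `𝓔_M` along whose forward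
orbit `|b|² + M η ≥ M`, which is a closed condition (`isClosed_stable_union_circle`).
-/
namespace DampedSzego
noncomputable section

/-! ### The Wiener algebra -/

/-- The Wiener algebra: continuous functions with absolutely summable Fourier coefficients. -/
def IsWiener (f : Torus → ℂ) : Prop :=
  Continuous f ∧ Summable fun k : ℤ => ‖fourierCoeff f k‖

/-- The norm `∑ |f̂(k)|` of the Wiener algebra. -/
def wnorm (f : Torus → ℂ) : ℝ := ∑' k : ℤ, ‖fourierCoeff f k‖

lemma wnorm_nonneg (f : Torus → ℂ) : 0 ≤ wnorm f := tsum_nonneg fun _ => norm_nonneg _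

lemma norm_fourier_apply (k : ℤ) (x : Torus) : ‖(fourier k x : ℂ)‖ = 1 := Circle.norm_coe _

lemma integrable_of_continuous {f : Torus → ℂ} (hf : Continuous f) :
    Integrable f AddCircle.haarAddCircle :=
  hf.integrable_of_hasCompactSupport (HasCompactSupport.of_compactSpace f)

lemma fourierCoeff_add {f g : Torus → ℂ} (hf : Continuous f) (hg : Continuous g) (n : ℤ) :
    fourierCoeff (f + g) n = fourierCoeff f n + fourierCoeff g n := by
  rw [fourierCoeff.add (integrable_of_continuous hf) (integrable_of_continuous hg)]; rfl

lemma fourierCoeff_neg (f : Torus → ℂ) (n : ℤ) :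
    fourierCoeff (-f) n = -fourierCoeff f n := by
  have := fourierCoeff.const_smul f (-1) n
  simpa using this

lemma fourierCoeff_sub {f g : Torus → ℂ} (hf : Continuous f) (hg : Continuous g) (n : ℤ) :
    fourierCoeff (f - g) n = fourierCoeff f n - fourierCoeff g n := by
  rw [sub_eq_add_neg, fourierCoeff_add hf hg.neg, fourierCoeff_neg, sub_eq_add_neg]

lemma fourierCoeff_fourier_apply (k n : ℤ) :
    fourierCoeff (fun x : Torus => (fourier k x : ℂ)) n = if k = n then 1 else 0 := by
  have := congrFun (fourierCoeff_fourier (T := 2 * π) k) n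
  rw [show (fun x : Torus => (fourier k x : ℂ)) = ⇑(fourier k : C(Torus, ℂ)) from rfl, this]
  simp [Pi.single_apply, eq_comm]

lemma mean_eq (f : Torus → ℂ) : mean f = fourierCoeff f 0 := by
  simp [mean, fourierCoeff]

/-- A function given by an absolutely convergent trigonometric series has the coefficients of this
series as Fourier coefficients. -/
lemma fourierCoeff_of_hasSum {f : Torus → ℂ} {a : ℤ → ℂ} (ha : Summable fun k => ‖a k‖)
    (h : ∀ x, HasSum (fun k => a k * fourier k x) (f x)) :
    Continuous f ∧ ∀ n, fourierCoeff f n = a n := by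
  have hf : f = fun x => ∑' k, a k * fourier k x := funext fun x => (h x).tsum_eq.symm
  have hb : ∀ (k : ℤ) (x : Torus), ‖a k * fourier k x‖ ≤ ‖a k‖ := fun k x => by
    rw [norm_mul, norm_fourier_apply, mul_one]
  have hc : Continuous f := by
    rw [hf]
    exact continuous_tsum (fun k => continuous_const.mul (fourier k).continuous) ha hb
  refine ⟨hc, fun n => ?_⟩
  have hint : ∀ k : ℤ, Integrable (fun x : Torus => fourier (-n) x • (a k * fourier k x))
      AddCircle.haarAddCircle := fun k => integrable_of_continuous (by fun_prop)
  have hval : ∀ k : ℤ, ∫ x : Torus, fourier (-n) x • (a k * fourier k x)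
      ∂AddCircle.haarAddCircle = if k = n then a k else 0 := fun k => by
    have : fourierCoeff (fun x : Torus => a k * fourier k x) n = _ :=
      fourierCoeff.const_mul (fun x => fourier k x) (a k) n
    rw [fourierCoeff_fourier_apply] at this
    rw [fourierCoeff] at this
    rw [this]; simp
  have hs : Summable fun k : ℤ => ∫ x : Torus, ‖fourier (-n) x • (a k * fourier k x)‖
      ∂AddCircle.haarAddCircle := by
    refine ha.congr fun k => ?_
    have : ∀ x : Torus, ‖fourier (-n) x • (a k * fourier k x)‖ = ‖a k‖ := fun x => by
      rw [smul_eq_mul, norm_mul, norm_mul, norm_fourier_apply, norm_fourier_apply]; ring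
    simp_rw [this]; simp
  have key := hasSum_integral_of_summable_integral_norm hint hs
  have h2 : fourierCoeff f n = ∫ x : Torus, ∑' k, fourier (-n) x • (a k * fourier k x)
      ∂AddCircle.haarAddCircle := by
    rw [fourierCoeff]
    congr 1; funext x
    rw [← (h x).tsum_eq]
    exact ((h x).summable.tsum_const_smul _).symm
  rw [h2, ← key.tsum_eq]
  simp_rw [hval]
  exact tsum_ite_eq n _

lemma isWiener_of_hasSum {f : Torus → ℂ} {a : ℤ → ℂ} (ha : Summable fun k => ‖a k‖)
    (h : ∀ x, HasSum (fun k => a k * fourier k x) (f x)) : IsWiener f := by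
  obtain ⟨hc, hn⟩ := fourierCoeff_of_hasSum ha h
  exact ⟨hc, by simpa only [hn] using ha⟩

namespace IsWiener

variable {f g : Torus → ℂ}

lemma hasSum (hf : IsWiener f) (x : Torus) :
    HasSum (fun k : ℤ => fourierCoeff f k * fourier k x) (f x) := by
  have h : Summable (fourierCoeff (⟨f, hf.1⟩ : C(Torus, ℂ))) := hf.2.of_norm
  exact has_pointwise_sum_fourier_series_of_summable h x

lemma norm_le (hf : IsWiener f) (x : Torus) : ‖f x‖ ≤ wnorm f := by
  rw [← (hf.hasSum x).tsum_eq]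
  refine (norm_tsum_le_tsum_norm ?_).trans_eq ?_
  · simpa only [norm_mul, norm_fourier_apply, mul_one] using hf.2
  · simp only [norm_mul, norm_fourier_apply, mul_one, wnorm]

lemma ext (hf : IsWiener f) (hg : IsWiener g) (h : ∀ n, fourierCoeff f n = fourierCoeff g n) :
    f = g := by
  funext x
  have h1 := hf.hasSum x
  simp_rw [h] at h1
  exact h1.unique (hg.hasSum x)

lemma add (hf : IsWiener f) (hg : IsWiener g) : IsWiener (f + g) := by
  refine ⟨hf.1.add hg.1, ?_⟩
  simp_rw [fourierCoeff_add hf.1 hg.1]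
  exact (hf.2.add hg.2).of_nonneg_of_le (fun _ => norm_nonneg _) fun _ => norm_add_le _ _

lemma wnorm_add_le (hf : IsWiener f) (hg : IsWiener g) : wnorm (f + g) ≤ wnorm f + wnorm g := by
  rw [wnorm, wnorm, wnorm, ← hf.2.tsum_add hg.2]
  exact (hf.add hg).2.tsum_le_tsum (fun k => by
    rw [fourierCoeff_add hf.1 hg.1]; exact norm_add_le _ _) (hf.2.add hg.2)

lemma neg (hf : IsWiener f) : IsWiener (-f) :=
  ⟨hf.1.neg, by simpa only [fourierCoeff_neg, norm_neg] using hf.2⟩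

lemma _root_.DampedSzego.wnorm_neg (f : Torus → ℂ) : wnorm (-f) = wnorm f := by
  simp only [wnorm, fourierCoeff_neg, norm_neg]

lemma sub (hf : IsWiener f) (hg : IsWiener g) : IsWiener (f - g) := by
  rw [sub_eq_add_neg]; exact hf.add hg.neg

lemma wnorm_sub_le (hf : IsWiener f) (hg : IsWiener g) : wnorm (f - g) ≤ wnorm f + wnorm g := by
  rw [sub_eq_add_neg, ← wnorm_neg g]; exact hf.wnorm_add_le hg.neg

lemma const_mul (hf : IsWiener f) (c : ℂ) : IsWiener (fun x => c * f x) :=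
  ⟨continuous_const.mul hf.1, by
    simpa only [fourierCoeff.const_mul, norm_mul] using hf.2.mul_left ‖c‖⟩

lemma _root_.DampedSzego.wnorm_const_mul (f : Torus → ℂ) (c : ℂ) :
    wnorm (fun x => c * f x) = ‖c‖ * wnorm f := by
  simp only [wnorm, fourierCoeff.const_mul, norm_mul, tsum_mul_left]

/-- The Fourier coefficients of a product are obtained by convolution. -/
lemma mul_aux (hf : IsWiener f) (hg : IsWiener g) :
    Summable (fun p : ℤ × ℤ => ‖fourierCoeff f p.2 * fourierCoeff g (p.1 - p.2)‖) ∧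
    (∑' p : ℤ × ℤ, ‖fourierCoeff f p.2 * fourierCoeff g (p.1 - p.2)‖) = wnorm f * wnorm g ∧
    ∀ x, HasSum (fun n : ℤ => (∑' k, fourierCoeff f k * fourierCoeff g (n - k)) * fourier n x)
      (f x * g x) := by
  let e : ℤ × ℤ ≃ ℤ × ℤ :=
    { toFun := fun p => (p.2, p.1 - p.2)
      invFun := fun q => (q.1 + q.2, q.1)
      left_inv := fun p => by simp
      right_inv := fun q => by simp }
  have h0 : Summable (fun q : ℤ × ℤ => ‖fourierCoeff f q.1 * fourierCoeff g q.2‖) :=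
    Summable.mul_norm hf.2 hg.2
  have h1 : Summable (fun p : ℤ × ℤ => ‖fourierCoeff f p.2 * fourierCoeff g (p.1 - p.2)‖) :=
    e.summable_iff.mpr h0
  refine ⟨h1, ?_, fun x => ?_⟩
  · have := e.tsum_eq (fun q : ℤ × ℤ => ‖fourierCoeff f q.1 * fourierCoeff g q.2‖)
    refine this.trans ?_
    simp_rw [norm_mul]
    simp_rw [norm_mul] at h0
    rw [wnorm, wnorm, hf.2.tsum_mul_tsum hg.2 h0]
  · have h2 : HasSum (fun q : ℤ × ℤ => (fourierCoeff f q.1 * fourier q.1 x) *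
        (fourierCoeff g q.2 * fourier q.2 x)) (f x * g x) := by
      have hs : Summable (fun q : ℤ × ℤ => (fourierCoeff f q.1 * fourier q.1 x) *
          (fourierCoeff g q.2 * fourier q.2 x)) := by
        apply Summable.of_norm
        refine h0.congr fun q => ?_
        simp only [norm_mul, norm_fourier_apply, mul_one]
      have hv := (hf.hasSum x).summable.tsum_mul_tsum (hg.hasSum x).summable hs
      rw [(hf.hasSum x).tsum_eq, (hg.hasSum x).tsum_eq] at hv
      rw [hv]; exact hs.hasSum
    have h3 : HasSum ((fun q : ℤ × ℤ => (fourierCoeff f q.1 * fourier q.1 x) *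
        (fourierCoeff g q.2 * (fourier q.2 x : ℂ))) ∘ e) (f x * g x) := e.hasSum_iff.mpr h2
    have h4 : HasSum (fun p : ℤ × ℤ => fourierCoeff f p.2 * fourierCoeff g (p.1 - p.2) *
        fourier p.1 x) (f x * g x) := by
      have h5 : (fun p : ℤ × ℤ => fourierCoeff f p.2 * fourierCoeff g (p.1 - p.2) *
          (fourier p.1 x : ℂ)) = (fun q : ℤ × ℤ => (fourierCoeff f q.1 * fourier q.1 x) *
            (fourierCoeff g q.2 * fourier q.2 x)) ∘ e := by
        funext p
        have : (fourier p.1 x : ℂ) = fourier p.2 x * fourier (p.1 - p.2) x := by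
          rw [← fourier_add, add_sub_cancel]
        simp only [e, Function.comp, Equiv.coe_fn_mk]
        rw [this]; ring
      exact h5 ▸ h3
    have h6 : ∀ n : ℤ, HasSum (fun k : ℤ => fourierCoeff f k * fourierCoeff g (n - k) *
        (fourier n x : ℂ)) ((∑' k, fourierCoeff f k * fourierCoeff g (n - k)) * fourier n x) :=
      fun n => HasSum.mul_right _ (h1.prod_factor n).of_norm.hasSum
    generalize f x * g x = z at h4
    exact HasSum.prod_fiberwise h4 h6

lemma fourierCoeff_mul_summable (hf : IsWiener f) (hg : IsWiener g) :
    Summable fun n : ℤ => ‖∑' k, fourierCoeff f k * fourierCoeff g (n - k)‖ :=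
  (hf.mul_aux hg).1.prod.of_nonneg_of_le (fun _ => norm_nonneg _) fun n =>
    norm_tsum_le_tsum_norm ((hf.mul_aux hg).1.prod_factor n)

lemma fourierCoeff_mul (hf : IsWiener f) (hg : IsWiener g) (n : ℤ) :
    fourierCoeff (fun x => f x * g x) n = ∑' k, fourierCoeff f k * fourierCoeff g (n - k) :=
  (fourierCoeff_of_hasSum (hf.fourierCoeff_mul_summable hg) (hf.mul_aux hg).2.2).2 n

lemma mul (hf : IsWiener f) (hg : IsWiener g) : IsWiener (fun x => f x * g x) :=
  isWiener_of_hasSum (hf.fourierCoeff_mul_summable hg) (hf.mul_aux hg).2.2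

lemma wnorm_mul_le (hf : IsWiener f) (hg : IsWiener g) :
    wnorm (fun x => f x * g x) ≤ wnorm f * wnorm g := by
  rw [← (hf.mul_aux hg).2.1, (hf.mul_aux hg).1.tsum_prod, wnorm]
  simp_rw [hf.fourierCoeff_mul hg]
  exact (hf.fourierCoeff_mul_summable hg).tsum_le_tsum (fun n =>
    norm_tsum_le_tsum_norm ((hf.mul_aux hg).1.prod_factor n)) (hf.mul_aux hg).1.prod

lemma _root_.DampedSzego.fourierCoeff_conj (f : Torus → ℂ) (n : ℤ) :
    fourierCoeff (fun x => (starRingEnd ℂ) (f x)) n = (starRingEnd ℂ) (fourierCoeff f (-n)) := by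
  rw [fourierCoeff, fourierCoeff, ← integral_conj]
  congr 1; funext x
  simp only [smul_eq_mul, map_mul]
  rw [← fourier_neg, neg_neg]

lemma conj (hf : IsWiener f) : IsWiener (fun x => (starRingEnd ℂ) (f x)) := by
  refine ⟨Complex.continuous_conj.comp hf.1, ?_⟩
  simp_rw [fourierCoeff_conj, RCLike.norm_conj]
  exact (Equiv.neg ℤ).summable_iff.mpr hf.2

lemma _root_.DampedSzego.wnorm_conj (f : Torus → ℂ) :
    wnorm (fun x => (starRingEnd ℂ) (f x)) = wnorm f := by
  simp_rw [wnorm, fourierCoeff_conj, RCLike.norm_conj]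
  exact (Equiv.neg ℤ).tsum_eq (fun k => ‖fourierCoeff f k‖)

end IsWiener

lemma fourierCoeff_const (c : ℂ) (n : ℤ) :
    fourierCoeff (fun _ : Torus => c) n = if n = 0 then c else 0 := by
  have h := fourierCoeff.const_mul (fun x : Torus => (fourier 0 x : ℂ)) c n
  rw [fourierCoeff_fourier_apply] at h
  simp only [fourier_zero, mul_one] at h
  rw [h]; simp [eq_comm]

lemma isWiener_const (c : ℂ) : IsWiener (fun _ => c) := by
  refine ⟨continuous_const, ?_⟩
  simp_rw [fourierCoeff_const]
  exact summable_of_ne_finset_zero (s := {0}) (fun n hn => by simp at hn; simp [hn])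

lemma wnorm_const (c : ℂ) : wnorm (fun _ => c) = ‖c‖ := by
  rw [wnorm, tsum_eq_single 0 (fun n hn => by rw [fourierCoeff_const]; simp [hn]),
    fourierCoeff_const]; simp

lemma isWiener_fourier (k : ℤ) : IsWiener (fun x => fourier k x) := by
  refine ⟨(fourier k).continuous, ?_⟩
  simp_rw [fourierCoeff_fourier_apply]
  exact summable_of_ne_finset_zero (s := {k}) (fun n hn => by
    simp at hn; simp [Ne.symm hn])

lemma wnorm_fourier (k : ℤ) : wnorm (fun x => fourier k x) = 1 := by
  rw [wnorm, tsum_eq_single k (fun n hn => by rw [fourierCoeff_fourier_apply]; simp [Ne.symm hn]),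
    fourierCoeff_fourier_apply]; simp

lemma norm_fourierCoeff_le_wnorm {f : Torus → ℂ} (hf : IsWiener f) (n : ℤ) :
    ‖fourierCoeff f n‖ ≤ wnorm f :=
  hf.2.le_tsum n fun _ _ => norm_nonneg _

lemma eq_zero_of_wnorm {f : Torus → ℂ} (hf : IsWiener f) (h : wnorm f = 0) : f = 0 := by
  funext x
  have := hf.norm_le x
  rw [h] at this
  simpa using this

/-! ### The operators of the equation on the Wiener algebra -/

lemma szego_aux {f : Torus → ℂ} (hf : IsWiener f) :
    Summable (fun k : ℤ => ‖if 0 ≤ k then fourierCoeff f k else 0‖) ∧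
    ∀ x, HasSum (fun k : ℤ => (if 0 ≤ k then fourierCoeff f k else 0) * fourier k x)
      (szego f x) := by
  have hs : Summable (fun k : ℤ => ‖if 0 ≤ k then fourierCoeff f k else 0‖) :=
    hf.2.of_nonneg_of_le (fun _ => norm_nonneg _) fun k => by split_ifs <;> simp
  refine ⟨hs, fun x => ?_⟩
  have hs' : Summable (fun k : ℤ => (if 0 ≤ k then fourierCoeff f k else 0) * fourier k x) := by
    apply Summable.of_norm
    simpa only [norm_mul, norm_fourier_apply, mul_one] using hs
  have hinj : Function.Injective (Nat.cast : ℕ → ℤ) := Nat.cast_injective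
  have hsupp : ∀ k ∉ Set.range (Nat.cast : ℕ → ℤ),
      (if 0 ≤ k then fourierCoeff f k else 0) * (fourier k x : ℂ) = 0 := fun k hk => by
    rw [if_neg, zero_mul]
    intro h
    exact hk ⟨k.toNat, Int.toNat_of_nonneg h⟩
  have h1 := (hinj.hasSum_iff hsupp).mpr (hs'.hasSum)
  have h2 : szego f x = ∑' k : ℤ, (if 0 ≤ k then fourierCoeff f k else 0) * fourier k x := by
    rw [← h1.tsum_eq, szego]
    exact tsum_congr fun k => by simp
  rw [h2]; exact hs'.hasSum

lemma fourierCoeff_szego {f : Torus → ℂ} (hf : IsWiener f) (n : ℤ) :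
    fourierCoeff (szego f) n = if 0 ≤ n then fourierCoeff f n else 0 :=
  (fourierCoeff_of_hasSum (szego_aux hf).1 (szego_aux hf).2).2 n

lemma IsWiener.szego {f : Torus → ℂ} (hf : IsWiener f) : IsWiener (szego f) :=
  isWiener_of_hasSum (szego_aux hf).1 (szego_aux hf).2

lemma wnorm_szego_le {f : Torus → ℂ} (hf : IsWiener f) : wnorm (szego f) ≤ wnorm f := by
  refine hf.szego.2.tsum_le_tsum (fun n => ?_) hf.2
  rw [fourierCoeff_szego hf]; split_ifs <;> simp

lemma szego_sub {f g : Torus → ℂ} (hf : IsWiener f) (hg : IsWiener g) :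
    szego (f - g) = szego f - szego g := by
  refine IsWiener.ext (hf.sub hg).szego (hf.szego.sub hg.szego) fun n => ?_
  rw [fourierCoeff_sub hf.szego.1 hg.szego.1, fourierCoeff_szego hf, fourierCoeff_szego hg,
    fourierCoeff_szego (hf.sub hg), fourierCoeff_sub hf.1 hg.1]
  split_ifs <;> simp

lemma IsWiener.shift {f : Torus → ℂ} (hf : IsWiener f) : IsWiener (shift f) :=
  (isWiener_fourier 1).mul hf

lemma wnorm_shift_le {f : Torus → ℂ} (hf : IsWiener f) : wnorm (shift f) ≤ wnorm f := by
  have := (isWiener_fourier 1).wnorm_mul_le hf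
  rwa [wnorm_fourier, one_mul] at this

lemma IsWiener.shiftAdj {f : Torus → ℂ} (hf : IsWiener f) : IsWiener (shiftAdj f) :=
  (isWiener_fourier (-1)).mul (hf.sub (isWiener_const (mean f)))

lemma mean_sub {f g : Torus → ℂ} (hf : IsWiener f) (hg : IsWiener g) :
    mean (f - g) = mean f - mean g := by
  rw [mean_eq, mean_eq, mean_eq, fourierCoeff_sub hf.1 hg.1]

lemma norm_mean_le {f : Torus → ℂ} (hf : IsWiener f) : ‖mean f‖ ≤ wnorm f := by
  rw [mean_eq]; exact norm_fourierCoeff_le_wnorm hf 0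

lemma wnorm_shiftAdj_le {f : Torus → ℂ} (hf : IsWiener f) :
    wnorm (shiftAdj f) ≤ 2 * wnorm f := by
  have h1 := (isWiener_fourier (-1)).wnorm_mul_le (hf.sub (isWiener_const (mean f)))
  rw [wnorm_fourier, one_mul] at h1
  have h2 := hf.wnorm_sub_le (isWiener_const (mean f))
  rw [wnorm_const] at h2
  have h3 := norm_mean_le hf
  exact h1.trans (h2.trans (by linarith))

lemma shift_sub (f g : Torus → ℂ) : shift (f - g) = shift f - shift g := by
  funext x; simp only [shift, Pi.sub_apply]; ring

lemma shiftAdj_sub {f g : Torus → ℂ} (hf : IsWiener f) (hg : IsWiener g) :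
    shiftAdj (f - g) = shiftAdj f - shiftAdj g := by
  funext x; simp only [shiftAdj, Pi.sub_apply, mean_sub hf hg]; ring

lemma cubic_eq (f : Torus → ℂ) :
    cubic f = fun x => f x * ((starRingEnd ℂ) (f x) * f x) := by
  funext x
  simp only [cubic]
  rw [← mul_assoc, Complex.mul_conj, Complex.normSq_eq_norm_sq]

lemma IsWiener.cubic {f : Torus → ℂ} (hf : IsWiener f) : IsWiener (cubic f) := by
  rw [cubic_eq]; exact hf.mul (hf.conj.mul hf)

lemma wnorm_cubic_sub_le {f g : Torus → ℂ} {K : ℝ} (hf : IsWiener f) (hg : IsWiener g)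
    (hfK : wnorm f ≤ K) (hgK : wnorm g ≤ K) :
    wnorm (cubic f - cubic g) ≤ 3 * K ^ 2 * wnorm (f - g) := by
  have hd := hf.sub hg
  have e : cubic f - cubic g =
      ((fun x => (f - g) x * ((starRingEnd ℂ) (f x) * f x)) +
       (fun x => g x * ((starRingEnd ℂ) ((f - g) x) * f x))) +
       (fun x => g x * ((starRingEnd ℂ) (g x) * (f - g) x)) := by
    rw [cubic_eq, cubic_eq]
    funext x
    simp only [Pi.sub_apply, Pi.add_apply, map_sub]; ring
  have h1 := hd.mul (hf.conj.mul hf)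
  have h2 := hg.mul (hd.conj.mul hf)
  have h3 := hg.mul (hg.conj.mul hd)
  have n1 := (hd.wnorm_mul_le (hf.conj.mul hf)).trans
    (mul_le_mul_of_nonneg_left (hf.conj.wnorm_mul_le hf) (wnorm_nonneg _))
  have n2 := (hg.wnorm_mul_le (hd.conj.mul hf)).trans
    (mul_le_mul_of_nonneg_left (hd.conj.wnorm_mul_le hf) (wnorm_nonneg _))
  have n3 := (hg.wnorm_mul_le (hg.conj.mul hd)).trans
    (mul_le_mul_of_nonneg_left (hg.conj.wnorm_mul_le hd) (wnorm_nonneg _))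
  rw [wnorm_conj] at n1 n2 n3
  rw [e]
  refine ((h1.add h2).wnorm_add_le h3).trans ?_
  refine (add_le_add_left (h1.wnorm_add_le h2) _).trans ?_
  have a := wnorm_nonneg f
  have b := wnorm_nonneg g
  have c := wnorm_nonneg (f - g)
  have q1 : wnorm f * wnorm f ≤ K ^ 2 := by nlinarith
  have q2 : wnorm g * wnorm f ≤ K ^ 2 := by nlinarith
  have q3 : wnorm g * wnorm g ≤ K ^ 2 := by nlinarith
  nlinarith

end
end DampedSzego
namespace DampedSzego
noncomputable section

/-! ### The vector field of the equation on the Wiener algebra -/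

/-- The right-hand side of the equation, once it is solved for `∂ₜ u`. -/
def field (ν α β : ℝ) (u : Torus → ℂ) : Torus → ℂ :=
  fun x => -Complex.I * (szego (cubic u) x + α * mean u
    - β * shift (szego (cubic (shiftAdj u))) x) - ν * mean u

lemma field_eq (ν α β : ℝ) (u : Torus → ℂ) :
    field ν α β u = ((fun x => -Complex.I * szego (cubic u) x) +
      fun _ => -(Complex.I * α + ν) * mean u) +
      fun x => (Complex.I * β) * shift (szego (cubic (shiftAdj u))) x := by
  funext x; simp only [field, Pi.add_apply]; ring

lemma IsWiener.field {u : Torus → ℂ} (hu : IsWiener u) (ν α β : ℝ) :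
    IsWiener (field ν α β u) := by
  rw [field_eq]
  exact ((hu.cubic.szego.const_mul _).add (isWiener_const _)).add
    (hu.shiftAdj.cubic.szego.shift.const_mul _)

lemma wnorm_field_sub_le (ν α β : ℝ) {u v : Torus → ℂ} {K : ℝ} (hu : IsWiener u)
    (hv : IsWiener v) (huK : wnorm u ≤ K) (hvK : wnorm v ≤ K) :
    wnorm (field ν α β u - field ν α β v) ≤
      (3 * K ^ 2 + (|α| + |ν|) + |β| * (24 * K ^ 2)) * wnorm (u - v) := by
  have e : field ν α β u - field ν α β v =
      ((fun x => -Complex.I * szego (cubic u - cubic v) x) +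
      fun _ => -(Complex.I * α + ν) * mean (u - v)) +
      fun x => (Complex.I * β) *
        shift (szego (cubic (shiftAdj u) - cubic (shiftAdj v))) x := by
    rw [field_eq, field_eq, szego_sub hu.cubic hv.cubic,
      szego_sub hu.shiftAdj.cubic hv.shiftAdj.cubic, shift_sub, mean_sub hu hv]
    funext x; simp only [Pi.add_apply, Pi.sub_apply]; ring
  have w1 := hu.cubic.sub hv.cubic
  have w3 := hu.shiftAdj.cubic.sub hv.shiftAdj.cubic
  rw [e]
  refine (((w1.szego.const_mul _).add (isWiener_const _)).wnorm_add_le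
    (w3.szego.shift.const_mul _)).trans ?_
  refine (add_le_add_left ((w1.szego.const_mul _).wnorm_add_le (isWiener_const _)) _).trans ?_
  rw [wnorm_const_mul (szego _), wnorm_const_mul (shift _), wnorm_const, norm_mul, norm_mul,
    norm_neg, norm_neg, Complex.norm_I, Complex.norm_real, Real.norm_eq_abs]
  have h1 := (wnorm_szego_le w1).trans (wnorm_cubic_sub_le hu hv huK hvK)
  have h2 := norm_mean_le (hu.sub hv)
  have h3 := ((wnorm_shift_le w3.szego).trans (wnorm_szego_le w3)).trans
    (wnorm_cubic_sub_le (K := 2 * K) hu.shiftAdj hv.shiftAdj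
      ((wnorm_shiftAdj_le hu).trans (by linarith)) ((wnorm_shiftAdj_le hv).trans (by linarith)))
  rw [← shiftAdj_sub hu hv] at h3
  have h4 := wnorm_shiftAdj_le (hu.sub hv)
  have h5 : ‖Complex.I * (α : ℂ) + ν‖ ≤ |α| + |ν| := by
    refine (norm_add_le _ _).trans ?_
    rw [norm_mul, Complex.norm_I, Complex.norm_real, Complex.norm_real]; simp
  have h6 : wnorm (shift (szego (cubic (shiftAdj u) - cubic (shiftAdj v)))) ≤
      24 * K ^ 2 * wnorm (u - v) :=
    h3.trans (by nlinarith [sq_nonneg K])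
  have h7 := mul_le_mul h5 h2 (norm_nonneg _) (by positivity)
  have h8 := mul_le_mul_of_nonneg_left h6 (abs_nonneg β)
  linarith

lemma wnorm_field_le (ν α β : ℝ) {u : Torus → ℂ} {K : ℝ} (hu : IsWiener u) (huK : wnorm u ≤ K) :
    wnorm (field ν α β u) ≤ (3 * K ^ 2 + (|α| + |ν|) + |β| * (24 * K ^ 2)) * K := by
  have h0 : IsWiener (0 : Torus → ℂ) := isWiener_const 0
  have hw0 : wnorm (0 : Torus → ℂ) = 0 := by
    have := wnorm_const 0
    rw [norm_zero] at this; exact this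
  have hf0 : field ν α β 0 = 0 := by
    have hc : cubic (0 : Torus → ℂ) = 0 := by funext x; simp [cubic]
    have hm : mean (0 : Torus → ℂ) = 0 := by simp [mean]
    have hs : szego (0 : Torus → ℂ) = 0 := by funext x; simp [szego, fourierCoeff]
    have hS : shiftAdj (0 : Torus → ℂ) = 0 := by funext x; simp [shiftAdj, hm]
    have hT : shift (0 : Torus → ℂ) = 0 := by funext x; simp [shift]
    funext x
    simp [field, hc, hm, hs, hS, hT]
  have := wnorm_field_sub_le ν α β hu h0 huK (hw0.le.trans ((wnorm_nonneg u).trans huK))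
  rw [hf0, sub_zero, sub_zero] at this
  exact this.trans (mul_le_mul_of_nonneg_left huK (by positivity))

/-! ### Sobolev regularity and the Wiener algebra -/

/-- Finiteness of the `H^r` norm. -/
def HsFinite (r : ℝ) (f : Torus → ℂ) : Prop :=
  Summable fun k : ℤ => (1 + (k : ℝ) ^ 2) ^ r * ‖fourierCoeff f k‖ ^ 2

lemma summable_one_add_sq_rpow_neg {r : ℝ} (hr : 1 / 2 < r) :
    Summable fun k : ℤ => (1 + (k : ℝ) ^ 2) ^ (-r) := by
  have h1 : Summable fun k : ℤ => |(k : ℝ)| ^ (-(2 * r)) + if k = 0 then (1 : ℝ) else 0 :=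
    (Real.summable_abs_int_rpow (by linarith)).add
      (summable_of_ne_finset_zero (s := {0}) (fun n hn => by simp at hn; simp [hn]))
  refine h1.of_nonneg_of_le (fun k => by positivity) fun k => ?_
  by_cases hk : k = 0
  · subst hk
    have : (0 : ℝ) ≤ |((0 : ℤ) : ℝ)| ^ (-(2 * r)) := by positivity
    simpa using this
  · have hk' : (0 : ℝ) < |(k : ℝ)| := abs_pos.mpr (by exact_mod_cast hk)
    simp only [hk, if_false, add_zero]
    have : |(k : ℝ)| ^ (-(2 * r)) = ((k : ℝ) ^ 2) ^ (-r) := by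
      rw [← sq_abs, ← Real.rpow_natCast, ← Real.rpow_mul hk'.le]; congr 1; push_cast; ring
    rw [this]
    exact Real.rpow_le_rpow_of_nonpos (by positivity) (by linarith) (by linarith)

lemma HsFinite.wiener_bound {r : ℝ} (hr : 1 / 2 < r) {f : Torus → ℂ} (h : HsFinite r f) :
    (Summable fun k : ℤ => ‖fourierCoeff f k‖) ∧
    wnorm f ≤ ((∑' k : ℤ, (1 + (k : ℝ) ^ 2) ^ (-r)) + hsNorm r f ^ 2) / 2 := by
  have hs := summable_one_add_sq_rpow_neg hr
  have hle : ∀ k : ℤ, ‖fourierCoeff f k‖ ≤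
      ((1 + (k : ℝ) ^ 2) ^ (-r) + (1 + (k : ℝ) ^ 2) ^ r * ‖fourierCoeff f k‖ ^ 2) / 2 := by
    intro k
    have hpos : (0 : ℝ) < (1 + (k : ℝ) ^ 2) := by positivity
    have hA : (0 : ℝ) < (1 + (k : ℝ) ^ 2) ^ r := Real.rpow_pos_of_pos hpos _
    rw [Real.rpow_neg hpos.le]
    generalize (1 + (k : ℝ) ^ 2) ^ r = A at hA
    have := sq_nonneg (A * ‖fourierCoeff f k‖ - 1)
    have h2 : 0 ≤ A⁻¹ * (A * ‖fourierCoeff f k‖ - 1) ^ 2 := by positivity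
    have h3 : A⁻¹ * (A * ‖fourierCoeff f k‖ - 1) ^ 2 =
        A * ‖fourierCoeff f k‖ ^ 2 - 2 * ‖fourierCoeff f k‖ + A⁻¹ := by
      field_simp; ring
    linarith
  have hS := (hs.add h).div_const 2
  have hsum : Summable fun k : ℤ => ‖fourierCoeff f k‖ :=
    hS.of_nonneg_of_le (fun _ => norm_nonneg _) hle
  refine ⟨hsum, ?_⟩
  have hsq : hsNorm r f ^ 2 = ∑' k : ℤ, (1 + (k : ℝ) ^ 2) ^ r * ‖fourierCoeff f k‖ ^ 2 :=
    Real.sq_sqrt (tsum_nonneg fun k => by positivity)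
  rw [hsq, ← hs.tsum_add h, ← tsum_div_const]
  exact hsum.tsum_le_tsum hle hS

lemma HsFinite.sub {r : ℝ} {f g : Torus → ℂ} (hf : HsFinite r f) (hg : HsFinite r g)
    (hfc : Continuous f) (hgc : Continuous g) : HsFinite r (f - g) := by
  refine ((hf.mul_left 2).add (hg.mul_left 2)).of_nonneg_of_le (fun k => by positivity) fun k => ?_
  rw [fourierCoeff_sub hfc hgc]
  have hA : (0 : ℝ) ≤ (1 + (k : ℝ) ^ 2) ^ r := by positivity
  have h1 := norm_sub_le (fourierCoeff f k) (fourierCoeff g k)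
  have h2 : ‖fourierCoeff f k - fourierCoeff g k‖ ^ 2 ≤
      2 * ‖fourierCoeff f k‖ ^ 2 + 2 * ‖fourierCoeff g k‖ ^ 2 := by
    nlinarith [sq_nonneg (‖fourierCoeff f k‖ - ‖fourierCoeff g k‖),
      norm_nonneg (fourierCoeff f k - fourierCoeff g k)]
  calc _ ≤ (1 + (k : ℝ) ^ 2) ^ r * (2 * ‖fourierCoeff f k‖ ^ 2 + 2 * ‖fourierCoeff g k‖ ^ 2) :=
        mul_le_mul_of_nonneg_left h2 hA
    _ = _ := by ring

lemma MemHsPlus.isWiener {r : ℝ} (hr : 1 / 2 < r) {f : Torus → ℂ} (h : MemHsPlus r f) :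
    IsWiener f :=
  ⟨h.1, (HsFinite.wiener_bound hr h.2.2).1⟩

/-! ### Uniqueness for the Cauchy problem -/

namespace IsSolution

variable {ν α β : ℝ} {u v : ℝ → Torus → ℂ}

lemma isWiener (hu : IsSolution ν α β u) (t : ℝ) : IsWiener (u t) := by
  obtain ⟨r, hr, hm, -⟩ := hu.continuous_hs
  exact (hm t).isWiener hr

lemma eventually_wnorm_le (hu : IsSolution ν α β u) (t : ℝ) :
    ∃ K : ℝ, ∀ᶠ τ in 𝓝 t, wnorm (u τ) ≤ K := by
  obtain ⟨r, hr, hm, hc⟩ := hu.continuous_hs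
  refine ⟨wnorm (u t) + ((∑' k : ℤ, (1 + (k : ℝ) ^ 2) ^ (-r)) + 1 ^ 2) / 2, ?_⟩
  have h1 : ∀ᶠ τ in 𝓝 t, hsNorm r (u τ - u t) < 1 :=
    (hc t).eventually (gt_mem_nhds one_pos)
  filter_upwards [h1] with τ hτ
  have hf : HsFinite r (u τ - u t) := HsFinite.sub (hm τ).2.2 (hm t).2.2 (hm τ).1 (hm t).1
  have hb := (hf.wiener_bound hr).2
  have h2 := ((hu.isWiener τ).sub (hu.isWiener t)).wnorm_add_le (hu.isWiener t)
  rw [sub_add_cancel] at h2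
  have h3 : hsNorm r (u τ - u t) ^ 2 ≤ 1 ^ 2 :=
    pow_le_pow_left₀ (Real.sqrt_nonneg _) hτ.le 2
  linarith

lemma hasDerivAt (hu : IsSolution ν α β u) (t : ℝ) (x : Torus) :
    HasDerivAt (fun τ => u τ x) (field ν α β (u t) x) t := by
  obtain ⟨d, hd, he⟩ := hu.equation t x
  have : d = field ν α β (u t) x := by
    rw [field, ← he]
    linear_combination (d + ν * mean (u t)) * Complex.I_mul_I
  rwa [← this]

lemma hasDerivAt_fourierCoeff (hu : IsSolution ν α β u) (t : ℝ) (n : ℤ) :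
    HasDerivAt (fun τ => fourierCoeff (u τ) n) (fourierCoeff (field ν α β (u t)) n) t := by
  obtain ⟨K, hK⟩ := hu.eventually_wnorm_le t
  have hc : ∀ f : Torus → ℂ, Continuous f → Continuous fun x => fourier (-n) x • f x :=
    fun f hf => (fourier (-n)).continuous.smul hf
  refine (hasDerivAt_integral_of_dominated_loc_of_deriv_le (𝕜 := ℝ)
    (F := fun τ x => fourier (-n) x • u τ x) (F' := fun τ x => fourier (-n) x • field ν α β (u τ) x)
    (bound := fun _ => (3 * K ^ 2 + (|α| + |ν|) + |β| * (24 * K ^ 2)) * K)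
    hK ?_ ?_ ?_ ?_ ?_ ?_).2
  · exact Eventually.of_forall fun τ => (hc _ (hu.isWiener τ).1).aestronglyMeasurable
  · exact integrable_of_continuous (hc _ (hu.isWiener t).1)
  · exact (hc _ ((hu.isWiener t).field ν α β).1).aestronglyMeasurable
  · refine Eventually.of_forall fun x τ hτ => ?_
    rw [norm_smul, norm_fourier_apply, one_mul]
    exact (((hu.isWiener τ).field ν α β).norm_le x).trans
      (wnorm_field_le ν α β (hu.isWiener τ) hτ)
  · exact integrable_const _
  · exact Eventually.of_forall fun x τ _ => (hu.hasDerivAt τ x).const_smul (fourier (-n) x)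

/-- On a short interval the difference of two solutions with the same initial value is halved by
the integral form of the equation, hence vanishes. -/
lemma eventually_eq (hu : IsSolution ν α β u) (hv : IsSolution ν α β v) {t₀ : ℝ}
    (h : u t₀ = v t₀) : ∀ᶠ t in 𝓝 t₀, u t = v t := by
  obtain ⟨K₁, hK₁⟩ := hu.eventually_wnorm_le t₀
  obtain ⟨K₂, hK₂⟩ := hv.eventually_wnorm_le t₀
  set K := max K₁ K₂
  set C := 3 * K ^ 2 + (|α| + |ν|) + |β| * (24 * K ^ 2) with hC
  have hC0 : 0 ≤ C := by positivity
  obtain ⟨ε, hε, hball⟩ := Metric.eventually_nhds_iff_ball.mp (hK₁.and hK₂)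
  set δ := min ε (1 / (2 * (C + 1)))
  have hδ : 0 < δ := lt_min hε (by positivity)
  have hδC : C * δ ≤ 1 / 2 := by
    have h1 : δ ≤ 1 / (2 * (C + 1)) := min_le_right _ _
    calc C * δ ≤ C * (1 / (2 * (C + 1))) := mul_le_mul_of_nonneg_left h1 hC0
      _ ≤ 1 / 2 := by
        rw [mul_one_div, div_le_div_iff₀ (by positivity) (by positivity)]; linarith
  have hK : ∀ t ∈ Metric.ball t₀ δ, wnorm (u t) ≤ K ∧ wnorm (v t) ≤ K := fun t ht => by
    have := hball t (Metric.ball_subset_ball (min_le_left _ _) ht)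
    exact ⟨this.1.trans (le_max_left _ _), this.2.trans (le_max_right _ _)⟩
  have hd : ∀ t, IsWiener (u t - v t) := fun t => (hu.isWiener t).sub (hv.isWiener t)
  have step : ∀ B : ℝ, (∀ t ∈ Metric.ball t₀ δ, wnorm (u t - v t) ≤ B) →
      ∀ t ∈ Metric.ball t₀ δ, wnorm (u t - v t) ≤ B / 2 := by
    intro B hB t₁ ht₁
    have hB0 : 0 ≤ B := (wnorm_nonneg _).trans (hB t₁ ht₁)
    refine (hd t₁).2.tsum_le_of_sum_le fun s => ?_
    -- testing against unimodular constants turns the finite sum of norms into a single function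
    choose! e he1 he2 using fun k : ℤ => RCLike.exists_norm_eq_mul_self
      (K := ℂ) (fourierCoeff (u t₁ - v t₁) k)
    have hder : ∀ t, HasDerivAt
        (fun τ => ∑ k ∈ s, e k * (fourierCoeff (u τ) k - fourierCoeff (v τ) k))
        (∑ k ∈ s, e k * (fourierCoeff (field ν α β (u t)) k
          - fourierCoeff (field ν α β (v t)) k)) t := fun t =>
      HasDerivAt.fun_sum fun k _ => ((hu.hasDerivAt_fourierCoeff t k).sub
        (hv.hasDerivAt_fourierCoeff t k)).const_mul _
    have hbound : ∀ t ∈ Metric.ball t₀ δ,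
        ‖∑ k ∈ s, e k * (fourierCoeff (field ν α β (u t)) k
          - fourierCoeff (field ν α β (v t)) k)‖ ≤ C * B := by
      intro t ht
      have hw := ((hu.isWiener t).field ν α β).sub ((hv.isWiener t).field ν α β)
      refine (norm_sum_le _ _).trans ?_
      calc _ = ∑ k ∈ s, ‖fourierCoeff (field ν α β (u t) - field ν α β (v t)) k‖ := by
            refine Finset.sum_congr rfl fun k _ => ?_
            rw [norm_mul, he1, one_mul, fourierCoeff_sub ((hu.isWiener t).field ν α β).1
              ((hv.isWiener t).field ν α β).1]
        _ ≤ wnorm (field ν α β (u t) - field ν α β (v t)) :=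
            hw.2.sum_le_tsum s fun _ _ => norm_nonneg _
        _ ≤ C * wnorm (u t - v t) :=
            wnorm_field_sub_le ν α β (hu.isWiener t) (hv.isWiener t) (hK t ht).1 (hK t ht).2
        _ ≤ C * B := mul_le_mul_of_nonneg_left (hB t ht) hC0
    have hmv := (convex_ball t₀ δ).norm_image_sub_le_of_norm_hasDerivWithin_le
      (fun t _ => (hder t).hasDerivWithinAt) hbound (Metric.mem_ball_self hδ) ht₁
    simp only [h, sub_self, mul_zero, Finset.sum_const_zero, sub_zero] at hmv
    have hsum : (∑ k ∈ s, e k * (fourierCoeff (u t₁) k - fourierCoeff (v t₁) k)) =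
        ((∑ k ∈ s, ‖fourierCoeff (u t₁ - v t₁) k‖ : ℝ) : ℂ) := by
      push_cast
      refine Finset.sum_congr rfl fun k _ => ?_
      rw [← fourierCoeff_sub (hu.isWiener t₁).1 (hv.isWiener t₁).1]
      exact (he2 k).symm
    rw [hsum, Complex.norm_real, Real.norm_of_nonneg
      (Finset.sum_nonneg fun _ _ => norm_nonneg _)] at hmv
    have ht : ‖t₁ - t₀‖ ≤ δ := (mem_ball_iff_norm.mp ht₁).le
    calc _ ≤ C * B * ‖t₁ - t₀‖ := hmv
      _ ≤ C * B * δ := mul_le_mul_of_nonneg_left ht (by positivity)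
      _ = (C * δ) * B := by ring
      _ ≤ 1 / 2 * B := mul_le_mul_of_nonneg_right hδC hB0
      _ = B / 2 := by ring
  have hiter : ∀ n : ℕ, ∀ t ∈ Metric.ball t₀ δ, wnorm (u t - v t) ≤ 2 * K / 2 ^ n := by
    intro n
    induction n with
    | zero =>
      intro t ht
      have := (hu.isWiener t).wnorm_sub_le (hv.isWiener t)
      have h2 := hK t ht
      simp only [pow_zero, div_one]; linarith
    | succ n ih =>
      intro t ht
      refine (step _ ih t ht).trans_eq ?_
      rw [pow_succ]; field_simp
  filter_upwards [Metric.ball_mem_nhds t₀ hδ] with t ht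
  have hlim : Tendsto (fun n : ℕ => 2 * K / 2 ^ n) atTop (𝓝 0) :=
    tendsto_const_nhds.div_atTop (tendsto_pow_atTop_atTop_of_one_lt one_lt_two)
  have h0 : wnorm (u t - v t) ≤ 0 := ge_of_tendsto' hlim fun n => hiter n t ht
  exact sub_eq_zero.mp (eq_zero_of_wnorm (hd t) (le_antisymm h0 (wnorm_nonneg _)))

lemma unique (hu : IsSolution ν α β u) (hv : IsSolution ν α β v) (h : u 0 = v 0) : u = v := by
  have hclosed : IsClosed {t | u t = v t} := by
    have : {t | u t = v t} = ⋂ x, {t | u t x = v t x} := by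
      ext t; simp [funext_iff]
    rw [this]
    refine isClosed_iInter fun x => isClosed_eq ?_ ?_
    · exact continuous_iff_continuousAt.mpr fun t => (hu.hasDerivAt t x).continuousAt
    · exact continuous_iff_continuousAt.mpr fun t => (hv.hasDerivAt t x).continuousAt
  have hopen : IsOpen {t | u t = v t} := isOpen_iff_mem_nhds.mpr fun t ht =>
    hu.eventually_eq hv ht
  have := IsClopen.eq_univ ⟨hclosed, hopen⟩ ⟨0, h⟩
  funext t
  exact (this.symm ▸ Set.mem_univ t : t ∈ {t | u t = v t})

end IsSolution

end
end DampedSzego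
namespace DampedSzego
noncomputable section

/-! ### The Szegő projection of rational functions -/

/-- The Wiener functions all of whose Fourier modes are nonnegative. -/
def IsHardy (f : Torus → ℂ) : Prop := IsWiener f ∧ ∀ n < 0, fourierCoeff f n = 0

lemma isHardy_of_hasSum {f : Torus → ℂ} {a : ℕ → ℂ} (ha : Summable fun k => ‖a k‖)
    (h : ∀ x, HasSum (fun k : ℕ => a k * fourier (k : ℤ) x) (f x)) :
    IsHardy f ∧ ∀ n : ℕ, fourierCoeff f n = a n := by
  have hinj : Function.Injective (Nat.cast : ℕ → ℤ) := Nat.cast_injective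
  let a' : ℤ → ℂ := fun k => if 0 ≤ k then a k.toNat else 0
  have hout : ∀ k ∉ Set.range (Nat.cast : ℕ → ℤ), a' k = 0 := fun k hk =>
    if_neg fun h => hk ⟨k.toNat, Int.toNat_of_nonneg h⟩
  have hin : ∀ n : ℕ, a' n = a n := fun n => by simp [a']
  have hs : Summable fun k => ‖a' k‖ := by
    refine (hinj.summable_iff fun k hk => by rw [hout k hk, norm_zero]).mp ?_
    simpa only [Function.comp_def, hin] using ha
  have hS : ∀ x, HasSum (fun k => a' k * fourier k x) (f x) := fun x => by
    refine (hinj.hasSum_iff fun k hk => by rw [hout k hk, zero_mul]).mp ?_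
    simpa only [Function.comp_def, hin] using h x
  refine ⟨⟨isWiener_of_hasSum hs hS, fun n hn => ?_⟩, fun n => ?_⟩
  · rw [(fourierCoeff_of_hasSum hs hS).2]
    exact if_neg (not_le.mpr hn)
  · rw [(fourierCoeff_of_hasSum hs hS).2, hin]

lemma fourierCoeff_fourier_mul (f : Torus → ℂ) (k n : ℤ) :
    fourierCoeff (fun x => fourier k x * f x) n = fourierCoeff f (n - k) := by
  rw [fourierCoeff, fourierCoeff]
  congr 1; funext x
  rw [neg_sub, sub_eq_add_neg, add_comm, fourier_add, smul_eq_mul, smul_eq_mul, mul_assoc]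

namespace IsHardy

variable {f g : Torus → ℂ}

lemma add (hf : IsHardy f) (hg : IsHardy g) : IsHardy (fun x => f x + g x) :=
  ⟨hf.1.add hg.1, fun n hn => by
    have := fourierCoeff_add hf.1.1 hg.1.1 n
    rw [hf.2 n hn, hg.2 n hn, add_zero] at this
    exact this⟩

lemma const_mul (hf : IsHardy f) (c : ℂ) : IsHardy (fun x => c * f x) :=
  ⟨hf.1.const_mul c, fun n hn => by rw [fourierCoeff.const_mul, hf.2 n hn, mul_zero]⟩

lemma mul (hf : IsHardy f) (hg : IsHardy g) : IsHardy (fun x => f x * g x) := by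
  refine ⟨hf.1.mul hg.1, fun n hn => ?_⟩
  rw [hf.1.fourierCoeff_mul hg.1]
  refine (tsum_congr fun k => ?_).trans tsum_zero
  rcases lt_or_ge k 0 with hk | hk
  · rw [hf.2 k hk, zero_mul]
  · rw [hg.2 _ (by lia), mul_zero]

lemma const (c : ℂ) : IsHardy (fun _ => c) :=
  ⟨isWiener_const c, fun n hn => by rw [fourierCoeff_const, if_neg hn.ne]⟩

lemma fourier_one : IsHardy (fun x => fourier 1 x) :=
  ⟨isWiener_fourier 1, fun n hn => by rw [fourierCoeff_fourier_apply, if_neg (by lia)]⟩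

end IsHardy

/-- The Szegő projector removes the part of a function with negative Fourier modes. -/
lemma szego_eq_of_decomposition {f g h : Torus → ℂ} (hf : IsHardy f) (hg : IsHardy g)
    (hg0 : fourierCoeff g 0 = 0) (e : ∀ x, h x = f x + (starRingEnd ℂ) (g x)) :
    szego h = f := by
  have hh : h = f + fun x => (starRingEnd ℂ) (g x) := funext e
  have hw : IsWiener h := by rw [hh]; exact hf.1.add hg.1.conj
  refine IsWiener.ext hw.szego hf.1 fun n => ?_
  rw [fourierCoeff_szego hw, hh, fourierCoeff_add hf.1.1 hg.1.conj.1, fourierCoeff_conj]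
  rcases lt_trichotomy n 0 with hn | hn | hn
  · rw [if_neg (not_le.mpr hn), hf.2 n hn]
  · subst hn; simp [hg0]
  · rw [if_pos hn.le, hg.2 (-n) (by lia)]; simp

/-- The geometric series `1 / (1 - p e^{ix})`. -/
def geom (p : ℂ) : Torus → ℂ := fun x => (1 - p * fourier 1 x)⁻¹

lemma fourier_nat (k : ℕ) (x : Torus) : (fourier (k : ℤ) x : ℂ) = fourier 1 x ^ k := by
  induction k with
  | zero => simp only [Nat.cast_zero, fourier_zero, pow_zero]
  | succ k ih => rw [Nat.cast_succ, fourier_add, ih, pow_succ]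

lemma isHardy_geom {p : ℂ} (hp : ‖p‖ < 1) :
    IsHardy (geom p) ∧ ∀ n : ℕ, fourierCoeff (geom p) n = p ^ n := by
  refine isHardy_of_hasSum ?_ fun x => ?_
  · simpa only [norm_pow] using summable_geometric_of_lt_one (norm_nonneg p) hp
  · simp_rw [fourier_nat, ← mul_pow]
    refine hasSum_geometric_of_norm_lt_one ?_
    rwa [norm_mul, norm_fourier_apply, mul_one]

lemma one_sub_ne_zero {p : ℂ} (hp : ‖p‖ < 1) (x : Torus) : (1 : ℂ) - p * fourier 1 x ≠ 0 := by
  intro h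
  have : ‖p * (fourier 1 x : ℂ)‖ = 1 := by rw [← sub_eq_zero.mp h, norm_one]
  rw [norm_mul, norm_fourier_apply, mul_one] at this
  linarith

lemma rankOne_eq (z : ℂ × ℂ × ℂ) :
    rankOne z = fun x => z.1 + z.2.1 * (fourier 1 x * geom z.2.2 x) := by
  funext x; simp only [rankOne, geom]; ring

lemma isHardy_rankOne {z : ℂ × ℂ × ℂ} (hp : ‖z.2.2‖ < 1) : IsHardy (rankOne z) := by
  rw [rankOne_eq]
  exact (IsHardy.const _).add ((IsHardy.fourier_one.mul (isHardy_geom hp).1).const_mul _)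

lemma fourierCoeff_rankOne_aux {z : ℂ × ℂ × ℂ} (hp : ‖z.2.2‖ < 1) (n : ℤ) :
    fourierCoeff (rankOne z) n = (if n = 0 then z.1 else 0) +
      z.2.1 * fourierCoeff (geom z.2.2) (n - 1) := by
  have h1 := IsHardy.const z.1
  have h2 := (IsHardy.fourier_one.mul (isHardy_geom hp).1).const_mul z.2.1
  have := fourierCoeff_add h1.1.1 h2.1.1 n
  rw [fourierCoeff_const, fourierCoeff.const_mul, fourierCoeff_fourier_mul] at this
  rw [rankOne_eq]; exact this

lemma fourierCoeff_rankOne_zero {z : ℂ × ℂ × ℂ} (hp : ‖z.2.2‖ < 1) :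
    fourierCoeff (rankOne z) 0 = z.1 := by
  rw [fourierCoeff_rankOne_aux hp, (isHardy_geom hp).1.2 _ (by norm_num)]; simp

lemma fourierCoeff_rankOne_succ {z : ℂ × ℂ × ℂ} (hp : ‖z.2.2‖ < 1) (k : ℕ) :
    fourierCoeff (rankOne z) ((k + 1 : ℕ) : ℤ) = z.2.1 * z.2.2 ^ k := by
  rw [fourierCoeff_rankOne_aux hp, if_neg (by push_cast; lia),
    show ((k + 1 : ℕ) : ℤ) - 1 = (k : ℤ) by push_cast; ring, (isHardy_geom hp).2 k, zero_add]

lemma mean_rankOne {z : ℂ × ℂ × ℂ} (hp : ‖z.2.2‖ < 1) : mean (rankOne z) = z.1 := by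
  rw [mean_eq, fourierCoeff_rankOne_zero hp]

lemma fourier_mul_conj (x : Torus) : (fourier 1 x : ℂ) * (starRingEnd ℂ) (fourier 1 x) = 1 := by
  rw [Complex.mul_conj, Complex.normSq_eq_norm_sq, norm_fourier_apply]; simp

lemma fourier_ne_zero (x : Torus) : (fourier 1 x : ℂ) ≠ 0 := fun h => by
  have := norm_fourier_apply 1 x
  rw [h, norm_zero] at this
  exact zero_ne_one this

lemma one_sub_mul_conj_ne_zero {p : ℂ} (hp : ‖p‖ < 1) : (1 : ℂ) - p * (starRingEnd ℂ) p ≠ 0 := by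
  rw [Complex.mul_conj, Complex.normSq_eq_norm_sq]
  have : ‖p‖ ^ 2 < 1 := by nlinarith [norm_nonneg p]
  have h : (1 - ‖p‖ ^ 2 : ℝ) ≠ 0 := by linarith
  exact_mod_cast h

lemma shiftAdj_rankOne {z : ℂ × ℂ × ℂ} (hp : ‖z.2.2‖ < 1) :
    shiftAdj (rankOne z) = fun x => z.2.1 * geom z.2.2 x := by
  funext x
  have h1 : (fourier (-1) x : ℂ) * fourier 1 x = 1 := by
    rw [← fourier_add, neg_add_cancel, fourier_zero]
  simp only [shiftAdj, mean_rankOne hp]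
  rw [rankOne_eq]
  linear_combination z.2.1 * geom z.2.2 x * h1

/-- The values of a fraction `1 / (1 - p e^{ix})` and of its conjugate. -/
lemma geom_relations {p : ℂ} (hp : ‖p‖ < 1) (x : Torus) :
    geom p x = 1 / (1 - p * fourier 1 x) ∧
    (starRingEnd ℂ) (geom p x) = fourier 1 x / (fourier 1 x - (starRingEnd ℂ) p) ∧
    (starRingEnd ℂ) (fourier 1 x : ℂ) = 1 / fourier 1 x ∧
    (fourier 1 x : ℂ) - (starRingEnd ℂ) p ≠ 0 := by
  have h0 := fourier_ne_zero x
  have h1 : (starRingEnd ℂ) (fourier 1 x : ℂ) = 1 / fourier 1 x := by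
    rw [eq_div_iff h0, mul_comm]; exact fourier_mul_conj x
  have h2 : (fourier 1 x : ℂ) - (starRingEnd ℂ) p ≠ 0 := by
    intro h
    have h3 := norm_fourier_apply 1 x
    rw [sub_eq_zero.mp h, RCLike.norm_conj] at h3
    linarith
  refine ⟨by rw [geom, one_div], ?_, h1, h2⟩
  rw [geom, map_inv₀, map_sub, map_mul, h1, map_one]
  have h4 : (1 : ℂ) - (starRingEnd ℂ) p * (1 / fourier 1 x) ≠ 0 := by
    intro h
    apply h2
    linear_combination (fourier 1 x : ℂ) * h + (starRingEnd ℂ) p * mul_one_div_cancel h0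
  field_simp

/-- The projection is read off an explicit decomposition into partial fractions, in which the term
with negative Fourier modes is the conjugate of a multiple of `e^{ix} / (1 - p e^{ix})`. -/
lemma szego_cubic_shiftAdj {z : ℂ × ℂ × ℂ} (hp : ‖z.2.2‖ < 1) :
    szego (cubic (shiftAdj (rankOne z))) = fun x =>
      (z.2.1 * (z.2.1 * (starRingEnd ℂ) z.2.1) / (1 - z.2.2 * (starRingEnd ℂ) z.2.2)) *
        (geom z.2.2 x * geom z.2.2 x + (z.2.2 * (starRingEnd ℂ) z.2.2 /
          (1 - z.2.2 * (starRingEnd ℂ) z.2.2)) * geom z.2.2 x) := by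
  obtain ⟨b, c, p⟩ := z
  have hg := (isHardy_geom (p := p) hp).1
  have hr := one_sub_mul_conj_ne_zero (p := p) hp
  rw [shiftAdj_rankOne hp]
  have hN := (IsHardy.fourier_one.mul hg).const_mul ((starRingEnd ℂ)
    (c * (c * (starRingEnd ℂ) c) / (1 - p * (starRingEnd ℂ) p) ^ 2) * p)
  refine szego_eq_of_decomposition (((hg.mul hg).add (hg.const_mul _)).const_mul _) hN ?_
    fun x => ?_
  · rw [fourierCoeff.const_mul, fourierCoeff_fourier_mul, hg.2 _ (by norm_num), mul_zero]
  · rw [cubic_eq]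
    have h1 := one_sub_ne_zero (p := p) hp x
    obtain ⟨e1, e2, e3, h2⟩ := geom_relations (p := p) hp x
    have h0 := fourier_ne_zero x
    simp only [map_mul, map_div₀, map_pow, map_sub, map_one, Complex.conj_conj, e2, e3]
    rw [e1]
    generalize (fourier 1 x : ℂ) = e at *
    generalize (starRingEnd ℂ) p = p' at *
    generalize (starRingEnd ℂ) c = c' at *
    dsimp only at *
    have hr' : (1 : ℂ) - p' * p ≠ 0 := by rwa [mul_comm]
    have h1' : (1 : ℂ) - e * p ≠ 0 := by rwa [mul_comm]
    field_simp
    ring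

lemma szego_cubic_rankOne {z : ℂ × ℂ × ℂ} (hp : ‖z.2.2‖ < 1) :
    szego (cubic (rankOne z)) = fun x =>
      z.1 * (starRingEnd ℂ) z.1 * z.1
      + (2 * (z.1 * (starRingEnd ℂ) z.1) * z.2.1) * (fourier 1 x * geom z.2.2 x)
      + ((starRingEnd ℂ) z.1 * z.2.1 ^ 2) *
          ((fourier 1 x * geom z.2.2 x) * (fourier 1 x * geom z.2.2 x))
      + (2 * z.1 * (z.2.1 * (starRingEnd ℂ) z.2.1) / (1 - z.2.2 * (starRingEnd ℂ) z.2.2)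
          + z.2.1 * (z.2.1 * (starRingEnd ℂ) z.2.1) * (starRingEnd ℂ) z.2.2 /
            (1 - z.2.2 * (starRingEnd ℂ) z.2.2) ^ 2) * geom z.2.2 x
      + (z.2.1 * (z.2.1 * (starRingEnd ℂ) z.2.1) / (1 - z.2.2 * (starRingEnd ℂ) z.2.2)) *
          (fourier 1 x * (geom z.2.2 x * geom z.2.2 x)) := by
  obtain ⟨b, c, p⟩ := z
  have hg := (isHardy_geom (p := p) hp).1
  have hr := one_sub_mul_conj_ne_zero (p := p) hp
  have hw := IsHardy.fourier_one.mul hg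
  have hN := hw.const_mul ((starRingEnd ℂ) b ^ 2 * c + (starRingEnd ℂ)
    (2 * b * (c * (starRingEnd ℂ) c) / (1 - p * (starRingEnd ℂ) p)
      + c * (c * (starRingEnd ℂ) c) * (starRingEnd ℂ) p / (1 - p * (starRingEnd ℂ) p) ^ 2) * p)
  refine szego_eq_of_decomposition (((((IsHardy.const _).add (hw.const_mul _)).add
    ((hw.mul hw).const_mul _)).add (hg.const_mul _)).add
    ((IsHardy.fourier_one.mul (hg.mul hg)).const_mul _)) hN ?_ fun x => ?_
  · rw [fourierCoeff.const_mul, fourierCoeff_fourier_mul, hg.2 _ (by norm_num), mul_zero]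
  · rw [cubic_eq, rankOne_eq]
    have h1 := one_sub_ne_zero (p := p) hp x
    obtain ⟨e1, e2, e3, h2⟩ := geom_relations (p := p) hp x
    have h0 := fourier_ne_zero x
    simp only [map_mul, map_div₀, map_pow, map_sub, map_one, map_add, Complex.conj_conj, e2, e3,
      map_ofNat]
    rw [e1]
    generalize (fourier 1 x : ℂ) = e at *
    generalize (starRingEnd ℂ) p = p' at *
    generalize (starRingEnd ℂ) c = c' at *
    generalize (starRingEnd ℂ) b = b' at *
    dsimp only at *
    have hr' : (1 : ℂ) - p' * p ≠ 0 := by rwa [mul_comm]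
    have h1' : (1 : ℂ) - e * p ≠ 0 := by rwa [mul_comm]
    field_simp
    ring

end
end DampedSzego
namespace DampedSzego
noncomputable section

/-! ### Norms, momentum and distances on the manifold of rational functions -/

lemma one_add_sq_rpow_le {s : ℝ} (hs : 0 ≤ s) (k j : ℕ) :
    (1 + ((k : ℝ) + j) ^ 2) ^ s ≤
      (2 * (1 + (j : ℝ) ^ 2)) ^ s * (2 ^ ⌈s⌉₊ * (1 + (k : ℝ) ^ (2 * ⌈s⌉₊))) := by
  have h1 : 1 + ((k : ℝ) + j) ^ 2 ≤ (2 * (1 + (j : ℝ) ^ 2)) * (1 + (k : ℝ) ^ 2) := by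
    nlinarith [sq_nonneg ((k : ℝ) - j), sq_nonneg ((k : ℝ) * j)]
  have h2 : (1 + (k : ℝ) ^ 2) ^ s ≤ 2 ^ ⌈s⌉₊ * (1 + (k : ℝ) ^ (2 * ⌈s⌉₊)) := by
    have h3 : (1 + (k : ℝ) ^ 2) ^ s ≤ (1 + (k : ℝ) ^ 2) ^ (⌈s⌉₊ : ℝ) :=
      Real.rpow_le_rpow_of_exponent_le (by nlinarith [sq_nonneg (k : ℝ)]) (Nat.le_ceil s)
    rw [Real.rpow_natCast] at h3
    refine h3.trans ?_
    rw [pow_mul]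
    rcases le_total ((k : ℝ) ^ 2) 1 with h | h
    · calc (1 + (k : ℝ) ^ 2) ^ ⌈s⌉₊ ≤ 2 ^ ⌈s⌉₊ := pow_le_pow_left₀ (by positivity) (by linarith) _
        _ ≤ _ := le_mul_of_one_le_right (by positivity) (by
          have : (0 : ℝ) ≤ ((k : ℝ) ^ 2) ^ ⌈s⌉₊ := by positivity
          linarith)
    · calc (1 + (k : ℝ) ^ 2) ^ ⌈s⌉₊ ≤ (2 * (k : ℝ) ^ 2) ^ ⌈s⌉₊ :=
            pow_le_pow_left₀ (by positivity) (by linarith) _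
        _ = 2 ^ ⌈s⌉₊ * ((k : ℝ) ^ 2) ^ ⌈s⌉₊ := mul_pow _ _ _
        _ ≤ _ := by gcongr; linarith
  calc _ ≤ ((2 * (1 + (j : ℝ) ^ 2)) * (1 + (k : ℝ) ^ 2)) ^ s :=
        Real.rpow_le_rpow (by positivity) h1 hs
    _ = (2 * (1 + (j : ℝ) ^ 2)) ^ s * (1 + (k : ℝ) ^ 2) ^ s :=
        Real.mul_rpow (by positivity) (by positivity)
    _ ≤ _ := mul_le_mul_of_nonneg_left h2 (by positivity)

lemma summable_weight {s : ℝ} (hs : 0 ≤ s) (j : ℕ) {r : ℝ} (hr0 : 0 ≤ r) (hr : r < 1) :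
    Summable fun k : ℕ => (1 + ((k : ℝ) + j) ^ 2) ^ s * r ^ k := by
  have hr' : ‖r‖ < 1 := by rwa [Real.norm_of_nonneg hr0]
  have h1 := (summable_geometric_of_lt_one hr0 hr).add
    (summable_pow_mul_geometric_of_norm_lt_one (2 * ⌈s⌉₊) hr')
  refine (h1.mul_left ((2 * (1 + (j : ℝ) ^ 2)) ^ s * 2 ^ ⌈s⌉₊)).of_nonneg_of_le
    (fun k => by positivity) fun k => ?_
  have := mul_le_mul_of_nonneg_right (one_add_sq_rpow_le hs k j) (pow_nonneg hr0 k)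
  refine this.trans_eq ?_
  ring

/-- The weighted geometric series `∑ (1 + (k + j)²)^s r^k`. -/
def weightSum (s : ℝ) (j : ℕ) (r : ℝ) : ℝ := ∑' k : ℕ, (1 + ((k : ℝ) + j) ^ 2) ^ s * r ^ k

lemma weightSum_nonneg (s : ℝ) (j : ℕ) {r : ℝ} (hr0 : 0 ≤ r) : 0 ≤ weightSum s j r :=
  tsum_nonneg fun k => by positivity

lemma hasSum_of_eq {f g : ℕ → ℝ} {a b : ℝ} (h : HasSum g b) (hfg : ∀ k, f k = g k) (hab : a = b) :
    HasSum f a := by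
  rw [funext hfg, hab]; exact h

lemma hasSum_int_of_nonneg {f : ℤ → ℝ} {a : ℝ} (hneg : ∀ n < 0, f n = 0)
    (h : HasSum (fun k : ℕ => f k) a) : HasSum f a := by
  have hinj : Function.Injective (Nat.cast : ℕ → ℤ) := Nat.cast_injective
  refine (hinj.hasSum_iff fun k hk => hneg k ?_).mp h
  by_contra hk'
  exact hk ⟨k.toNat, Int.toNat_of_nonneg (not_lt.mp hk')⟩

lemma hasSum_hs {s : ℝ} (hs : 0 ≤ s) {f : Torus → ℂ} {b c p : ℂ} (hp : ‖p‖ < 1)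
    (hneg : ∀ n < 0, fourierCoeff f n = 0) (h0 : fourierCoeff f 0 = b)
    (h1 : ∀ k : ℕ, fourierCoeff f ((k + 1 : ℕ) : ℤ) = c * p ^ k) :
    HasSum (fun k : ℤ => (1 + (k : ℝ) ^ 2) ^ s * ‖fourierCoeff f k‖ ^ 2)
      (‖b‖ ^ 2 + ‖c‖ ^ 2 * weightSum s 1 (‖p‖ ^ 2)) := by
  refine hasSum_int_of_nonneg (fun n hn => by rw [hneg n hn]; simp) ?_
  rw [← hasSum_nat_add_iff' 1]
  have hr : ‖p‖ ^ 2 < 1 := by nlinarith [norm_nonneg p]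
  have hS := ((summable_weight hs 1 (sq_nonneg ‖p‖) hr).hasSum).mul_left (‖c‖ ^ 2)
  refine hasSum_of_eq hS (fun k => ?_) ?_
  · rw [h1 k, norm_mul, norm_pow]
    push_cast; ring
  · simp [h0, weightSum]

lemma hsNorm_sq_rankOne {s : ℝ} (hs : 0 ≤ s) {z : ℂ × ℂ × ℂ} (hp : ‖z.2.2‖ < 1) :
    hsNorm s (rankOne z) ^ 2 = ‖z.1‖ ^ 2 + ‖z.2.1‖ ^ 2 * weightSum s 1 (‖z.2.2‖ ^ 2) := by
  have h := hasSum_hs hs hp (isHardy_rankOne hp).2 (fourierCoeff_rankOne_zero hp)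
    (fourierCoeff_rankOne_succ hp)
  rw [hsNorm, h.tsum_eq, Real.sq_sqrt]
  have := weightSum_nonneg s 1 (sq_nonneg ‖z.2.2‖)
  positivity

lemma memHsPlus_rankOne {z : ℂ × ℂ × ℂ} (hp : ‖z.2.2‖ < 1) : MemHsPlus 1 (rankOne z) :=
  ⟨(isHardy_rankOne hp).1.1, (isHardy_rankOne hp).2,
    (hasSum_hs zero_le_one hp (isHardy_rankOne hp).2 (fourierCoeff_rankOne_zero hp)
    (fourierCoeff_rankOne_succ hp)).summable⟩

lemma momentum_rankOne {z : ℂ × ℂ × ℂ} (hp : ‖z.2.2‖ < 1) :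
    momentum (rankOne z) = ‖z.2.1‖ ^ 2 / (1 - ‖z.2.2‖ ^ 2) ^ 2 := by
  have hr : ‖z.2.2‖ ^ 2 < 1 := by nlinarith [norm_nonneg z.2.2]
  have hr' : ‖‖z.2.2‖ ^ 2‖ < 1 := by rwa [Real.norm_of_nonneg (sq_nonneg _)]
  have h : HasSum (fun k : ℕ => (k : ℝ) * ‖fourierCoeff (rankOne z) (k : ℤ)‖ ^ 2)
      (‖z.2.1‖ ^ 2 / (1 - ‖z.2.2‖ ^ 2) ^ 2) := by
    rw [← hasSum_nat_add_iff' 1]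
    have h1 := (hasSum_coe_mul_geometric_of_norm_lt_one hr').add
      (hasSum_geometric_of_norm_lt_one hr')
    refine hasSum_of_eq (h1.mul_left (‖z.2.1‖ ^ 2)) (fun k => ?_) ?_
    · rw [fourierCoeff_rankOne_succ hp, norm_mul, norm_pow]
      push_cast; ring
    · have : (1 : ℝ) - ‖z.2.2‖ ^ 2 ≠ 0 := by linarith
      simp
      field_simp
      ring
  exact h.tsum_eq

lemma rankOne_injOn {z z' : ℂ × ℂ × ℂ} (hz : z ∈ paramDomain) (hz' : z' ∈ paramDomain)
    (h : rankOne z = rankOne z') : z = z' := by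
  have h0 : z.1 = z'.1 := by
    rw [← fourierCoeff_rankOne_zero hz.2, ← fourierCoeff_rankOne_zero hz'.2, h]
  have h1 : z.2.1 = z'.2.1 := by
    have e1 := fourierCoeff_rankOne_succ hz.2 0
    have e2 := fourierCoeff_rankOne_succ hz'.2 0
    rw [pow_zero, mul_one] at e1 e2
    rw [← e1, ← e2, h]
  have h2 : z.2.2 = z'.2.2 := by
    have e1 := fourierCoeff_rankOne_succ hz.2 1
    have e2 := fourierCoeff_rankOne_succ hz'.2 1
    rw [pow_one] at e1 e2
    rw [h, e2, ← h1] at e1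
    exact (mul_left_cancel₀ hz.1 e1).symm
  exact Prod.ext h0 (Prod.ext h1 h2)

/-- The coordinates of the points of `𝓔_M`: the momentum of `b + c e^{ix} / (1 - p e^{ix})` is
`|c|² / (1 - |p|²)²`. For `M > 0` the condition `c ≠ 0` is automatic. -/
def levelSet (M : ℝ) : Set (ℂ × ℂ × ℂ) :=
  {z | ‖z.2.2‖ < 1 ∧ ‖z.2.1‖ ^ 2 = M * (1 - ‖z.2.2‖ ^ 2) ^ 2}

lemma levelSet_subset {M : ℝ} (hM : 0 < M) : levelSet M ⊆ paramDomain := by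
  rintro z ⟨hp, hc⟩
  refine ⟨fun h => ?_, hp⟩
  have hr : 0 < 1 - ‖z.2.2‖ ^ 2 := by nlinarith [norm_nonneg z.2.2]
  have : 0 < M * (1 - ‖z.2.2‖ ^ 2) ^ 2 := by positivity
  rw [h, norm_zero] at hc
  linarith

lemma rankOne_mem_energyLevel_iff {M : ℝ} {z : ℂ × ℂ × ℂ} (hz : z ∈ paramDomain) :
    rankOne z ∈ energyLevel M ↔ z ∈ levelSet M := by
  have hr : 0 < 1 - ‖z.2.2‖ ^ 2 := by nlinarith [norm_nonneg z.2.2, hz.2]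
  constructor
  · rintro ⟨-, h⟩
    rw [momentum_rankOne hz.2, div_eq_iff (by positivity)] at h
    exact ⟨hz.2, h⟩
  · rintro ⟨-, h⟩
    refine ⟨⟨z, hz, rfl⟩, ?_⟩
    rw [momentum_rankOne hz.2, div_eq_iff (by positivity), h]

lemma mem_energyLevel_iff {M : ℝ} (hM : 0 < M) {u : Torus → ℂ} :
    u ∈ energyLevel M ↔ ∃ z ∈ levelSet M, u = rankOne z := by
  constructor
  · rintro ⟨⟨z, hz, rfl⟩, h⟩
    exact ⟨z, (rankOne_mem_energyLevel_iff hz).mp ⟨⟨z, hz, rfl⟩, h⟩, rfl⟩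
  · rintro ⟨z, hz, rfl⟩
    exact (rankOne_mem_energyLevel_iff (levelSet_subset hM hz)).mpr hz

lemma rankOne_circle (c : ℂ) : rankOne (0, c, 0) = fun x => c * fourier 1 x := by
  funext x; simp [rankOne, -fourier_apply]

lemma rankOne_mem_circleSet_iff {M : ℝ} (hM : 0 < M) {z : ℂ × ℂ × ℂ} (hz : z ∈ paramDomain) :
    rankOne z ∈ circleSet M ↔ z.1 = 0 ∧ z.2.2 = 0 ∧ ‖z.2.1‖ ^ 2 = M := by
  constructor
  · rintro ⟨c, hc, h⟩
    rw [← rankOne_circle] at h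
    have hc0 : c ≠ 0 := by rintro rfl; simp at hc; linarith
    have := rankOne_injOn hz (z' := (0, c, 0)) ⟨hc0, by simp⟩ h
    subst this
    exact ⟨rfl, rfl, hc⟩
  · rintro ⟨h1, h2, h3⟩
    refine ⟨z.2.1, h3, ?_⟩
    rw [← rankOne_circle]
    congr 1
    exact Prod.ext h1 (Prod.ext rfl h2)

/-- The squared distance in `H^s` to the circle `𝓒_M`: the contributions of the Fourier modes `0`,
`1` and `≥ 2`. -/
def distSq (s M : ℝ) (z : ℂ × ℂ × ℂ) : ℝ :=
  ‖z.1‖ ^ 2 + 2 ^ s * (‖z.2.1‖ - √M) ^ 2 +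
    ‖z.2.1‖ ^ 2 * (‖z.2.2‖ ^ 2 * weightSum s 2 (‖z.2.2‖ ^ 2))

lemma hsNorm_sub_circle {s : ℝ} (hs : 0 ≤ s) {z : ℂ × ℂ × ℂ} (hp : ‖z.2.2‖ < 1) (c : ℂ) :
    hsNorm s (rankOne z - fun x => c * fourier 1 x) = √(‖z.1‖ ^ 2 + 2 ^ s * ‖z.2.1 - c‖ ^ 2 +
    ‖z.2.1‖ ^ 2 * (‖z.2.2‖ ^ 2 * weightSum s 2 (‖z.2.2‖ ^ 2))) := by
  have hcont : Continuous fun x : Torus => c * (fourier 1 x : ℂ) :=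
    ((isWiener_fourier 1).const_mul c).1
  have hco : ∀ n, fourierCoeff (rankOne z - fun x => c * fourier 1 x) n =
      fourierCoeff (rankOne z) n - if n = 1 then c else 0 := fun n => by
    rw [fourierCoeff_sub (isHardy_rankOne hp).1.1 hcont,
      fourierCoeff.const_mul (fun x : Torus => (fourier 1 x : ℂ)), fourierCoeff_fourier_apply]
    simp [eq_comm]
  have hr : ‖z.2.2‖ ^ 2 < 1 := by nlinarith [norm_nonneg z.2.2]
  have h : HasSum (fun k : ℤ => (1 + (k : ℝ) ^ 2) ^ s *
      ‖fourierCoeff (rankOne z - fun x => c * fourier 1 x) k‖ ^ 2)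
      (‖z.1‖ ^ 2 + 2 ^ s * ‖z.2.1 - c‖ ^ 2 +
      ‖z.2.1‖ ^ 2 * (‖z.2.2‖ ^ 2 * weightSum s 2 (‖z.2.2‖ ^ 2))) := by
    refine hasSum_int_of_nonneg (fun n hn => ?_) ?_
    · rw [hco, (isHardy_rankOne hp).2 n hn, if_neg (by lia)]; simp
    rw [← hasSum_nat_add_iff' 2]
    have hS := ((summable_weight hs 2 (sq_nonneg ‖z.2.2‖) hr).hasSum).mul_left
      (‖z.2.1‖ ^ 2 * ‖z.2.2‖ ^ 2)
    refine hasSum_of_eq hS (fun k => ?_) ?_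
    · rw [hco, show k + 2 = (k + 1) + 1 from rfl, fourierCoeff_rankOne_succ hp,
        if_neg (by push_cast; lia), sub_zero, norm_mul, norm_pow]
      push_cast; ring_nf
    · have e1 := fourierCoeff_rankOne_succ hp 0
      rw [zero_add, pow_zero, mul_one, Nat.cast_one] at e1
      rw [Finset.sum_range_succ, Finset.sum_range_one, hco, hco, Nat.cast_zero, Nat.cast_one,
        fourierCoeff_rankOne_zero hp, e1, weightSum]
      norm_num
      ring
  rw [hsNorm, h.tsum_eq]

/-- The nearest point of the circle is `√M (c / |c|) e^{ix}`. -/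
lemma hsDist_circle {s M : ℝ} (hs : 0 ≤ s) (hM : 0 ≤ M) {z : ℂ × ℂ × ℂ}
    (hz : z ∈ paramDomain) :
    hsDist s (rankOne z) (circleSet M) = √(distSq s M z) := by
  have hw := weightSum_nonneg s 2 (sq_nonneg ‖z.2.2‖)
  have hc0 : 0 < ‖z.2.1‖ := norm_pos_iff.mpr hz.1
  refine IsLeast.csInf_eq ⟨?_, ?_⟩
  · refine ⟨_, ⟨((√M / ‖z.2.1‖ : ℝ) : ℂ) * z.2.1, ?_, rfl⟩, ?_⟩
    · rw [norm_mul, Complex.norm_real, Real.norm_of_nonneg (by positivity),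
        div_mul_cancel₀ _ hc0.ne', Real.sq_sqrt hM]
    · dsimp only
      rw [hsNorm_sub_circle hs hz.2, distSq]
      have : z.2.1 - ((√M / ‖z.2.1‖ : ℝ) : ℂ) * z.2.1 =
          ((1 - √M / ‖z.2.1‖ : ℝ) : ℂ) * z.2.1 := by push_cast; ring
      rw [this, norm_mul, Complex.norm_real, mul_pow, Real.norm_eq_abs, sq_abs, ← mul_pow,
        sub_mul, div_mul_cancel₀ _ hc0.ne', one_mul]
  · rintro _ ⟨_, ⟨c, hc, rfl⟩, rfl⟩
    dsimp only
    rw [hsNorm_sub_circle hs hz.2, distSq]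
    apply Real.sqrt_le_sqrt
    have h1 : ‖c‖ = √M := by rw [← hc, Real.sqrt_sq (norm_nonneg c)]
    have h2 : (‖z.2.1‖ - √M) ^ 2 ≤ ‖z.2.1 - c‖ ^ 2 := by
      rw [← h1, ← sq_abs]
      exact pow_le_pow_left₀ (abs_nonneg _) (abs_norm_sub_norm_le _ _) 2
    have h3 : (0 : ℝ) ≤ 2 ^ s := by positivity
    nlinarith

/-! ### The reduced equation -/

/-- The vector field of the equation in the coordinates `(b, c, p)`, restricted to `𝓔_M` and
extended to a polynomial vector field. -/
def vf (ν α β M : ℝ) (z : ℂ × ℂ × ℂ) : ℂ × ℂ × ℂ :=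
  (-(ν * z.1) - Complex.I * (z.1 * (starRingEnd ℂ) z.1 * z.1
      + 2 * z.1 * M * (1 - z.2.2 * (starRingEnd ℂ) z.2.2)
      + z.2.1 * M * (starRingEnd ℂ) z.2.2 + α * z.1),
    -Complex.I * (2 * (z.1 * (starRingEnd ℂ) z.1) * z.2.1
      + 2 * z.1 * z.2.2 * M * (1 - z.2.2 * (starRingEnd ℂ) z.2.2) + (1 - β) * z.2.1 * M),
    -Complex.I * ((starRingEnd ℂ) z.1 * z.2.1
      + (1 - β) * M * (1 - z.2.2 * (starRingEnd ℂ) z.2.2) * z.2.2))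

lemma levelSet_mul_conj {M : ℝ} {z : ℂ × ℂ × ℂ} (hz : z ∈ levelSet M) :
    z.2.1 * (starRingEnd ℂ) z.2.1 = M * (1 - z.2.2 * (starRingEnd ℂ) z.2.2) ^ 2 := by
  rw [Complex.mul_conj, Complex.mul_conj, Complex.normSq_eq_norm_sq, Complex.normSq_eq_norm_sq,
    hz.2]
  push_cast; ring

lemma field_rankOne (ν α β : ℝ) {M : ℝ} {z : ℂ × ℂ × ℂ} (hz : z ∈ levelSet M) (x : Torus) :
    field ν α β (rankOne z) x = (vf ν α β M z).1 +
      (vf ν α β M z).2.1 * (fourier 1 x * geom z.2.2 x) +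
      z.2.1 * (vf ν α β M z).2.2 * (fourier 1 x * geom z.2.2 x) ^ 2 := by
  have hp := hz.1
  rw [field, szego_cubic_rankOne hp, szego_cubic_shiftAdj hp, mean_rankOne hp, shift]
  have hcc := levelSet_mul_conj hz
  obtain ⟨b, c, p⟩ := z
  have hr := one_sub_mul_conj_ne_zero (p := p) hp
  have h1 := one_sub_ne_zero (p := p) hp x
  obtain ⟨e1, -, -, -⟩ := geom_relations (p := p) hp x
  simp only [vf]
  dsimp only at hcc hr h1 e1
  rw [e1, hcc]
  generalize (fourier 1 x : ℂ) = e at *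
  generalize (starRingEnd ℂ) p = p' at *
  generalize (starRingEnd ℂ) c = c' at *
  generalize (starRingEnd ℂ) b = b' at *
  have hr' : (1 : ℂ) - p' * p ≠ 0 := by rwa [mul_comm]
  have h1' : (1 : ℂ) - e * p ≠ 0 := by rwa [mul_comm]
  field_simp
  ring

lemma tendsto_hsNorm_rankOne {γ : ℝ → ℂ × ℂ × ℂ} (hγ : Continuous γ) (hp : ∀ t, ‖(γ t).2.2‖ < 1)
    (t : ℝ) : Tendsto (fun τ => hsNorm 1 (rankOne (γ τ) - rankOne (γ t))) (𝓝 t) (𝓝 0) := by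
  obtain ⟨ρ, hρ1, hρ2⟩ := exists_between (max_lt (hp t) one_half_lt_one)
  have hρ0 : 0 < ρ := by linarith [le_max_right ‖(γ t).2.2‖ (1 / 2)]
  have hρt : ‖(γ t).2.2‖ < ρ := lt_of_le_of_lt (le_max_left _ _) hρ1
  set B := ‖(γ t).1‖ + 1 + (‖(γ t).2.1‖ + 1) / ρ with hB
  have hB0 : 0 < B := by positivity
  have hco : ∀ z : ℂ × ℂ × ℂ, ‖z.1‖ ≤ ‖(γ t).1‖ + 1 → ‖z.2.1‖ ≤ ‖(γ t).2.1‖ + 1 → ‖z.2.2‖ ≤ ρ →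
      ∀ k : ℤ, ‖fourierCoeff (rankOne z) k‖ ≤ B * ρ ^ k.natAbs := by
    intro z hb hc hpz k
    have hz : ‖z.2.2‖ < 1 := hpz.trans_lt hρ2
    rcases lt_trichotomy k 0 with hk | hk | hk
    · rw [(isHardy_rankOne hz).2 k hk, norm_zero]; positivity
    · subst hk
      rw [fourierCoeff_rankOne_zero hz, Int.natAbs_zero, pow_zero, mul_one]
      exact hb.trans (by rw [hB]; linarith [show 0 ≤ (‖(γ t).2.1‖ + 1) / ρ by positivity])
    · obtain ⟨n, rfl⟩ : ∃ n : ℕ, k = ((n + 1 : ℕ) : ℤ) := ⟨k.toNat - 1, by lia⟩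
      rw [fourierCoeff_rankOne_succ hz, norm_mul, norm_pow, Int.natAbs_natCast]
      calc _ ≤ (‖(γ t).2.1‖ + 1) * ρ ^ n := by gcongr
        _ = (‖(γ t).2.1‖ + 1) / ρ * ρ ^ (n + 1) := by rw [pow_succ]; field_simp
        _ ≤ B * ρ ^ (n + 1) := by
          refine mul_le_mul_of_nonneg_right ?_ (by positivity)
          rw [hB]; linarith [norm_nonneg (γ t).1]
  have hcb : Continuous fun τ => ‖(γ τ).1‖ := by fun_prop
  have hcc : Continuous fun τ => ‖(γ τ).2.1‖ := by fun_prop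
  have hcp : Continuous fun τ => ‖(γ τ).2.2‖ := by fun_prop
  have hev : ∀ᶠ τ in 𝓝 t, ‖(γ τ).1‖ ≤ ‖(γ t).1‖ + 1 ∧ ‖(γ τ).2.1‖ ≤ ‖(γ t).2.1‖ + 1 ∧
      ‖(γ τ).2.2‖ ≤ ρ := by
    filter_upwards [(hcb.tendsto t).eventually (gt_mem_nhds (lt_add_one _)),
      (hcc.tendsto t).eventually (gt_mem_nhds (lt_add_one _)),
      (hcp.tendsto t).eventually (gt_mem_nhds hρt)] with τ h1 h2 h3
    exact ⟨h1.le, h2.le, h3.le⟩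
  have key : Tendsto (fun τ => ∑' k : ℤ, (1 + (k : ℝ) ^ 2) ^ (1 : ℝ) *
      ‖fourierCoeff (rankOne (γ τ) - rankOne (γ t)) k‖ ^ 2) (𝓝 t) (𝓝 (∑' k : ℤ, (0 : ℝ))) := by
    refine tendsto_tsum_of_dominated_convergence
      (bound := fun k : ℤ => (1 + (k : ℝ) ^ 2) ^ (1 : ℝ) * (2 * (B * ρ ^ k.natAbs)) ^ 2) ?_ ?_ ?_
    · have hsum : Summable fun k : ℕ => (1 + (k : ℝ) ^ 2) ^ (1 : ℝ) * (2 * (B * ρ ^ k)) ^ 2 := by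
        have := (summable_weight (s := 1) zero_le_one 0 (sq_nonneg ρ)
          (by nlinarith : ρ ^ 2 < 1)).mul_left (4 * B ^ 2)
        refine this.congr fun k => ?_
        push_cast; ring_nf
      refine Summable.of_nat_of_neg ?_ ?_
      · simpa using hsum
      · simpa using hsum
    · intro k
      have hcont : ContinuousAt (fun τ => fourierCoeff (rankOne (γ τ)) k) t := by
        refine Continuous.continuousAt ?_
        rcases lt_trichotomy k 0 with hk | hk | hk
        · simp_rw [fun τ => (isHardy_rankOne (hp τ)).2 k hk]; exact continuous_const
        · subst hk; simp_rw [fun τ => fourierCoeff_rankOne_zero (hp τ)]; fun_prop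
        · obtain ⟨n, rfl⟩ : ∃ n : ℕ, k = ((n + 1 : ℕ) : ℤ) := ⟨k.toNat - 1, by lia⟩
          simp_rw [fun τ => fourierCoeff_rankOne_succ (hp τ) n]; fun_prop
      have h2 : Tendsto (fun τ => (1 + (k : ℝ) ^ 2) ^ (1 : ℝ) *
          ‖fourierCoeff (rankOne (γ τ)) k - fourierCoeff (rankOne (γ t)) k‖ ^ 2) (𝓝 t)
          (𝓝 ((1 + (k : ℝ) ^ 2) ^ (1 : ℝ) *
          ‖fourierCoeff (rankOne (γ t)) k - fourierCoeff (rankOne (γ t)) k‖ ^ 2)) :=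
        (((hcont.tendsto.sub_const _).norm).pow 2).const_mul _
      rw [sub_self, norm_zero, zero_pow two_ne_zero, mul_zero] at h2
      refine h2.congr fun τ => ?_
      rw [fourierCoeff_sub (isHardy_rankOne (hp τ)).1.1 (isHardy_rankOne (hp t)).1.1]
    · filter_upwards [hev] with τ hτ k
      rw [Real.norm_of_nonneg (by positivity),
        fourierCoeff_sub (isHardy_rankOne (hp τ)).1.1 (isHardy_rankOne (hp t)).1.1]
      have h1 := hco (γ τ) hτ.1 hτ.2.1 hτ.2.2 k
      have h2 := hco (γ t) (by linarith) (by linarith) hρt.le k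
      have h3 : ‖fourierCoeff (rankOne (γ τ)) k - fourierCoeff (rankOne (γ t)) k‖ ≤
          2 * (B * ρ ^ k.natAbs) := (norm_sub_le _ _).trans (by linarith)
      gcongr
  rw [tsum_zero] at key
  have := key.sqrt
  rwa [Real.sqrt_zero] at this

/-- Integral curves of the reduced vector field on `𝓔_M` yield solutions of the equation. -/
lemma isSolution_rankOne {ν α β M : ℝ} {γ : ℝ → ℂ × ℂ × ℂ}
    (hγ : ∀ t, HasDerivAt γ (vf ν α β M (γ t)) t) (hl : ∀ t, γ t ∈ levelSet M) :
    IsSolution ν α β fun t => rankOne (γ t) := by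
  have hcont : Continuous γ := continuous_iff_continuousAt.mpr fun t => (hγ t).continuousAt
  refine ⟨⟨1, by norm_num, fun t => memHsPlus_rankOne (hl t).1,
    tendsto_hsNorm_rankOne hcont fun t => (hl t).1⟩, fun t x => ?_⟩
  refine ⟨field ν α β (rankOne (γ t)) x, ?_, ?_⟩
  · have h1 : HasDerivAt (fun τ => (γ τ).1) (vf ν α β M (γ t)).1 t := (hγ t).fst
    have h2 : HasDerivAt (fun τ => (γ τ).2.1) (vf ν α β M (γ t)).2.1 t := (hγ t).snd.fst
    have h3 : HasDerivAt (fun τ => (γ τ).2.2) (vf ν α β M (γ t)).2.2 t := (hγ t).snd.snd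
    have hne := one_sub_ne_zero (hl t).1 x
    have h4 := h1.add (((h2.mul_const (fourier 1 x : ℂ))).div
      ((h3.mul_const (fourier 1 x : ℂ)).const_sub 1) hne)
    refine h4.congr_deriv ?_
    rw [field_rankOne ν α β (hl t) x, geom]
    have hne' : (1 : ℂ) - fourier 1 x * (γ t).2.2 ≠ 0 := by rwa [mul_comm]
    generalize (fourier 1 x : ℂ) = e at *
    field_simp
    ring
  · rw [field]
    linear_combination (-(szego (cubic (rankOne (γ t))) x + α * mean (rankOne (γ t))
    - β * shift (szego (cubic (shiftAdj (rankOne (γ t))))) x)) * Complex.I_mul_I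

end
end DampedSzego
namespace DampedSzego
noncomputable section

/-! ### Integral curves of vector fields -/

section ODE
variable {E : Type*} [NormedAddCommGroup E] [NormedSpace ℝ E]

/-- Integral curves on the intervals `(-n-1, n+1)` which are compatible with each other define a
global one. -/
lemma exists_integralCurve_of_compatible {V : E → E} (α : ℕ → ℝ → E)
    (hα : ∀ (n : ℕ) (t : ℝ), |t| < n + 1 → HasDerivAt (α n) (V (α n t)) t)
    (hc : ∀ m n : ℕ, m ≤ n → ∀ t : ℝ, |t| < m + 1 → α m t = α n t) :
    ∃ γ : ℝ → E, γ 0 = α 0 0 ∧ ∀ t, HasDerivAt γ (V (γ t)) t := by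
  refine ⟨fun t => α ⌈|t|⌉₊ t, by simp, fun t => ?_⟩
  have hlt : ∀ τ : ℝ, |τ| < (⌈|τ|⌉₊ : ℝ) + 1 := fun τ => by linarith [Nat.le_ceil |τ|]
  have hev : (fun τ => α ⌈|τ|⌉₊ τ) =ᶠ[𝓝 t] α (⌈|t|⌉₊ + 1) := by
    filter_upwards [(continuous_abs.tendsto t).eventually (gt_mem_nhds (lt_add_one |t|))] with τ hτ
    refine hc _ _ ?_ τ (hlt τ)
    refine Nat.ceil_le.mpr ?_
    push_cast
    linarith [Nat.le_ceil |t|]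
  refine HasDerivAt.congr_of_eventuallyEq ?_ hev
  dsimp only
  rw [hc _ (⌈|t|⌉₊ + 1) (Nat.le_succ _) t (hlt t)]
  refine hα _ t ?_
  push_cast
  linarith [hlt t]

lemma exists_integralCurve_of_lipschitz [CompleteSpace E] {F : E → E} {K L : NNReal}
    (hF : LipschitzWith K F) (hL : ∀ x, ‖F x‖ ≤ L) (x : E) :
    ∃ γ : ℝ → E, γ 0 = x ∧ ∀ t, HasDerivAt γ (F (γ t)) t := by
  have hloc : ∀ n : ℕ, ∃ γ : ℝ → E, γ 0 = x ∧
      ∀ t : ℝ, |t| < n + 1 → HasDerivAt γ (F (γ t)) t := by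
    intro n
    have hpl : IsPicardLindelof (fun _ : ℝ => F) (tmin := -((n : ℝ) + 1)) (tmax := (n : ℝ) + 1)
        ⟨0, by constructor <;> linarith [Nat.cast_nonneg (α := ℝ) n]⟩ x (L * (n + 1)) 0 L K := by
      refine IsPicardLindelof.of_time_independent (fun y _ => hL y) hF.lipschitzOnWith ?_
      simp
    obtain ⟨γ, h0, hd⟩ := hpl.exists_eq_forall_mem_Icc_hasDerivWithinAt₀
    refine ⟨γ, h0, fun t ht => ?_⟩
    rw [abs_lt] at ht
    exact (hd t ⟨ht.1.le, ht.2.le⟩).hasDerivAt (Icc_mem_nhds ht.1 ht.2)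
  choose α h0 hα using hloc
  obtain ⟨γ, hγ0, hγ⟩ := exists_integralCurve_of_compatible α hα fun m n hmn t ht => by
    have hmn' : (m : ℝ) ≤ n := by exact_mod_cast hmn
    have hm : (0 : ℝ) ≤ m := Nat.cast_nonneg m
    refine ODE_solution_unique_of_mem_Ioo (v := fun _ => F) (s := fun _ => Set.univ)
      (a := -((m : ℝ) + 1)) (b := (m : ℝ) + 1) (K := K) (t₀ := 0)
      (fun _ _ => hF.lipschitzOnWith) ⟨by linarith, by linarith⟩
      (fun τ hτ => ⟨hα m τ (abs_lt.mpr hτ), trivial⟩)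
      (fun τ hτ => ⟨hα n τ ((abs_lt.mpr hτ).trans_le (by linarith)), trivial⟩)
      (by rw [h0, h0]) (abs_lt.mp ht)
  exact ⟨γ, hγ0.trans (h0 0), hγ⟩

lemma exists_lipschitzOnWith_closedBall [FiniteDimensional ℝ E] {V : E → E}
    (hV : ContDiff ℝ 1 V) (R : ℝ) :
    ∃ K : NNReal, LipschitzOnWith K V (Metric.closedBall 0 R) :=
  hV.contDiffOn.exists_lipschitzOnWith one_ne_zero (convex_closedBall 0 R)
    (isCompact_closedBall 0 R)

/-- A `C¹` vector field has a global integral curve through `x` as soon as the curves which follow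
it with a speed at most `1` are bounded on bounded intervals of time. -/
lemma exists_integralCurve_of_bound [FiniteDimensional ℝ E] {V : E → E} (hV : ContDiff ℝ 1 V) (x : E)
    (hb : ∀ T : ℝ, ∃ R : ℝ, ∀ χ : ℝ → ℝ, (∀ t, 0 ≤ χ t ∧ χ t ≤ 1) → ∀ γ : ℝ → E, γ 0 = x →
      (∀ t, HasDerivAt γ (χ t • V (γ t)) t) → ∀ t, |t| ≤ T → ‖γ t‖ ≤ R) :
    ∃ γ : ℝ → E, γ 0 = x ∧ ∀ t, HasDerivAt γ (V (γ t)) t := by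
  have : CompleteSpace E := FiniteDimensional.complete ℝ E
  choose R hR using hb
  have hloc : ∀ n : ℕ, ∃ γ : ℝ → E, γ 0 = x ∧ (∀ t : ℝ, |t| < n + 1 → ‖γ t‖ ≤ R (n + 1)) ∧
      ∀ t : ℝ, |t| < n + 1 → HasDerivAt γ (V (γ t)) t := by
    intro n
    let f : ContDiffBump (0 : E) :=
      ⟨|R (n + 1)| + 1, |R (n + 1)| + 2, by positivity, by linarith⟩
    have hFs : HasCompactSupport fun y => f y • V y := f.hasCompactSupport.smul_right
    have hFc : ContDiff ℝ 1 fun y => f y • V y := f.contDiff.smul hV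
    obtain ⟨K, hK⟩ := hFc.lipschitzWith_of_hasCompactSupport hFs one_ne_zero
    obtain ⟨L, hL⟩ := hFs.exists_bound_of_continuous hFc.continuous
    obtain ⟨γ, h0, hγ⟩ := exists_integralCurve_of_lipschitz (L := L.toNNReal) hK
      (fun y => (hL y).trans (Real.le_coe_toNNReal L)) x
    have hbd : ∀ t, |t| < (n : ℝ) + 1 → ‖γ t‖ ≤ R (n + 1) := fun t ht =>
      hR (n + 1) (fun t => f (γ t)) (fun t => ⟨f.nonneg, f.le_one⟩) γ h0 hγ t ht.le
    refine ⟨γ, h0, hbd, fun t ht => ?_⟩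
    have h1 : f (γ t) = 1 := f.one_of_mem_closedBall (by
      rw [mem_closedBall_zero_iff]
      exact (hbd t ht).trans ((le_abs_self _).trans (by show _ ≤ |R (n + 1)| + 1; linarith)))
    have := hγ t
    simp only [h1, one_smul] at this
    exact this
  choose α h0 hbd hα using hloc
  obtain ⟨γ, hγ0, hγ⟩ := exists_integralCurve_of_compatible α hα fun m n hmn t ht => by
    have hmn' : (m : ℝ) ≤ n := by exact_mod_cast hmn
    have hm : (0 : ℝ) ≤ m := Nat.cast_nonneg m
    obtain ⟨K, hK⟩ := exists_lipschitzOnWith_closedBall hV (max (R (m + 1)) (R (n + 1)))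
    refine ODE_solution_unique_of_mem_Ioo (v := fun _ => V)
      (s := fun _ => Metric.closedBall 0 (max (R (m + 1)) (R (n + 1))))
      (a := -((m : ℝ) + 1)) (b := (m : ℝ) + 1) (K := K) (t₀ := 0)
      (fun _ _ => hK) ⟨by linarith, by linarith⟩
      (fun τ hτ => ⟨hα m τ (abs_lt.mpr hτ), ?_⟩)
      (fun τ hτ => ⟨hα n τ ((abs_lt.mpr hτ).trans_le (by linarith)), ?_⟩)
      (by rw [h0, h0]) (abs_lt.mp ht)
    · rw [mem_closedBall_zero_iff]
      exact (hbd m τ (abs_lt.mpr hτ)).trans (le_max_left _ _)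
    · rw [mem_closedBall_zero_iff]
      exact (hbd n τ ((abs_lt.mpr hτ).trans_le (by linarith))).trans (le_max_right _ _)
  exact ⟨γ, hγ0.trans (h0 0), hγ⟩

lemma integralCurve_unique {V : E → E} (hV : ContDiff ℝ 1 V) {γ₁ γ₂ : ℝ → E}
    (h₁ : ∀ t, HasDerivAt γ₁ (V (γ₁ t)) t) (h₂ : ∀ t, HasDerivAt γ₂ (V (γ₂ t)) t) {t₀ : ℝ}
    (h : γ₁ t₀ = γ₂ t₀) : γ₁ = γ₂ := by
  have hc₁ : Continuous γ₁ := continuous_iff_continuousAt.mpr fun t => (h₁ t).continuousAt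
  have hc₂ : Continuous γ₂ := continuous_iff_continuousAt.mpr fun t => (h₂ t).continuousAt
  have hclosed : IsClosed {t | γ₁ t = γ₂ t} := isClosed_eq hc₁ hc₂
  have hopen : IsOpen {t | γ₁ t = γ₂ t} := isOpen_iff_mem_nhds.mpr fun t ht => by
    obtain ⟨K, s, hs, hK⟩ := (hV.contDiffAt (x := γ₁ t)).exists_lipschitzOnWith
    refine ODE_solution_unique_of_eventually (v := fun _ => V) (s := fun _ => s) (K := K)
      (Eventually.of_forall fun _ => hK) ?_ ?_ ht
    · filter_upwards [hc₁.continuousAt hs] with τ hτ using ⟨h₁ τ, hτ⟩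
    · rw [show γ₁ t = γ₂ t from ht] at hs
      filter_upwards [hc₂.continuousAt hs] with τ hτ using ⟨h₂ τ, hτ⟩
  have := IsClopen.eq_univ ⟨hclosed, hopen⟩ ⟨t₀, h⟩
  funext t
  exact (this.symm ▸ Set.mem_univ t : t ∈ {t | γ₁ t = γ₂ t})

/-- Continuous dependence of integral curves on the initial value, for curves which are uniformly
bounded. -/
lemma tendsto_integralCurve [FiniteDimensional ℝ E] {V : E → E} (hV : ContDiff ℝ 1 V) {ι : Type*}
    {l : Filter ι} {γs : ι → ℝ → E} {γ : ℝ → E} {R T : ℝ} (hT : 0 ≤ T)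
    (hs : ∀ i t, HasDerivAt (γs i) (V (γs i t)) t) (h : ∀ t, HasDerivAt γ (V (γ t)) t)
    (hbs : ∀ᶠ i in l, ∀ t ∈ Set.Icc 0 T, ‖γs i t‖ ≤ R) (hb : ∀ t ∈ Set.Icc 0 T, ‖γ t‖ ≤ R)
    (h0 : Tendsto (fun i => γs i 0) l (𝓝 (γ 0))) :
    Tendsto (fun i => γs i T) l (𝓝 (γ T)) := by
  obtain ⟨K, hK⟩ := exists_lipschitzOnWith_closedBall hV R
  rw [tendsto_iff_dist_tendsto_zero] at h0 ⊢
  have hlim : Tendsto (fun i => dist (γs i 0) (γ 0) * exp (K * (T - 0))) l (𝓝 0) := by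
    simpa using h0.mul_const (exp (K * (T - 0)))
  refine squeeze_zero' (Eventually.of_forall fun _ => dist_nonneg) ?_ hlim
  filter_upwards [hbs] with i hi
  refine dist_le_of_trajectories_ODE_of_mem (v := fun _ => V)
    (s := fun _ => Metric.closedBall 0 R) (fun _ _ => hK)
    (fun t _ => (hs i t).continuousAt.continuousWithinAt) (fun t _ => (hs i t).hasDerivWithinAt)
    (fun t ht => mem_closedBall_zero_iff.mpr (hi t (Set.Ico_subset_Icc_self ht)))
    (fun t _ => (h t).continuousAt.continuousWithinAt) (fun t _ => (h t).hasDerivWithinAt)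
    (fun t ht => mem_closedBall_zero_iff.mpr (hb t (Set.Ico_subset_Icc_self ht))) le_rfl T
    ⟨hT, le_rfl⟩

lemma contDiff_integralCurve {V : E → E} (hV : ContDiff ℝ ∞ V) {γ : ℝ → E}
    (h : ∀ t, HasDerivAt γ (V (γ t)) t) : ContDiff ℝ ∞ γ := by
  rw [contDiff_infty]
  intro n
  induction n with
  | zero =>
    exact contDiff_zero.mpr (continuous_iff_continuousAt.mpr fun t => (h t).continuousAt)
  | succ n ih =>
    have hd : deriv γ = fun t => V (γ t) := funext fun t => (h t).deriv
    rw [Nat.cast_succ, contDiff_succ_iff_deriv]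
    refine ⟨fun t => (h t).differentiableAt, by simp, ?_⟩
    rw [hd]
    exact (contDiff_infty.mp hV n).comp ih

end ODE

lemma pos_of_abs_deriv_le {f f' g : ℝ → ℝ} (hf : ∀ t, HasDerivAt f (f' t) t) (hg : Continuous g)
    (hb : ∀ t, |f' t| ≤ g t * |f t|) (h0 : 0 < f 0) (t : ℝ) : 0 < f t := by
  have hc : Continuous f := continuous_iff_continuousAt.mpr fun t => (hf t).continuousAt
  have key : ∀ (φ φ' ψ : ℝ → ℝ), (∀ t, HasDerivAt φ (φ' t) t) → Continuous ψ →
      (∀ t, |φ' t| ≤ ψ t * |φ t|) → ∀ a b, a ≤ b → φ a = 0 → φ b = 0 := by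
    intro φ φ' ψ hφ hψ hbd a b hab ha
    obtain ⟨K, hK⟩ := isCompact_Icc.exists_bound_of_continuousOn (s := Set.Icc a b) hψ.continuousOn
    refine eq_zero_of_abs_deriv_le_mul_abs_self_of_eq_zero_right (f' := φ') (K := K)
      (fun t _ => (hφ t).continuousAt.continuousWithinAt) (fun t _ => (hφ t).hasDerivWithinAt) ha
      (fun t ht => (hbd t).trans (mul_le_mul_of_nonneg_right
        ((le_abs_self _).trans (hK t (Set.Ico_subset_Icc_self ht))) (abs_nonneg _))) b ⟨hab, le_rfl⟩
  have hne : ∀ t, f t ≠ 0 := by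
    intro t ht
    rcases le_total t 0 with h | h
    · exact h0.ne' (key f f' g hf hg hb t 0 h ht)
    · have hd : ∀ s, HasDerivAt (fun s => f (-s)) (-f' (-s)) s := fun s => by
        have := HasDerivAt.comp s (hf (-s)) (hasDerivAt_neg s)
        exact this.congr_deriv (by ring)
      have := key (fun s => f (-s)) (fun s => -f' (-s)) (fun s => g (-s)) hd
        (hg.comp continuous_neg) (fun s => by rw [abs_neg]; exact hb (-s)) (-t) 0 (by linarith)
        (by simpa using ht)
      simp at this
      exact h0.ne' this
  by_contra hneg
  obtain ⟨s, hs⟩ := mem_range_of_exists_le_of_exists_ge hc ⟨t, not_lt.mp hneg⟩ ⟨0, h0.le⟩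
  exact hne s hs

lemma le_mul_exp_abs {y y' : ℝ → ℝ} {C : ℝ} (hy : ∀ t, HasDerivAt y (y' t) t)
    (hb : ∀ t, |y' t| ≤ C * y t) (t : ℝ) : y t ≤ y 0 * exp (C * |t|) := by
  have hd1 : ∀ t, HasDerivAt (fun t => y t * exp (-(C * t)))
      ((y' t - C * y t) * exp (-(C * t))) t := fun t => by
    have h1 : HasDerivAt (fun t : ℝ => exp (-(C * t))) (exp (-(C * t)) * (-(C * 1))) t :=
      (((hasDerivAt_id t).const_mul C).neg).exp
    exact ((hy t).mul h1).congr_deriv (by ring)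
  have hd2 : ∀ t, HasDerivAt (fun t => y t * exp (C * t))
      ((y' t + C * y t) * exp (C * t)) t := fun t => by
    have h1 : HasDerivAt (fun t : ℝ => exp (C * t)) (exp (C * t) * (C * 1)) t :=
      ((hasDerivAt_id t).const_mul C).exp
    exact ((hy t).mul h1).congr_deriv (by ring)
  rcases le_total 0 t with h | h
  · have hanti : Antitone fun t => y t * exp (-(C * t)) :=
      antitone_of_hasDerivAt_nonpos hd1 fun t =>
        mul_nonpos_of_nonpos_of_nonneg (by linarith [(abs_le.mp (hb t)).2]) (exp_pos _).le
    have := hanti h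
    simp only [mul_zero, neg_zero, exp_zero, mul_one] at this
    rw [abs_of_nonneg h]
    calc y t = y t * exp (-(C * t)) * exp (C * t) := by rw [mul_assoc, ← exp_add]; simp
      _ ≤ _ := mul_le_mul_of_nonneg_right this (exp_pos _).le
  · have hmono : Monotone fun t => y t * exp (C * t) :=
      monotone_of_hasDerivAt_nonneg hd2 fun t =>
        mul_nonneg (by linarith [(abs_le.mp (hb t)).1]) (exp_pos _).le
    have := hmono h
    simp only [mul_zero, exp_zero, mul_one] at this
    rw [abs_of_nonpos h]
    calc y t = y t * exp (C * t) * exp (C * -t) := by rw [mul_assoc, ← exp_add]; simp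
      _ ≤ _ := mul_le_mul_of_nonneg_right this (exp_pos _).le

end
end DampedSzego
namespace DampedSzego
noncomputable section

/-! ### The flow of the reduced equation -/

lemma contDiff_conj {E : Type*} [NormedAddCommGroup E] [NormedSpace ℝ E] {n : WithTop ℕ∞}
    {f : E → ℂ} (hf : ContDiff ℝ n f) : ContDiff ℝ n fun x => (starRingEnd ℂ) (f x) :=
  Complex.conjCLE.contDiff.comp hf

lemma contDiff_vf (ν α β M : ℝ) : ContDiff ℝ ∞ (vf ν α β M) := by
  have hb : ContDiff ℝ ∞ fun z : ℂ × ℂ × ℂ => z.1 := contDiff_fst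
  have hc : ContDiff ℝ ∞ fun z : ℂ × ℂ × ℂ => z.2.1 := contDiff_fst.comp contDiff_snd
  have hp : ContDiff ℝ ∞ fun z : ℂ × ℂ × ℂ => z.2.2 := contDiff_snd.comp contDiff_snd
  have hb' := contDiff_conj hb
  have hp' := contDiff_conj hp
  unfold vf
  fun_prop

lemma hasDerivAt_coords {γ : ℝ → ℂ × ℂ × ℂ} {v : ℂ × ℂ × ℂ} {t : ℝ} (h : HasDerivAt γ v t) :
    HasDerivAt (fun t => (γ t).1) v.1 t ∧ HasDerivAt (fun t => (γ t).2.1) v.2.1 t ∧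
      HasDerivAt (fun t => (γ t).2.2) v.2.2 t :=
  ⟨h.fst, h.snd.fst, h.snd.snd⟩

lemma hasDerivAt_norm_sq {f : ℝ → ℂ} {f' : ℂ} {t : ℝ} (hf : HasDerivAt f f' t) :
    HasDerivAt (fun s => ‖f s‖ ^ 2) (2 * ((f t).re * f'.re + (f t).im * f'.im)) t := by
  have := hf.norm_sq
  rw [Complex.inner] at this
  simp only [Complex.mul_re, Complex.conj_re, Complex.conj_im] at this
  exact this.congr_deriv (by ring)

lemma normSq_eq (w : ℂ) : ‖w‖ ^ 2 = w.re * w.re + w.im * w.im := by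
  rw [← Complex.normSq_eq_norm_sq, Complex.normSq_apply]

/-- The gauge invariant quantity `b c̄ p`. -/
def crossTerm (z : ℂ × ℂ × ℂ) : ℂ := z.1 * (starRingEnd ℂ) z.2.1 * z.2.2

/-- The quantity `1 - |p|²`. -/
def eta (z : ℂ × ℂ × ℂ) : ℝ := 1 - ‖z.2.2‖ ^ 2

/-- The Lyapunov function `|b|² + M (1 - |p|²)`, the squared `L²` norm on `𝓔_M`. -/
def lyap (M : ℝ) (z : ℂ × ℂ × ℂ) : ℝ := ‖z.1‖ ^ 2 + M * eta z

section Evolution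
variable {ν α β M : ℝ} {γ : ℝ → ℂ × ℂ × ℂ} {χ : ℝ} {t : ℝ}

lemma hasDerivAt_normSq_b (h : HasDerivAt γ (χ • vf ν α β M (γ t)) t) :
    HasDerivAt (fun t => ‖(γ t).1‖ ^ 2)
      (χ * (-2 * ν * ‖(γ t).1‖ ^ 2 - 2 * M * (crossTerm (γ t)).im)) t := by
  refine (hasDerivAt_norm_sq (hasDerivAt_coords h).1).congr_deriv ?_
  rw [normSq_eq]
  simp [vf, crossTerm]
  ring

lemma hasDerivAt_normSq_c (h : HasDerivAt γ (χ • vf ν α β M (γ t)) t) :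
    HasDerivAt (fun t => ‖(γ t).2.1‖ ^ 2)
      (χ * (4 * M * eta (γ t) * (crossTerm (γ t)).im)) t := by
  refine (hasDerivAt_norm_sq (hasDerivAt_coords h).2.1).congr_deriv ?_
  rw [eta, normSq_eq]
  simp [vf, crossTerm]
  ring

lemma hasDerivAt_eta (h : HasDerivAt γ (χ • vf ν α β M (γ t)) t) :
    HasDerivAt (fun t => eta (γ t)) (χ * (2 * (crossTerm (γ t)).im)) t := by
  refine ((hasDerivAt_norm_sq (hasDerivAt_coords h).2.2).const_sub 1).congr_deriv ?_
  simp [vf, crossTerm]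
  ring

end Evolution

lemma eta_pos {z : ℂ × ℂ × ℂ} (h : ‖z.2.2‖ < 1) : 0 < eta z := by
  rw [eta]; nlinarith [norm_nonneg z.2.2]

lemma eta_le_one (z : ℂ × ℂ × ℂ) : eta z ≤ 1 := by
  rw [eta]; nlinarith [sq_nonneg ‖z.2.2‖]

lemma norm_lt_one_of_eta_pos {z : ℂ × ℂ × ℂ} (h : 0 < eta z) : ‖z.2.2‖ < 1 := by
  rw [eta] at h; nlinarith [norm_nonneg z.2.2]

lemma norm_c_of_mem {M : ℝ} {z : ℂ × ℂ × ℂ} (hz : z ∈ levelSet M) :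
    ‖z.2.1‖ = √M * eta z := by
  have h := eta_pos hz.1
  have h2 : ‖z.2.1‖ ^ 2 = M * eta z ^ 2 := hz.2
  rw [← Real.sqrt_sq (norm_nonneg z.2.1), h2, Real.sqrt_mul' _ (sq_nonneg _), Real.sqrt_sq h.le]

lemma norm_crossTerm_le {M : ℝ} {z : ℂ × ℂ × ℂ} (hz : z ∈ levelSet M) :
    ‖crossTerm z‖ ≤ √M * ‖z.1‖ * eta z := by
  rw [crossTerm, norm_mul, norm_mul, RCLike.norm_conj, norm_c_of_mem hz]
  have h := eta_pos hz.1
  have : ‖z.1‖ * (√M * eta z) * ‖z.2.2‖ ≤ ‖z.1‖ * (√M * eta z) * 1 :=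
    mul_le_mul_of_nonneg_left hz.1.le (by positivity)
  linarith

/-- The set `𝓔_M` is invariant along the reduced vector field, even if it is followed with a
variable speed, and the growth is at most exponential. -/
lemma slow_curve_bound {ν α β M : ℝ} (hν : 0 < ν) (hM : 0 < M) {γ : ℝ → ℂ × ℂ × ℂ} {χ : ℝ → ℝ}
    (hχ : ∀ t, 0 ≤ χ t ∧ χ t ≤ 1) (hγ : ∀ t, HasDerivAt γ (χ t • vf ν α β M (γ t)) t)
    (h0 : γ 0 ∈ levelSet M) (t : ℝ) : γ t ∈ levelSet M ∧
      ‖(γ t).1‖ ^ 2 + 1 ≤ (‖(γ 0).1‖ ^ 2 + 1) * exp ((2 * ν + M * √M) * |t|) := by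
  have hcont : Continuous γ := continuous_iff_continuousAt.mpr fun t => (hγ t).continuousAt
  -- this relation is preserved even where `eta` is not known to be positive yet
  have hJ : ∀ t, ‖(γ t).2.1‖ ^ 2 = M * eta (γ t) ^ 2 := by
    have hd : ∀ t, HasDerivAt (fun t => ‖(γ t).2.1‖ ^ 2 - M * eta (γ t) ^ 2) 0 t := fun t =>
      ((hasDerivAt_normSq_c (hγ t)).sub (((hasDerivAt_eta (hγ t)).pow 2).const_mul M)).congr_deriv
        (by norm_num; ring)
    intro t
    have := is_const_of_deriv_eq_zero (fun t => (hd t).differentiableAt) (fun t => (hd t).deriv) t 0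
    have h2 : ‖(γ 0).2.1‖ ^ 2 = M * eta (γ 0) ^ 2 := h0.2
    linarith
  have hc : ∀ t, ‖(γ t).2.1‖ = √M * |eta (γ t)| := fun t => by
    rw [← Real.sqrt_sq (norm_nonneg (γ t).2.1), hJ t, Real.sqrt_mul' _ (sq_nonneg _),
      Real.sqrt_sq_eq_abs]
  -- `|η'| ≤ g |η|` with `g` continuous, so that `η` cannot reach zero in finite time
  have hη : ∀ t, 0 < eta (γ t) := by
    refine pos_of_abs_deriv_le (fun t => hasDerivAt_eta (hγ t))
      (g := fun t => 2 * (√M * ‖(γ t).1‖ * ‖(γ t).2.2‖)) (by fun_prop) (fun t => ?_)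
      (eta_pos h0.1)
    have h1 : |(crossTerm (γ t)).im| ≤ ‖crossTerm (γ t)‖ := Complex.abs_im_le_norm _
    rw [crossTerm, norm_mul, norm_mul, RCLike.norm_conj, hc t] at h1
    rw [abs_mul, abs_of_nonneg (hχ t).1, abs_mul, abs_two]
    calc χ t * (2 * |(crossTerm (γ t)).im|) ≤ 1 * (2 * |(crossTerm (γ t)).im|) :=
          mul_le_mul_of_nonneg_right (hχ t).2 (by positivity)
      _ ≤ 2 * (‖(γ t).1‖ * (√M * |eta (γ t)|) * ‖(γ t).2.2‖) := by rw [crossTerm]; linarith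
      _ = _ := by ring
  have hmem : ∀ t, γ t ∈ levelSet M := fun t => ⟨norm_lt_one_of_eta_pos (hη t), hJ t⟩
  refine ⟨hmem t, ?_⟩
  refine le_mul_exp_abs (y := fun t => ‖(γ t).1‖ ^ 2 + 1)
    (fun t => (hasDerivAt_normSq_b (hγ t)).add_const 1) (fun t => ?_) t
  have h1 : |(crossTerm (γ t)).im| ≤ √M * ‖(γ t).1‖ := by
    refine (Complex.abs_im_le_norm _).trans ((norm_crossTerm_le (hmem t)).trans ?_)
    exact mul_le_of_le_one_right (by positivity) (eta_le_one _)
  rw [abs_mul, abs_of_nonneg (hχ t).1]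
  have hs := Real.sqrt_nonneg M
  calc χ t * |-2 * ν * ‖(γ t).1‖ ^ 2 - 2 * M * (crossTerm (γ t)).im|
      ≤ 1 * |-2 * ν * ‖(γ t).1‖ ^ 2 - 2 * M * (crossTerm (γ t)).im| :=
        mul_le_mul_of_nonneg_right (hχ t).2 (abs_nonneg _)
    _ ≤ 2 * ν * ‖(γ t).1‖ ^ 2 + 2 * M * |(crossTerm (γ t)).im| := by
        rw [one_mul]
        refine (abs_sub _ _).trans ?_
        rw [abs_mul, abs_mul, abs_mul, abs_mul, abs_of_pos hν, abs_of_pos hM, abs_neg, abs_two,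
          abs_of_nonneg (sq_nonneg ‖(γ t).1‖)]
    _ ≤ 2 * ν * ‖(γ t).1‖ ^ 2 + M * √M * (2 * ‖(γ t).1‖) := by nlinarith
    _ ≤ (2 * ν + M * √M) * (‖(γ t).1‖ ^ 2 + 1) := by
        have : 0 ≤ M * √M * (‖(γ t).1‖ - 1) ^ 2 := by positivity
        nlinarith

lemma norm_le_of_mem {M : ℝ} {z : ℂ × ℂ × ℂ} (hz : z ∈ levelSet M) {B : ℝ}
    (hB : ‖z.1‖ ^ 2 + 1 ≤ B) : ‖z‖ ≤ B + √M := by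
  have h1 : ‖z.1‖ ≤ B := by nlinarith [sq_nonneg (‖z.1‖ - 1), norm_nonneg z.1]
  have h2 : ‖z.2.1‖ ≤ √M := by
    rw [norm_c_of_mem hz]
    exact mul_le_of_le_one_right (Real.sqrt_nonneg _) (eta_le_one z)
  have h3 : 0 ≤ √M := Real.sqrt_nonneg _
  have h4 : 1 ≤ B := by nlinarith [sq_nonneg ‖z.1‖]
  refine norm_prod_le_iff.mpr ⟨by linarith, norm_prod_le_iff.mpr ⟨by linarith, ?_⟩⟩
  linarith [hz.1]

/-- Global integral curves of the reduced vector field which are contained in `𝓔_M`. -/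
structure IsOrbit (ν α β M : ℝ) (γ : ℝ → ℂ × ℂ × ℂ) : Prop where
  deriv : ∀ t, HasDerivAt γ (vf ν α β M (γ t)) t
  mem : ∀ t, γ t ∈ levelSet M

lemma isOrbit_of_hasDerivAt {ν α β M : ℝ} (hν : 0 < ν) (hM : 0 < M) {γ : ℝ → ℂ × ℂ × ℂ}
    (hγ : ∀ t, HasDerivAt γ (vf ν α β M (γ t)) t) (h0 : γ 0 ∈ levelSet M) :
    IsOrbit ν α β M γ :=
  ⟨hγ, fun t => (slow_curve_bound hν hM (χ := fun _ => 1) (fun _ => ⟨zero_le_one, le_rfl⟩)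
    (fun t => by rw [one_smul]; exact hγ t) h0 t).1⟩

lemma exists_orbit {ν : ℝ} (α β : ℝ) {M : ℝ} (hν : 0 < ν) (hM : 0 < M) {z : ℂ × ℂ × ℂ}
    (hz : z ∈ levelSet M) : ∃ γ, IsOrbit ν α β M γ ∧ γ 0 = z := by
  obtain ⟨γ, h0, hγ⟩ := exists_integralCurve_of_bound (V := vf ν α β M)
    ((contDiff_vf ν α β M).of_le (by simp)) z fun T => by
      refine ⟨(‖z.1‖ ^ 2 + 1) * exp ((2 * ν + M * √M) * T) + √M, fun χ hχ γ h0 hγ t ht => ?_⟩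
      obtain ⟨h1, h2⟩ := slow_curve_bound hν hM hχ hγ (h0.symm ▸ hz) t
      refine norm_le_of_mem h1 (h2.trans ?_)
      rw [h0]
      have : 0 ≤ 2 * ν + M * √M := by positivity
      gcongr
  exact ⟨γ, isOrbit_of_hasDerivAt hν hM hγ (h0.symm ▸ hz), h0⟩

namespace IsOrbit

variable {ν α β M : ℝ} {γ δ : ℝ → ℂ × ℂ × ℂ}

lemma continuous (h : IsOrbit ν α β M γ) : Continuous γ :=
  continuous_iff_continuousAt.mpr fun t => (h.deriv t).continuousAt

lemma unique (h : IsOrbit ν α β M γ) (h' : IsOrbit ν α β M δ) {t : ℝ} (e : γ t = δ t) : γ = δ :=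
  integralCurve_unique ((contDiff_vf ν α β M).of_le (by simp)) h.deriv h'.deriv e

lemma shift (h : IsOrbit ν α β M γ) (a : ℝ) : IsOrbit ν α β M fun t => γ (t + a) :=
  ⟨fun t => (h.deriv (t + a)).comp_add_const t a, fun t => h.mem (t + a)⟩

lemma contDiff (h : IsOrbit ν α β M γ) : ContDiff ℝ ∞ γ :=
  contDiff_integralCurve (contDiff_vf ν α β M) h.deriv

lemma smul_deriv (h : IsOrbit ν α β M γ) (t : ℝ) :
    HasDerivAt γ ((1 : ℝ) • vf ν α β M (γ t)) t := by
  rw [one_smul]; exact h.deriv t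

lemma hasDerivAt_eta (h : IsOrbit ν α β M γ) (t : ℝ) :
    HasDerivAt (fun t => eta (γ t)) (2 * (crossTerm (γ t)).im) t :=
  (DampedSzego.hasDerivAt_eta (h.smul_deriv t)).congr_deriv (by ring)

lemma hasDerivAt_lyap (h : IsOrbit ν α β M γ) (t : ℝ) :
    HasDerivAt (fun t => lyap M (γ t)) (-(2 * ν) * ‖(γ t).1‖ ^ 2) t :=
  ((hasDerivAt_normSq_b (h.smul_deriv t)).add ((h.hasDerivAt_eta t).const_mul M)).congr_deriv
    (by ring)

lemma antitone_lyap (h : IsOrbit ν α β M γ) (hν : 0 < ν) : Antitone fun t => lyap M (γ t) :=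
  antitone_of_hasDerivAt_nonpos h.hasDerivAt_lyap fun t => by
    have := mul_nonneg hν.le (sq_nonneg ‖(γ t).1‖)
    simp only [Pi.zero_apply]
    linarith

lemma norm_le (h : IsOrbit ν α β M γ) (hν : 0 < ν) (hM : 0 < M) {t : ℝ} {T B : ℝ}
    (ht : t ∈ Set.Icc 0 T) (hB : ‖γ 0‖ ≤ B) :
    ‖γ t‖ ≤ (B ^ 2 + 1) * exp ((2 * ν + M * √M) * T) + √M := by
  obtain ⟨h1, h2⟩ := slow_curve_bound hν hM (χ := fun _ => 1) (fun _ => ⟨zero_le_one, le_rfl⟩)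
    h.smul_deriv (h.mem 0) t
  refine norm_le_of_mem h1 (h2.trans ?_)
  have h3 : ‖(γ 0).1‖ ≤ B := (norm_fst_le _).trans hB
  have : 0 ≤ 2 * ν + M * √M := by positivity
  rw [abs_of_nonneg ht.1]
  have := ht.2
  gcongr

/-- Continuous dependence on the initial value. -/
lemma tendsto_of_tendsto (hν : 0 < ν) (hM : 0 < M) {ι : Type*} {l : Filter ι}
    {γs : ι → ℝ → ℂ × ℂ × ℂ} (hs : ∀ i, IsOrbit ν α β M (γs i)) (h : IsOrbit ν α β M γ)
    (h0 : Tendsto (fun i => γs i 0) l (𝓝 (γ 0))) {T : ℝ} (hT : 0 ≤ T) :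
    Tendsto (fun i => γs i T) l (𝓝 (γ T)) := by
  refine tendsto_integralCurve ((contDiff_vf ν α β M).of_le (by simp)) hT
    (fun i => (hs i).deriv) h.deriv
    (R := ((‖γ 0‖ + 1) ^ 2 + 1) * exp ((2 * ν + M * √M) * T) + √M) ?_ ?_ h0
  · filter_upwards [h0.norm.eventually (gt_mem_nhds (lt_add_one ‖γ 0‖))] with i hi t ht
    exact (hs i).norm_le hν hM ht hi.le
  · intro t ht
    exact h.norm_le hν hM ht (by linarith)

end IsOrbit

/-- The action of the torus of gauge transformations and translations on the coordinates. -/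
def rot (a d : ℂ) (z : ℂ × ℂ × ℂ) : ℂ × ℂ × ℂ := (a * z.1, a * d * z.2.1, d * z.2.2)

lemma mul_conj_of_norm_one {a : ℂ} (ha : ‖a‖ = 1) : a * (starRingEnd ℂ) a = 1 := by
  rw [Complex.mul_conj, Complex.normSq_eq_norm_sq, ha]; simp

lemma vf_rot (ν α β M : ℝ) {a d : ℂ} (ha : ‖a‖ = 1) (hd : ‖d‖ = 1) (z : ℂ × ℂ × ℂ) :
    vf ν α β M (rot a d z) = rot a d (vf ν α β M z) := by
  have ha' := mul_conj_of_norm_one ha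
  have hd' := mul_conj_of_norm_one hd
  obtain ⟨b, c, p⟩ := z
  simp only [vf, rot, map_mul]
  generalize (starRingEnd ℂ) a = a' at *
  generalize (starRingEnd ℂ) d = d' at *
  generalize (starRingEnd ℂ) b = b'
  generalize (starRingEnd ℂ) p = p'
  have ea : a' = a⁻¹ := eq_inv_of_mul_eq_one_right ha'
  have ed : d' = d⁻¹ := eq_inv_of_mul_eq_one_right hd'
  have ha0 : a ≠ 0 := by rintro rfl; simp at ha
  have hd0 : d ≠ 0 := by rintro rfl; simp at hd
  subst ea ed
  refine Prod.ext ?_ (Prod.ext ?_ ?_) <;> simp only <;> field_simp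

lemma rot_mem_levelSet {M : ℝ} {a d : ℂ} (ha : ‖a‖ = 1) (hd : ‖d‖ = 1) {z : ℂ × ℂ × ℂ}
    (hz : z ∈ levelSet M) : rot a d z ∈ levelSet M := by
  simpa [rot, levelSet, ha, hd] using hz

lemma IsOrbit.rot {ν α β M : ℝ} {γ : ℝ → ℂ × ℂ × ℂ} (h : IsOrbit ν α β M γ) {a d : ℂ}
    (ha : ‖a‖ = 1) (hd : ‖d‖ = 1) : IsOrbit ν α β M fun t => rot a d (γ t) := by
  refine ⟨fun t => ?_, fun t => rot_mem_levelSet ha hd (h.mem t)⟩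
  rw [vf_rot ν α β M ha hd]
  obtain ⟨h1, h2, h3⟩ := hasDerivAt_coords (h.deriv t)
  exact (h1.const_mul a).prodMk ((h2.const_mul (a * d)).prodMk (h3.const_mul d))

/-- A solution starting from `𝓔_M` is given by an integral curve of the reduced vector field. -/
lemma IsSolution.exists_orbit {ν α β M : ℝ} (hν : 0 < ν) (hM : 0 < M) {u : ℝ → Torus → ℂ}
    (hu : IsSolution ν α β u) (h0 : u 0 ∈ energyLevel M) :
    ∃ γ, IsOrbit ν α β M γ ∧ u = fun t => rankOne (γ t) := by
  obtain ⟨z, hz, e⟩ := (mem_energyLevel_iff hM).mp h0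
  obtain ⟨γ, hγ, hγ0⟩ := DampedSzego.exists_orbit α β hν hM hz
  exact ⟨γ, hγ, hu.unique (isSolution_rankOne hγ.deriv hγ.mem) (by rw [e, hγ0])⟩

end
end DampedSzego
namespace DampedSzego
noncomputable section

/-! ### Convergence lemmas for scalar functions -/

/-- A version of Barbalat's lemma: if a function converges and its derivative is Lipschitz, then
the derivative tends to zero. -/
lemma tendsto_zero_of_primitive_tendsto {E : Type*} [NormedAddCommGroup E] [NormedSpace ℝ E]
    {F f : ℝ → E} {l : E} {C : ℝ} (hF : ∀ t, HasDerivAt F (f t) t)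
    (hf : ∀ s t, 0 ≤ s → 0 ≤ t → ‖f s - f t‖ ≤ C * |s - t|) (hl : Tendsto F atTop (𝓝 l)) :
    Tendsto f atTop (𝓝 0) := by
  have hC : 0 ≤ C := by
    have := (norm_nonneg _).trans (hf 1 0 zero_le_one le_rfl)
    simpa using this
  rw [Metric.tendsto_nhds]
  intro ε hε
  set δ := ε / (2 * (C + 1)) with hδ
  have hδ0 : 0 < δ := by positivity
  have hCδ : C * δ < ε / 2 := by
    rw [hδ, mul_div_assoc', div_lt_div_iff₀ (by positivity) two_pos]
    nlinarith
  have h1 : Tendsto (fun t => F (t + δ) - F t) atTop (𝓝 (l - l)) :=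
    (hl.comp (tendsto_atTop_add_const_right _ δ tendsto_id)).sub hl
  rw [sub_self] at h1
  have h2 : ∀ᶠ t in atTop, ‖F (t + δ) - F t‖ < ε / 2 * δ := by
    have := (h1.norm).eventually (gt_mem_nhds (show ‖(0 : E)‖ < ε / 2 * δ by
      rw [norm_zero]; positivity))
    exact this
  filter_upwards [h2, eventually_ge_atTop 0] with t ht ht0
  rw [dist_zero_right]
  have h3 : ‖(F (t + δ) - (t + δ) • f t) - (F t - t • f t)‖ ≤ C * δ * ‖(t + δ) - t‖ := by
    refine (convex_Icc t (t + δ)).norm_image_sub_le_of_norm_hasDerivWithin_le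
      (f := fun s => F s - s • f t) (f' := fun s => f s - f t) (fun s _ => ?_) (fun s hs => ?_)
      ⟨le_rfl, by linarith⟩ ⟨by linarith, le_rfl⟩
    · have := ((hF s).sub ((hasDerivAt_id s).smul_const (f t)))
      simp only [one_smul] at this
      exact this.hasDerivWithinAt
    · refine (hf s t (ht0.trans hs.1) ht0).trans (mul_le_mul_of_nonneg_left ?_ hC)
      rw [abs_of_nonneg (by linarith [hs.1])]; linarith [hs.2]
  have h4 : (F (t + δ) - (t + δ) • f t) - (F t - t • f t) = (F (t + δ) - F t) - δ • f t := by
    rw [add_smul]; abel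
  rw [h4, add_sub_cancel_left, Real.norm_of_nonneg hδ0.le] at h3
  have h5 : δ * ‖f t‖ ≤ ‖F (t + δ) - F t‖ + C * δ * δ := by
    have : ‖δ • f t‖ ≤ ‖F (t + δ) - F t‖ + ‖(F (t + δ) - F t) - δ • f t‖ := by
      have := norm_sub_le (F (t + δ) - F t) ((F (t + δ) - F t) - δ • f t)
      rwa [sub_sub_cancel] at this
    rw [norm_smul, Real.norm_of_nonneg hδ0.le] at this
    linarith
  have h6 : δ * ‖f t‖ < δ * ε := by nlinarith
  exact lt_of_mul_lt_mul_left h6 hδ0.le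

/-- Solutions of a stable scalar differential inequality with vanishing forcing tend to zero. -/
lemma tendsto_zero_of_deriv_le {y y' h : ℝ → ℝ} {c : ℝ} (hc : 0 < c)
    (hy : ∀ t, HasDerivAt y (y' t) t) (hy0 : ∀ t, 0 ≤ y t)
    (hle : ∀ᶠ t in atTop, y' t ≤ -c * y t + h t) (hh : Tendsto h atTop (𝓝 0)) :
    Tendsto y atTop (𝓝 0) := by
  rw [Metric.tendsto_nhds]
  intro ε hε
  have h1 : ∀ᶠ t in atTop, h t < c * (ε / 2) := hh.eventually (gt_mem_nhds (by positivity))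
  obtain ⟨T, hT⟩ := eventually_atTop.mp (hle.and h1)
  have hd : ∀ t, HasDerivAt (fun t => (y t - ε / 2) * exp (c * t))
      ((y' t + c * (y t - ε / 2)) * exp (c * t)) t := fun t => by
    have h1 : HasDerivAt (fun t : ℝ => exp (c * t)) (exp (c * t) * (c * 1)) t :=
      ((hasDerivAt_id t).const_mul c).exp
    exact (((hy t).sub_const _).mul h1).congr_deriv (by ring)
  have hanti : AntitoneOn (fun t => (y t - ε / 2) * exp (c * t)) (Set.Ici T) := by
    refine antitoneOn_of_deriv_nonpos (convex_Ici T)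
      (fun t _ => (hd t).continuousAt.continuousWithinAt)
      (fun t _ => (hd t).differentiableAt.differentiableWithinAt) fun t ht => ?_
    rw [interior_Ici] at ht
    rw [(hd t).deriv]
    obtain ⟨a, b⟩ := hT t (le_of_lt ht)
    exact mul_nonpos_of_nonpos_of_nonneg (by linarith) (exp_pos _).le
  have hlim : Tendsto (fun t => ε / 2 + ((y T - ε / 2) * exp (c * T)) * exp (-(c * t))) atTop
      (𝓝 (ε / 2 + ((y T - ε / 2) * exp (c * T)) * 0)) :=
    ((tendsto_exp_neg_atTop_nhds_zero.comp (tendsto_id.const_mul_atTop hc)).const_mul _).const_add _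
  rw [mul_zero, add_zero] at hlim
  filter_upwards [eventually_ge_atTop T, hlim.eventually (gt_mem_nhds (half_lt_self hε))]
    with t ht hlt
  rw [dist_zero_right, Real.norm_of_nonneg (hy0 t)]
  refine lt_of_le_of_lt ?_ hlt
  have := hanti (Set.mem_Ici.mpr le_rfl) (Set.mem_Ici.mpr ht) ht
  simp only at this
  have h3 := mul_le_mul_of_nonneg_right this (exp_pos (-(c * t))).le
  rw [mul_assoc, ← exp_add, add_neg_cancel, exp_zero, mul_one] at h3
  linarith

/-- Bounded solutions of an unstable scalar differential inequality with vanishing forcing tend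
to zero. -/
lemma tendsto_zero_of_le_deriv {y y' h : ℝ → ℝ} {c B : ℝ} (hc : 0 < c)
    (hy : ∀ᶠ t in atTop, HasDerivAt y (y' t) t) (hy0 : ∀ t, 0 ≤ y t)
    (hB : ∀ᶠ t in atTop, y t ≤ B)
    (hle : ∀ᶠ t in atTop, c * y t - h t ≤ y' t) (hh : Tendsto h atTop (𝓝 0)) :
    Tendsto y atTop (𝓝 0) := by
  rw [Metric.tendsto_nhds]
  intro ε hε
  have h1 : ∀ᶠ t in atTop, h t < c * (ε / 2) := hh.eventually (gt_mem_nhds (by positivity))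
  obtain ⟨T, hT⟩ := eventually_atTop.mp (hy.and (hB.and (hle.and h1)))
  filter_upwards [eventually_ge_atTop T] with t₀ ht₀
  rw [dist_zero_right, Real.norm_of_nonneg (hy0 t₀)]
  by_contra! hlt
  have hd : ∀ t, T ≤ t → HasDerivAt (fun t => (y t - ε / 2) * exp (-(c * t)))
      ((y' t - c * (y t - ε / 2)) * exp (-(c * t))) t := fun t ht => by
    have h1 : HasDerivAt (fun t : ℝ => exp (-(c * t))) (exp (-(c * t)) * (-(c * 1))) t :=
      (((hasDerivAt_id t).const_mul c).neg).exp
    exact (((hT t ht).1.sub_const _).mul h1).congr_deriv (by ring)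
  have hmono : MonotoneOn (fun t => (y t - ε / 2) * exp (-(c * t))) (Set.Ici T) := by
    refine monotoneOn_of_deriv_nonneg (convex_Ici T)
      (fun t ht => (hd t ht).continuousAt.continuousWithinAt)
      (fun t ht => (hd t (interior_subset ht)).differentiableAt.differentiableWithinAt)
      fun t ht => ?_
    rw [interior_Ici] at ht
    rw [(hd t (le_of_lt ht)).deriv]
    obtain ⟨-, -, a, b⟩ := hT t (le_of_lt ht)
    exact mul_nonneg (by linarith) (exp_pos _).le
  have hpos : 0 < (y t₀ - ε / 2) * exp (-(c * t₀)) := mul_pos (by linarith) (exp_pos _)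
  have hlim : Tendsto (fun t => (B - ε / 2) * exp (-(c * t))) atTop (𝓝 ((B - ε / 2) * 0)) :=
    (tendsto_exp_neg_atTop_nhds_zero.comp (tendsto_id.const_mul_atTop hc)).const_mul _
  rw [mul_zero] at hlim
  refine absurd (ge_of_tendsto hlim ?_) (not_le.mpr hpos)
  filter_upwards [eventually_ge_atTop t₀] with t ht
  refine (hmono (Set.mem_Ici.mpr ht₀) (Set.mem_Ici.mpr (ht₀.trans ht)) ht).trans ?_
  exact mul_le_mul_of_nonneg_right (by linarith [(hT t (ht₀.trans ht)).2.1]) (exp_pos _).le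

/-- Solutions of `E' = -a E + f` with `a → a₀`, `Re a₀ > 0` and `f → f₀` tend to `f₀ / a₀`. -/
lemma tendsto_of_linear_ode {D a f : ℝ → ℂ} {a₀ f₀ : ℂ} (ha₀ : 0 < a₀.re)
    (hD : ∀ t, HasDerivAt D (-a t * D t + f t) t) (ha : Tendsto a atTop (𝓝 a₀))
    (hf : Tendsto f atTop (𝓝 f₀)) : Tendsto D atTop (𝓝 (f₀ / a₀)) := by
  have ha0 : a₀ ≠ 0 := by rintro rfl; simp at ha₀
  set g : ℝ → ℂ := fun t => f t - a t * (f₀ / a₀) with hg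
  have hg0 : Tendsto g atTop (𝓝 0) := by
    have := hf.sub (ha.mul_const (f₀ / a₀))
    rwa [mul_div_cancel₀ _ ha0, sub_self] at this
  have hd : ∀ t, HasDerivAt (fun t => D t - f₀ / a₀) (-a t * (D t - f₀ / a₀) + g t) t := fun t =>
    ((hD t).sub_const _).congr_deriv (by rw [hg]; ring)
  set c := a₀.re / 2 with hc
  have hc0 : 0 < c := by positivity
  have hre : ∀ᶠ t in atTop, c < (a t).re :=
    ((Complex.continuous_re.tendsto a₀).comp ha).eventually (lt_mem_nhds (half_lt_self ha₀))
  have hh : Tendsto (fun t => ‖g t‖ ^ 2 / c) atTop (𝓝 0) := by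
    simpa using (hg0.norm.pow 2).div_const c
  have key : Tendsto (fun t => ‖D t - f₀ / a₀‖ ^ 2) atTop (𝓝 0) := by
    refine tendsto_zero_of_deriv_le hc0 (fun t => hasDerivAt_norm_sq (hd t))
      (fun t => sq_nonneg _) ?_ hh
    filter_upwards [hre] with t ht
    generalize D t - f₀ / a₀ = w
    have e : 2 * (w.re * (-a t * w + g t).re + w.im * (-a t * w + g t).im) =
        -(2 * (a t).re) * ‖w‖ ^ 2 + 2 * (w * (starRingEnd ℂ) (g t)).re := by
      rw [normSq_eq]; simp; ring
    rw [e]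
    have h1 : (w * (starRingEnd ℂ) (g t)).re ≤ ‖w‖ * ‖g t‖ := by
      refine (Complex.re_le_norm _).trans ?_
      rw [norm_mul, RCLike.norm_conj]
    have h2 : 2 * (‖w‖ * ‖g t‖) ≤ c * ‖w‖ ^ 2 + ‖g t‖ ^ 2 / c := by
      have : 0 ≤ (c * ‖w‖ - ‖g t‖) ^ 2 / c := by positivity
      have h3 : (c * ‖w‖ - ‖g t‖) ^ 2 / c = c * ‖w‖ ^ 2 - 2 * (‖w‖ * ‖g t‖) + ‖g t‖ ^ 2 / c := by
        field_simp; ring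
      linarith
    nlinarith [sq_nonneg ‖w‖]
  have h1 : Tendsto (fun t => ‖D t - f₀ / a₀‖) atTop (𝓝 0) := by
    have := key.sqrt
    simpa only [Real.sqrt_sq (norm_nonneg _), Real.sqrt_zero] using this
  have := (tendsto_zero_iff_norm_tendsto_zero.mpr h1).add_const (f₀ / a₀)
  simpa using this

/-- If the derivative converges to `l`, then so does the quotient by the variable. -/
lemma tendsto_div_of_tendsto_deriv {f f' : ℝ → ℝ} {l : ℝ} (hf : ∀ t, HasDerivAt f (f' t) t)
    (hl : Tendsto f' atTop (𝓝 l)) : Tendsto (fun t => f t / t) atTop (𝓝 l) := by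
  rw [Metric.tendsto_nhds]
  intro ε hε
  obtain ⟨T, hT⟩ := eventually_atTop.mp (Metric.tendsto_nhds.mp hl (ε / 2) (by positivity))
  have hlim : Tendsto (fun t : ℝ => |f T - l * T| / t) atTop (𝓝 0) :=
    tendsto_const_nhds.div_atTop tendsto_id
  filter_upwards [eventually_gt_atTop 0, eventually_ge_atTop T, eventually_gt_atTop (-T),
    hlim.eventually (gt_mem_nhds (show 0 < ε / 4 by positivity)),
    (tendsto_const_nhds.div_atTop tendsto_id : Tendsto (fun t : ℝ => |T| / t) atTop
      (𝓝 0)).eventually (gt_mem_nhds (show (0 : ℝ) < 1 / 4 by norm_num))] with t ht htT htT' h1 h2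
  have h3 : ‖(f t - l * t) - (f T - l * T)‖ ≤ ε / 2 * ‖t - T‖ := by
    refine (convex_Ici T).norm_image_sub_le_of_norm_hasDerivWithin_le
      (f := fun s => f s - l * s) (f' := fun s => f' s - l) (fun s _ => ?_) (fun s hs => ?_)
      (Set.mem_Ici.mpr le_rfl) (Set.mem_Ici.mpr htT)
    · have := (hf s).sub ((hasDerivAt_id s).const_mul l)
      rw [mul_one] at this
      exact this.hasDerivWithinAt
    · exact (hT s hs).le
  rw [Real.norm_eq_abs, Real.norm_eq_abs, abs_of_nonneg (by linarith : 0 ≤ t - T)] at h3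
  rw [div_lt_iff₀ ht] at h1 h2
  rw [Real.dist_eq, show f t / t - l = (f t - l * t) / t by field_simp, abs_div, abs_of_pos ht,
    div_lt_iff₀ ht]
  have h4 : |f t - l * t| ≤ |(f t - l * t) - (f T - l * T)| + |f T - l * T| := by
    have := abs_add_le ((f t - l * t) - (f T - l * T)) (f T - l * T)
    rwa [sub_add_cancel] at this
  have h5 : -T ≤ |T| := neg_le_abs T
  nlinarith

/-! ### The long-time dichotomy -/

namespace IsOrbit

variable {ν α β M : ℝ} {γ : ℝ → ℂ × ℂ × ℂ}

lemma lyap_nonneg {z : ℂ × ℂ × ℂ} (hM : 0 < M) (hz : z ∈ levelSet M) : 0 ≤ lyap M z := by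
  have := eta_pos hz.1
  rw [lyap]; positivity

lemma bounded_forward (h : IsOrbit ν α β M γ) (hν : 0 < ν) (hM : 0 < M) {t : ℝ} (ht : 0 ≤ t) :
    ‖γ t‖ ≤ lyap M (γ 0) + 1 + √M := by
  refine norm_le_of_mem (h.mem t) ?_
  have h1 := h.antitone_lyap hν ht
  have h2 := eta_pos (h.mem t).1
  simp only [lyap] at h1 ⊢
  nlinarith

/-- A smooth function is Lipschitz along an orbit. -/
lemma lipschitz_comp (h : IsOrbit ν α β M γ) (hν : 0 < ν) (hM : 0 < M) {E : Type*}
    [NormedAddCommGroup E] [NormedSpace ℝ E] {g : ℂ × ℂ × ℂ → E} (hg : ContDiff ℝ 1 g) :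
    ∃ C : ℝ, ∀ s t, 0 ≤ s → 0 ≤ t → ‖g (γ s) - g (γ t)‖ ≤ C * |s - t| := by
  set R := lyap M (γ 0) + 1 + √M
  obtain ⟨K, hK⟩ := hg.contDiffOn.exists_lipschitzOnWith one_ne_zero
    (convex_closedBall (0 : ℂ × ℂ × ℂ) R) (isCompact_closedBall 0 R)
  obtain ⟨B, hB⟩ := (isCompact_closedBall (0 : ℂ × ℂ × ℂ) R).exists_bound_of_continuousOn
    (contDiff_vf ν α β M).continuous.continuousOn
  have hmem : ∀ t, 0 ≤ t → γ t ∈ Metric.closedBall (0 : ℂ × ℂ × ℂ) R := fun t ht =>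
    mem_closedBall_zero_iff.mpr (h.bounded_forward hν hM ht)
  refine ⟨K * B, fun s t hs ht => ?_⟩
  have h1 := hK.dist_le_mul _ (hmem s hs) _ (hmem t ht)
  have h2 : ‖γ s - γ t‖ ≤ B * ‖s - t‖ :=
    (convex_Ici (0 : ℝ)).norm_image_sub_le_of_norm_hasDerivWithin_le
      (fun τ _ => (h.deriv τ).hasDerivWithinAt) (fun τ hτ => hB _ (hmem τ hτ))
      (Set.mem_Ici.mpr ht) (Set.mem_Ici.mpr hs)
  rw [dist_eq_norm, dist_eq_norm] at h1
  refine h1.trans ?_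
  rw [mul_assoc]
  exact mul_le_mul_of_nonneg_left h2 K.2

lemma exists_lyap_limit (h : IsOrbit ν α β M γ) (hν : 0 < ν) (hM : 0 < M) :
    ∃ l, Tendsto (fun t => lyap M (γ t)) atTop (𝓝 l) := by
  refine ⟨_, tendsto_atTop_ciInf (h.antitone_lyap hν) ⟨0, ?_⟩⟩
  rintro _ ⟨t, rfl⟩
  exact lyap_nonneg hM (h.mem t)

/-- The derivative `-2 ν |b|²` of the Lyapunov function tends to zero, by Barbalat's lemma. -/
lemma tendsto_b (h : IsOrbit ν α β M γ) (hν : 0 < ν) (hM : 0 < M) :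
    Tendsto (fun t => (γ t).1) atTop (𝓝 0) := by
  obtain ⟨l, hl⟩ := h.exists_lyap_limit hν hM
  obtain ⟨C, hC⟩ := h.lipschitz_comp hν hM (g := fun z => -(2 * ν) * ‖z.1‖ ^ 2)
    (contDiff_const.mul (contDiff_fst.norm_sq ℝ))
  have h1 := tendsto_zero_of_primitive_tendsto h.hasDerivAt_lyap hC hl
  have h2 : Tendsto (fun t => ‖(γ t).1‖ ^ 2) atTop (𝓝 0) := by
    have := h1.const_mul (-(2 * ν))⁻¹
    rw [mul_zero] at this
    refine this.congr fun t => ?_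
    field_simp
  have h3 := h2.sqrt
  simp only [Real.sqrt_sq (norm_nonneg _), Real.sqrt_zero] at h3
  exact tendsto_zero_iff_norm_tendsto_zero.mpr h3

/-- Since `b → 0`, Barbalat's lemma gives `b' → 0`, and `-i M c p̄` is the only term of `b'` which
does not contain `b`. -/
lemma tendsto_c_mul_p (h : IsOrbit ν α β M γ) (hν : 0 < ν) (hM : 0 < M) :
    Tendsto (fun t => ‖(γ t).2.1‖ * ‖(γ t).2.2‖) atTop (𝓝 0) := by
  have hb := h.tendsto_b hν hM
  obtain ⟨C, hC⟩ := h.lipschitz_comp hν hM (g := fun z => (vf ν α β M z).1)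
    (((contDiff_vf ν α β M).of_le (by simp)).fst)
  have h1 := (tendsto_zero_of_primitive_tendsto (fun t => (hasDerivAt_coords (h.deriv t)).1) hC
    hb).norm
  rw [norm_zero] at h1
  have hbn := hb.norm
  rw [norm_zero] at hbn
  have hup : Tendsto (fun t => (‖(vf ν α β M (γ t)).1‖ +
      (‖(γ t).1‖ * (ν + |α| + 2 * M) + ‖(γ t).1‖ ^ 3)) / M) atTop (𝓝 0) := by
    have := (h1.add ((hbn.mul_const (ν + |α| + 2 * M)).add (hbn.pow 3))).div_const M
    simpa using this
  refine squeeze_zero (fun t => by positivity) (fun t => ?_) hup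
  rw [le_div_iff₀ hM]
  set z := γ t with hz
  have hmem : z ∈ levelSet M := h.mem t
  have e : Complex.I * (z.2.1 * M * (starRingEnd ℂ) z.2.2) = -(vf ν α β M z).1 -
      z.1 * (ν + Complex.I * α + Complex.I * (2 * M * (eta z : ℝ)))
      - Complex.I * (z.1 * (starRingEnd ℂ) z.1 * z.1) := by
    have hη : ((eta z : ℝ) : ℂ) = 1 - z.2.2 * (starRingEnd ℂ) z.2.2 := by
      rw [Complex.mul_conj, Complex.normSq_eq_norm_sq, eta]; push_cast; ring
    rw [hη, vf]; ring
  have e2 : ‖Complex.I * (z.2.1 * M * (starRingEnd ℂ) z.2.2)‖ = ‖z.2.1‖ * ‖z.2.2‖ * M := by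
    rw [norm_mul, norm_mul, norm_mul, Complex.norm_I, RCLike.norm_conj, Complex.norm_real,
      Real.norm_of_nonneg hM.le]; ring
  rw [← e2, e]
  have n1 : ‖(ν : ℂ) + Complex.I * α + Complex.I * (2 * M * (eta z : ℝ))‖ ≤ ν + |α| + 2 * M := by
    refine (norm_add₃_le).trans ?_
    have h0 := eta_pos hmem.1
    rw [norm_mul, norm_mul, Complex.norm_I, Complex.norm_real, Complex.norm_real, norm_mul,
      norm_mul, Complex.norm_real, Complex.norm_real, Real.norm_of_nonneg hν.le,
      Real.norm_of_nonneg hM.le, Real.norm_of_nonneg h0.le, Real.norm_eq_abs, Complex.norm_ofNat]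
    have := eta_le_one z
    nlinarith
  have n2 : ‖Complex.I * (z.1 * (starRingEnd ℂ) z.1 * z.1)‖ = ‖z.1‖ ^ 3 := by
    rw [norm_mul, norm_mul, norm_mul, Complex.norm_I, RCLike.norm_conj]; ring
  refine (norm_sub_le _ _).trans ?_
  rw [n2]
  have n3 := norm_sub_le (-(vf ν α β M z).1)
    (z.1 * (ν + Complex.I * α + Complex.I * (2 * M * (eta z : ℝ))))
  rw [norm_neg, norm_mul] at n3
  have n4 := mul_le_mul_of_nonneg_left n1 (norm_nonneg z.1)
  linarith

/-- Every orbit either blows up or converges to the circle `𝓒_M`: `η = 1 - |p|²` has a limit, at which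
`|c p|² = M η² (1 - η)` vanishes. -/
lemma eta_dichotomy (h : IsOrbit ν α β M γ) (hν : 0 < ν) (hM : 0 < M) :
    Tendsto (fun t => eta (γ t)) atTop (𝓝 0) ∨ Tendsto (fun t => eta (γ t)) atTop (𝓝 1) := by
  obtain ⟨l, hl⟩ := h.exists_lyap_limit hν hM
  have hb := (h.tendsto_b hν hM).norm.pow 2
  rw [norm_zero, zero_pow two_ne_zero] at hb
  have h1 : Tendsto (fun t => eta (γ t)) atTop (𝓝 (l / M)) := by
    have := (hl.sub hb).div_const M
    rw [sub_zero] at this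
    refine this.congr fun t => ?_
    rw [lyap]; field_simp; ring
  have h2 : Tendsto (fun t => M * (eta (γ t) ^ 2 * (1 - eta (γ t)))) atTop (𝓝 0) := by
    have := (h.tendsto_c_mul_p hν hM).pow 2
    rw [zero_pow two_ne_zero] at this
    refine this.congr fun t => ?_
    have h3 : ‖(γ t).2.1‖ ^ 2 = M * eta (γ t) ^ 2 := (h.mem t).2
    rw [mul_pow, h3, eta]; ring
  have h3 := tendsto_nhds_unique h2 (((h1.pow 2).mul (h1.const_sub 1)).const_mul M)
  have h4 : l / M = 0 ∨ l / M = 1 := by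
    rcases mul_eq_zero.mp h3.symm with h5 | h5
    · linarith
    · rcases mul_eq_zero.mp h5 with h6 | h6
      · left; exact pow_eq_zero_iff two_ne_zero |>.mp h6
      · right; linarith
  rcases h4 with h4 | h4
  · left; rwa [h4] at h1
  · right; rwa [h4] at h1

lemma tendsto_lyap (h : IsOrbit ν α β M γ) (hν : 0 < ν) (hM : 0 < M) {e : ℝ}
    (he : Tendsto (fun t => eta (γ t)) atTop (𝓝 e)) :
    Tendsto (fun t => lyap M (γ t)) atTop (𝓝 (M * e)) := by
  have hb := (h.tendsto_b hν hM).norm.pow 2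
  rw [norm_zero, zero_pow two_ne_zero] at hb
  simpa [lyap] using hb.add (he.const_mul M)

/-! ### The rate of blow-up -/

lemma hasDerivAt_crossTerm (h : IsOrbit ν α β M γ) (t : ℝ) :
    HasDerivAt (fun t => crossTerm (γ t))
      (-(ν + Complex.I * α - Complex.I * (1 - β) * M - Complex.I * (‖(γ t).1‖ ^ 2 : ℝ)
        + Complex.I * (3 - β) * M * (eta (γ t) : ℝ)) * crossTerm (γ t)
      + 2 * Complex.I * (‖(γ t).1‖ ^ 2 : ℝ) * M * (eta (γ t) : ℝ) * (1 - (eta (γ t) : ℝ))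
      - Complex.I * M ^ 2 * (eta (γ t) : ℝ) ^ 2 * (1 - (eta (γ t) : ℝ))
      - Complex.I * (‖(γ t).1‖ ^ 2 : ℝ) * M * (eta (γ t) : ℝ) ^ 2) t := by
  obtain ⟨h1, h2, h3⟩ := hasDerivAt_coords (h.deriv t)
  have h2' : HasDerivAt (fun t => (starRingEnd ℂ) (γ t).2.1)
      ((starRingEnd ℂ) (vf ν α β M (γ t)).2.1) t :=
    (Complex.conjCLE.toContinuousLinearMap.hasFDerivAt.comp_hasDerivAt t h2)
  refine ((h1.mul h2').mul h3).congr_deriv ?_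
  simp only [Pi.mul_apply]
  have hcc := levelSet_mul_conj (h.mem t)
  generalize γ t = z at *
  have hη : ((eta z : ℝ) : ℂ) = 1 - z.2.2 * (starRingEnd ℂ) z.2.2 := by
    rw [Complex.mul_conj, Complex.normSq_eq_norm_sq, eta]; push_cast; ring
  have hb : ((‖z.1‖ ^ 2 : ℝ) : ℂ) = z.1 * (starRingEnd ℂ) z.1 := by
    rw [Complex.mul_conj, Complex.normSq_eq_norm_sq]
  rw [hη, hb, crossTerm]
  simp only [vf, map_mul, map_add, map_sub, map_neg, Complex.conj_I, Complex.conj_ofReal, map_one,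
    map_ofNat, Complex.conj_conj]
  linear_combination (-Complex.I * M * z.2.2 * (starRingEnd ℂ) z.2.2
    - Complex.I * z.1 * (starRingEnd ℂ) z.1) * hcc

/-- The limit of `b c̄ p / (1 - |p|²)²` along a blowing-up orbit: this quotient solves a scalar linear
equation whose coefficients converge, with a damping of limit `ν > 0`. -/
lemma tendsto_crossTerm_div (h : IsOrbit ν α β M γ) (hν : 0 < ν) (hM : 0 < M)
    (he : Tendsto (fun t => eta (γ t)) atTop (𝓝 0)) :
    Tendsto (fun t => crossTerm (γ t) / ((eta (γ t) : ℝ) : ℂ) ^ 2) atTop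
      (𝓝 (-(Complex.I * M ^ 2) / (ν + Complex.I * α - Complex.I * (1 - β) * M))) := by
  have hb := (h.tendsto_b hν hM).norm
  rw [norm_zero] at hb
  have hb2 := hb.pow 2
  rw [zero_pow two_ne_zero] at hb2
  have heC : Tendsto (fun t => ((eta (γ t) : ℝ) : ℂ)) atTop (𝓝 0) := by
    have := (Complex.continuous_ofReal.tendsto 0).comp he
    rwa [Complex.ofReal_zero] at this
  have hbC : Tendsto (fun t => ((‖(γ t).1‖ ^ 2 : ℝ) : ℂ)) atTop (𝓝 0) := by
    have := (Complex.continuous_ofReal.tendsto 0).comp hb2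
    rwa [Complex.ofReal_zero] at this
  have hXe : Tendsto (fun t => crossTerm (γ t) / ((eta (γ t) : ℝ) : ℂ)) atTop (𝓝 0) := by
    have hup : Tendsto (fun t => √M * ‖(γ t).1‖) atTop (𝓝 0) := by simpa using hb.const_mul √M
    refine squeeze_zero_norm (fun t => ?_) hup
    have hη := eta_pos (h.mem t).1
    rw [norm_div, Complex.norm_real, Real.norm_of_nonneg hη.le, div_le_iff₀ hη]
    exact norm_crossTerm_le (h.mem t)
  set κ : ℂ := ν + Complex.I * α - Complex.I * (1 - β) * M with hκ
  refine tendsto_of_linear_ode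
    (a := fun t => κ - Complex.I * (‖(γ t).1‖ ^ 2 : ℝ) + Complex.I * (3 - β) * M * (eta (γ t) : ℝ)
      - 2 * Complex.I * (crossTerm (γ t) / ((eta (γ t) : ℝ) : ℂ)))
    (f := fun t => -(Complex.I * M ^ 2 * (1 - (eta (γ t) : ℝ)))
      - Complex.I * (‖(γ t).1‖ ^ 2 : ℝ) * M) (a₀ := κ) (by simp [hκ, hν]) (fun t => ?_) ?_ ?_
  · have hη := eta_pos (h.mem t).1
    have hη0 : ((eta (γ t) : ℝ) : ℂ) ≠ 0 := by exact_mod_cast hη.ne'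
    refine ((h.hasDerivAt_crossTerm t).div (((h.hasDerivAt_eta t).ofReal_comp).pow 2)
      (pow_ne_zero 2 hη0)).congr_deriv ?_
    have him : ((2 * (crossTerm (γ t)).im : ℝ) : ℂ) =
        -Complex.I * (crossTerm (γ t) - (starRingEnd ℂ) (crossTerm (γ t))) := by
      rw [Complex.sub_conj]
      push_cast
      linear_combination (2 * ((crossTerm (γ t)).im : ℂ)) * Complex.I_mul_I
    have hXX : crossTerm (γ t) * (starRingEnd ℂ) (crossTerm (γ t)) =
        (‖(γ t).1‖ ^ 2 : ℝ) * M * (eta (γ t) : ℝ) ^ 2 * (1 - (eta (γ t) : ℝ)) := by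
      rw [Complex.mul_conj, Complex.normSq_eq_norm_sq, crossTerm, norm_mul, norm_mul,
        RCLike.norm_conj, mul_pow, mul_pow, (h.mem t).2, eta]
      push_cast; ring
    simp only [Pi.pow_apply]
    rw [him]
    generalize (starRingEnd ℂ) (crossTerm (γ t)) = X' at *
    generalize crossTerm (γ t) = X at *
    generalize ((eta (γ t) : ℝ) : ℂ) = η at *
    generalize ((‖(γ t).1‖ ^ 2 : ℝ) : ℂ) = B at *
    rw [hκ]
    field_simp
    linear_combination (-2 * Complex.I * η) * hXX
  · have := ((hbC.const_mul Complex.I).const_sub κ).add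
      (heC.const_mul (Complex.I * (3 - β) * M)) |>.sub (hXe.const_mul (2 * Complex.I))
    simpa using this
  · have := (((heC.const_sub 1).const_mul (Complex.I * M ^ 2)).neg).sub
      ((hbC.const_mul Complex.I).mul_const (M : ℂ))
    simpa using this

/-- Along a blowing-up orbit, `1 - |p|²` decays like `1 / t`, because the derivative of its inverse
converges. -/
lemma tendsto_inv_eta_div (h : IsOrbit ν α β M γ) (hν : 0 < ν) (hM : 0 < M)
    (he : Tendsto (fun t => eta (γ t)) atTop (𝓝 0)) :
    Tendsto (fun t => (eta (γ t))⁻¹ / t) atTop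
      (𝓝 (2 * ν * M ^ 2 / (ν ^ 2 + ((1 - β) * M - α) ^ 2))) := by
  have hd : ∀ t, HasDerivAt (fun t => (eta (γ t))⁻¹)
      (-2 * (crossTerm (γ t) / ((eta (γ t) : ℝ) : ℂ) ^ 2).im) t := fun t => by
    have hη := eta_pos (h.mem t).1
    refine ((h.hasDerivAt_eta t).inv hη.ne').congr_deriv ?_
    rw [← Complex.ofReal_pow, Complex.div_ofReal_im]
    ring
  refine tendsto_div_of_tendsto_deriv hd ?_
  have := ((Complex.continuous_im.tendsto _).comp (h.tendsto_crossTerm_div hν hM he)).const_mul (-2)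
  convert! this using 2
  rw [Complex.div_im]
  simp [Complex.normSq_apply, ← Complex.ofReal_pow]
  ring

end IsOrbit

end
end DampedSzego
namespace DampedSzego
noncomputable section

/-! ### Abelian asymptotics of the weighted geometric series -/

/-- The binomial series of `(1 - r)^{-(a + 1)}`. -/
lemma hasSum_multichoose (a : ℝ) {r : ℝ} (hr0 : 0 ≤ r) (hr : r < 1) :
    HasSum (fun k : ℕ => Ring.multichoose (a + 1) k * r ^ k) ((1 - r) ^ (-(a + 1))) := by
  have h := (Real.one_div_one_sub_rpow_hasFPowerSeriesOnBall_zero (a + 1)).hasSum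
    (y := r) (by
      rw [Metric.mem_eball, edist_zero_right, ← ofReal_norm, Real.norm_of_nonneg hr0]
      simpa using hr)
  rw [zero_add, one_div, ← Real.rpow_neg (by linarith)] at h
  refine h.congr_fun ?_ |> id
  intro k
  simp [FormalMultilinearSeries.ofScalars, Ring.multichoose_eq, mul_comm]

lemma multichoose_eq_prod (a : ℝ) (k : ℕ) :
    (k.factorial : ℝ) * Ring.multichoose (a + 1) k = ∏ j ∈ Finset.range k, (a + (j + 1 : ℕ)) := by
  rw [← nsmul_eq_mul, Ring.factorial_nsmul_multichoose_eq_ascPochhammer,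
    Polynomial.ascPochhammer_smeval_eq_eval]
  induction k with
  | zero => simp
  | succ k ih =>
    rw [Finset.prod_range_succ, ← ih, ascPochhammer_succ_eval]
    push_cast; ring

lemma tendsto_multichoose_div {a : ℝ} (ha : 0 < a) :
    Tendsto (fun k : ℕ => (k : ℝ) ^ a / Ring.multichoose (a + 1) k) atTop
      (𝓝 (Real.Gamma (a + 1))) := by
  rw [Real.Gamma_add_one ha.ne']
  refine ((Real.GammaSeq_tendsto_Gamma a).const_mul a).congr fun k => ?_
  rw [Real.GammaSeq, Finset.prod_range_succ', ← multichoose_eq_prod]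
  have : (k.factorial : ℝ) ≠ 0 := by positivity
  push_cast
  field_simp
  simp
  ring

/-- If the coefficients of two power series are asymptotically proportional, and the second one
sums to `(1 - r)^{-m}`, then the first one is asymptotically proportional to it as `r → 1`. -/
lemma tendsto_abel {a b : ℕ → ℝ} {m l : ℝ} (hm : 0 < m) (hb : ∀ k, 0 < b k)
    (hB : ∀ r : ℝ, 0 ≤ r → r < 1 → HasSum (fun k => b k * r ^ k) ((1 - r) ^ (-m)))
    (hab : Tendsto (fun k => a k / b k) atTop (𝓝 l)) :
    Tendsto (fun r : ℝ => (∑' k, a k * r ^ k) * (1 - r) ^ m) (𝓝[Set.Ico 0 1] 1) (𝓝 l) := by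
  rw [Metric.tendsto_nhds]
  intro ε hε
  obtain ⟨N, hN⟩ := (Metric.tendsto_atTop.mp hab) (ε / 2) (by positivity)
  set A : ℝ := ∑ k ∈ Finset.range N, |a k - l * b k| with hA
  have hlim : Tendsto (fun r : ℝ => A * (1 - r) ^ m) (𝓝[Set.Ico 0 1] 1) (𝓝 0) := by
    have h1 : ContinuousAt (fun r : ℝ => A * (1 - r) ^ m) 1 :=
      continuousAt_const.mul ((continuousAt_const.sub continuousAt_id).rpow_const (Or.inr hm.le))
    have h2 := h1.tendsto
    simp only [sub_self, Real.zero_rpow hm.ne', mul_zero] at h2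
    exact h2.mono_left nhdsWithin_le_nhds
  filter_upwards [hlim.eventually_lt_const (show (0 : ℝ) < ε / 2 by positivity),
    self_mem_nhdsWithin] with r hr ⟨hr0, hr1⟩
  have hpos : 0 < (1 - r) ^ m := Real.rpow_pos_of_pos (by linarith) m
  have hBr := hB r hr0 hr1
  have hbound : ∀ k, ‖(a k - l * b k) * r ^ k‖ ≤
      (if k ∈ Finset.range N then |a k - l * b k| else 0) + ε / 2 * (b k * r ^ k) := by
    intro k
    have hk0 : 0 ≤ r ^ k := pow_nonneg hr0 k
    have hk1 : r ^ k ≤ 1 := pow_le_one₀ hr0 hr1.le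
    rw [norm_mul, Real.norm_eq_abs, Real.norm_of_nonneg hk0]
    split_ifs with hk
    · have := mul_le_mul_of_nonneg_left hk1 (abs_nonneg (a k - l * b k))
      have := mul_nonneg (hb k).le hk0
      nlinarith
    · have hk' := hN k (by simpa using hk)
      rw [Real.dist_eq] at hk'
      have e : a k - l * b k = (a k / b k - l) * b k := by
        have := (hb k).ne'
        field_simp
      rw [e, abs_mul, abs_of_pos (hb k), zero_add, ← mul_assoc]
      have := (hb k).le
      gcongr
  have hfin : HasSum (fun k => if k ∈ Finset.range N then |a k - l * b k| else 0) A := by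
    have : HasSum (fun k => if k ∈ Finset.range N then |a k - l * b k| else 0)
        (∑ k ∈ Finset.range N, if k ∈ Finset.range N then |a k - l * b k| else 0) :=
      hasSum_sum_of_ne_finset_zero fun k hk => if_neg hk
    rwa [Finset.sum_congr rfl fun k hk => if_pos hk] at this
  have hsum := hfin.add (hBr.mul_left (ε / 2))
  have hS : Summable fun k => (a k - l * b k) * r ^ k :=
    Summable.of_norm_bounded hsum.summable hbound
  have hle := tsum_of_norm_bounded hsum hbound
  have hsplit : ∑' k, a k * r ^ k = (∑' k, (a k - l * b k) * r ^ k) + l * (1 - r) ^ (-m) := by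
    rw [← (hS.hasSum.add (hBr.mul_left l)).tsum_eq]
    exact tsum_congr fun k => by ring
  have hinv : (1 - r) ^ (-m) * (1 - r) ^ m = 1 := by
    rw [← Real.rpow_add (by linarith), neg_add_cancel, Real.rpow_zero]
  rw [hsplit, Real.dist_eq, add_mul, mul_assoc, hinv, mul_one, add_sub_cancel_right, abs_mul,
    abs_of_pos hpos]
  rw [Real.norm_eq_abs] at hle
  calc _ ≤ (A + ε / 2 * (1 - r) ^ (-m)) * (1 - r) ^ m := by gcongr
    _ = A * (1 - r) ^ m + ε / 2 := by rw [add_mul, mul_assoc, hinv, mul_one]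
    _ < ε := by linarith

lemma tendsto_weightSum {s : ℝ} (hs : 0 < s) (j : ℕ) :
    Tendsto (fun r : ℝ => weightSum s j r * (1 - r) ^ (2 * s + 1)) (𝓝[Set.Ico 0 1] 1)
      (𝓝 (Real.Gamma (2 * s + 1))) := by
  have hpos : ∀ k, 0 < Ring.multichoose (2 * s + 1) k := fun k => by
    have h1 := multichoose_eq_prod (2 * s) k
    have h2 : 0 < ∏ j ∈ Finset.range k, (2 * s + (j + 1 : ℕ)) :=
      Finset.prod_pos fun j _ => by positivity
    rw [← h1] at h2
    exact pos_of_mul_pos_right h2 (by positivity)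
  refine tendsto_abel (by linarith) hpos (fun r h0 h1 => hasSum_multichoose (2 * s) h0 h1) ?_
  have h1 : Tendsto (fun k : ℕ => ((1 + ((k : ℝ) + j) ^ 2) / (k : ℝ) ^ 2) ^ s) atTop (𝓝 1) := by
    have hk : Tendsto (fun k : ℕ => (k : ℝ)⁻¹) atTop (𝓝 0) := tendsto_inv_atTop_nhds_zero_nat
    have h2 : Tendsto (fun k : ℕ => ((k : ℝ)⁻¹) ^ 2 + (1 + j * (k : ℝ)⁻¹) ^ 2) atTop (𝓝 1) := by
      simpa using (hk.pow 2).add (((hk.const_mul (j : ℝ)).const_add 1).pow 2)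
    have h3 := h2.rpow_const (p := s) (Or.inl one_ne_zero)
    rw [Real.one_rpow] at h3
    refine h3.congr' ?_
    filter_upwards [eventually_gt_atTop 0] with k hk0
    have : (k : ℝ) ≠ 0 := by positivity
    congr 1
    field_simp
  have h2 := h1.mul (tendsto_multichoose_div (show 0 < 2 * s by linarith))
  rw [one_mul] at h2
  refine h2.congr' ?_
  filter_upwards [eventually_gt_atTop 0] with k hk0
  have hk : (0 : ℝ) < k := by positivity
  rw [Real.div_rpow (by positivity) (by positivity), Real.rpow_mul hk.le, Real.rpow_two]
  have : ((k : ℝ) ^ 2) ^ s ≠ 0 := by positivity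
  have := (hpos k).ne'
  field_simp

namespace IsOrbit
variable {ν α β M : ℝ} {γ : ℝ → ℂ × ℂ × ℂ}

/-- The growth of the Sobolev norms along a blowing-up orbit. -/
lemma hsNorm_sq_isEquivalent (h : IsOrbit ν α β M γ) (hν : 0 < ν) (hM : 0 < M)
    (he : Tendsto (fun t => eta (γ t)) atTop (𝓝 0)) {s : ℝ} (hs : 1 / 2 < s) :
    (fun t : ℝ => hsNorm s (rankOne (γ t)) ^ 2) ~[atTop]
      fun t : ℝ => (Real.Gamma (2 * s + 1) * M ^ (4 * s - 1) *
        ((ν ^ 2 + ((1 - β) * M - α) ^ 2) / (2 * ν)) ^ (1 - 2 * s)) * t ^ (2 * s - 1) := by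
  set D : ℝ := (ν ^ 2 + ((1 - β) * M - α) ^ 2) / (2 * ν) with hDdef
  have hDpos : 0 < D := by positivity
  have hG : 0 < Real.Gamma (2 * s + 1) := Real.Gamma_pos_of_pos (by linarith)
  have hdiv := h.tendsto_inv_eta_div hν hM he
  have hlim : 2 * ν * M ^ 2 / (ν ^ 2 + ((1 - β) * M - α) ^ 2) = M ^ 2 / D := by
    rw [hDdef]; field_simp
  rw [hlim] at hdiv
  refine (isEquivalent_iff_tendsto_one ?_).mpr ?_
  · filter_upwards [eventually_gt_atTop 0] with t ht
    positivity
  have h1 : Tendsto (fun t => ((eta (γ t))⁻¹ / t) ^ (2 * s - 1)) atTop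
      (𝓝 ((M ^ 2 / D) ^ (2 * s - 1))) := hdiv.rpow_const (Or.inl (by positivity))
  have hr : Tendsto (fun t => ‖(γ t).2.2‖ ^ 2) atTop (𝓝[Set.Ico 0 1] 1) := by
    refine tendsto_nhdsWithin_iff.mpr ⟨?_, Eventually.of_forall fun t => ?_⟩
    · have := he.const_sub 1
      simpa [eta] using this
    · have := eta_pos (h.mem t).1
      exact ⟨sq_nonneg _, by rw [eta] at this; linarith⟩
  have h2 := (tendsto_weightSum (show 0 < s by linarith) 1).comp hr
  have hb := (h.tendsto_b hν hM).norm.pow 2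
  simp only [norm_zero, ne_eq, OfNat.ofNat_ne_zero, not_false_eq_true, zero_pow] at hb
  have ht0 : Tendsto (fun t : ℝ => t ^ (1 - 2 * s)) atTop (𝓝 0) := by
    have := tendsto_rpow_neg_atTop (show 0 < 2 * s - 1 by linarith)
    simpa using this
  have h3 := (((hb.mul ht0).add (((h2.mul h1).const_mul M))).div_const
    (Real.Gamma (2 * s + 1) * M ^ (4 * s - 1) * D ^ (1 - 2 * s)))
  have hval : (0 * 0 + M * (Real.Gamma (2 * s + 1) * (M ^ 2 / D) ^ (2 * s - 1))) /
      (Real.Gamma (2 * s + 1) * M ^ (4 * s - 1) * D ^ (1 - 2 * s)) = 1 := by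
    rw [Real.div_rpow (by positivity) hDpos.le, ← Real.rpow_natCast M 2, ← Real.rpow_mul hM.le,
      show 4 * s - 1 = 1 + ((2 : ℕ) : ℝ) * (2 * s - 1) by push_cast; ring, Real.rpow_add hM,
      Real.rpow_one, show 1 - 2 * s = -(2 * s - 1) by ring, Real.rpow_neg hDpos.le]
    have : 0 < M ^ (((2 : ℕ) : ℝ) * (2 * s - 1)) := by positivity
    have : 0 < D ^ (2 * s - 1) := by positivity
    field_simp
    ring
  rw [hval] at h3
  refine h3.congr' ?_
  filter_upwards [eventually_gt_atTop 0] with t ht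
  have hη := eta_pos (h.mem t).1
  have hη1 : 1 - ‖(γ t).2.2‖ ^ 2 = eta (γ t) := rfl
  simp only [Pi.div_apply, Function.comp_apply, hη1]
  rw [hsNorm_sq_rankOne (by linarith) (h.mem t).1, (h.mem t).2, hη1,
    Real.div_rpow (by positivity) ht.le, Real.inv_rpow hη.le,
    show 2 * s + 1 = 2 + (2 * s - 1) by ring, Real.rpow_add hη, Real.rpow_two,
    show t ^ (1 - 2 * s) = (t ^ (2 * s - 1))⁻¹ by rw [← Real.rpow_neg ht.le]; congr 1; ring]
  have : 0 < eta (γ t) ^ (2 * s - 1) := by positivity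
  have : 0 < t ^ (2 * s - 1) := by positivity
  have : 0 < M ^ (4 * s - 1) := by positivity
  have : 0 < D ^ (1 - 2 * s) := by positivity
  rw [show 2 + (2 * s - 1) = 2 * s + 1 by ring]
  field_simp

end IsOrbit

end
end DampedSzego
namespace DampedSzego
noncomputable section

/-! ### Perturbed hyperbolic linear systems -/

lemma le_mul_exp_of_deriv_le {f f' : ℝ → ℝ} {k a b : ℝ} (hab : a ≤ b)
    (hf : ∀ t, HasDerivAt f (f' t) t) (h : ∀ t ∈ Set.Icc a b, f' t ≤ k * f t) :
    f b ≤ f a * exp (k * (b - a)) := by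
  have hd : ∀ t, HasDerivAt (fun t => f t * exp (-(k * t)))
      ((f' t - k * f t) * exp (-(k * t))) t := fun t => by
    have h1 : HasDerivAt (fun t : ℝ => exp (-(k * t))) (exp (-(k * t)) * (-(k * 1))) t :=
      (((hasDerivAt_id t).const_mul k).neg).exp
    exact ((hf t).mul h1).congr_deriv (by ring)
  have hanti : AntitoneOn (fun t => f t * exp (-(k * t))) (Set.Icc a b) := by
    refine antitoneOn_of_deriv_nonpos (convex_Icc a b)
      (fun t _ => (hd t).continuousAt.continuousWithinAt)
      (fun t _ => (hd t).differentiableAt.differentiableWithinAt) fun t ht => ?_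
    rw [(hd t).deriv]
    have := h t (interior_subset ht)
    exact mul_nonpos_of_nonpos_of_nonneg (by linarith) (exp_pos _).le
  have h1 := hanti (Set.left_mem_Icc.mpr hab) (Set.right_mem_Icc.mpr hab) hab
  have h2 := mul_le_mul_of_nonneg_right h1 (exp_pos (k * b)).le
  simp only at h2
  rw [mul_assoc, ← exp_add, neg_add_cancel, exp_zero, mul_one, mul_assoc, ← exp_add] at h2
  rwa [show k * (b - a) = -(k * a) + k * b by ring]

lemma mul_exp_le_of_le_deriv {f f' : ℝ → ℝ} {k a b : ℝ} (hab : a ≤ b)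
    (hf : ∀ t, HasDerivAt f (f' t) t) (h : ∀ t ∈ Set.Icc a b, k * f t ≤ f' t) :
    f a * exp (k * (b - a)) ≤ f b := by
  have := le_mul_exp_of_deriv_le (k := k) hab (fun t => (hf t).neg) fun t ht => by
    have := h t ht
    simp only [Pi.neg_apply]
    linarith
  simp only [Pi.neg_apply] at this
  linarith

/-- A function whose derivative decays exponentially converges. -/
lemma exists_tendsto_of_abs_deriv_le_exp {f f' : ℝ → ℝ} {C k : ℝ} (hk : 0 < k)
    (hf : ∀ t, 0 ≤ t → HasDerivAt f (f' t) t) (h : ∀ t, 0 ≤ t → |f' t| ≤ C * exp (-(k * t))) :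
    ∃ l, Tendsto f atTop (𝓝 l) := by
  have hC : 0 ≤ C := by
    have := (abs_nonneg _).trans (h 0 le_rfl)
    simpa using this
  have hd : ∀ ε t : ℝ, 0 ≤ t → HasDerivAt (fun t => f t + ε * (C / k * exp (-(k * t))))
      (f' t - ε * (C * exp (-(k * t)))) t := fun ε t ht => by
    have h1 : HasDerivAt (fun t : ℝ => exp (-(k * t))) (exp (-(k * t)) * (-(k * 1))) t :=
      (((hasDerivAt_id t).const_mul k).neg).exp
    refine ((hf t ht).add ((h1.const_mul (C / k)).const_mul ε)).congr_deriv ?_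
    field_simp
    ring
  have hmono : MonotoneOn (fun t => f t + (-1) * (C / k * exp (-(k * t)))) (Set.Ici 0) := by
    refine monotoneOn_of_deriv_nonneg (convex_Ici 0)
      (fun t ht => (hd (-1) t ht).continuousAt.continuousWithinAt)
      (fun t ht => (hd (-1) t (interior_subset ht)).differentiableAt.differentiableWithinAt)
      fun t ht => ?_
    have ht0 : 0 ≤ t := interior_subset ht
    rw [(hd (-1) t ht0).deriv]
    have := neg_le_of_abs_le (h t ht0)
    linarith
  have hanti : AntitoneOn (fun t => f t + 1 * (C / k * exp (-(k * t)))) (Set.Ici 0) := by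
    refine antitoneOn_of_deriv_nonpos (convex_Ici 0)
      (fun t ht => (hd 1 t ht).continuousAt.continuousWithinAt)
      (fun t ht => (hd 1 t (interior_subset ht)).differentiableAt.differentiableWithinAt)
      fun t ht => ?_
    have ht0 : 0 ≤ t := interior_subset ht
    rw [(hd 1 t ht0).deriv]
    have := le_of_abs_le (h t ht0)
    linarith
  have hm2 : Monotone fun t : ℝ => f (max 0 t) + (-1) * (C / k * exp (-(k * max 0 t))) :=
    fun a b hab => hmono (Set.mem_Ici.mpr (le_max_left 0 a)) (Set.mem_Ici.mpr (le_max_left 0 b))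
      (max_le_max le_rfl hab)
  have hbd : BddAbove (Set.range fun t : ℝ =>
      f (max 0 t) + (-1) * (C / k * exp (-(k * max 0 t)))) := by
    refine ⟨f 0 + 1 * (C / k * exp (-(k * 0))), ?_⟩
    rintro _ ⟨t, rfl⟩
    have h1 := hanti (Set.mem_Ici.mpr (le_refl (0 : ℝ))) (Set.mem_Ici.mpr (le_max_left 0 t))
      (le_max_left 0 t)
    have h2 : 0 ≤ C / k * exp (-(k * max 0 t)) := by positivity
    simp only at h1 ⊢
    linarith
  have hlim := tendsto_atTop_ciSup hm2 hbd
  have he : Tendsto (fun t : ℝ => C / k * exp (-(k * t))) atTop (𝓝 0) := by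
    have := (tendsto_exp_neg_atTop_nhds_zero.comp (tendsto_id.const_mul_atTop hk)).const_mul (C / k)
    rwa [mul_zero] at this
  refine ⟨_, (hlim.add he).congr' ?_⟩
  filter_upwards [eventually_ge_atTop 0] with t ht
  rw [max_eq_right ht]
  ring

lemma abs_inner_le (z w : ℂ) : |z.re * w.re + z.im * w.im| ≤ ‖z‖ * ‖w‖ := by
  have h1 : z.re * w.re + z.im * w.im = (w * (starRingEnd ℂ) z).re := by
    simp; ring
  rw [h1]
  refine (Complex.abs_re_le_norm _).trans ?_
  rw [norm_mul, RCLike.norm_conj, mul_comm]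

/-- A curve `(x, y)` in `ℂ²` satisfying the system `x' = l₁ x + n₁`, `y' = l₂ y + n₂` with
`Re l₁ ≤ -m < 0 < m ≤ Re l₂`. -/
structure IsSaddleCurve (m : ℝ) (l₁ l₂ : ℂ) (x y n₁ n₂ : ℝ → ℂ) : Prop where
  pos : 0 < m
  re_le : l₁.re ≤ -m
  le_re : m ≤ l₂.re
  deriv_x : ∀ t, HasDerivAt x (l₁ * x t + n₁ t) t
  deriv_y : ∀ t, HasDerivAt y (l₂ * y t + n₂ t) t

/-- The perturbations are small at time `t`, relatively to the size of the curve and to the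
spectral gap. -/
def IsSmallAt (m : ℝ) (x y n₁ n₂ : ℝ → ℂ) (t : ℝ) : Prop :=
  ‖n₁ t‖ ≤ m / 4 * max ‖x t‖ ‖y t‖ ∧ ‖n₂ t‖ ≤ m / 4 * max ‖x t‖ ‖y t‖

namespace IsSaddleCurve
variable {m : ℝ} {l₁ l₂ : ℂ} {x y n₁ n₂ : ℝ → ℂ}

lemma shift (h : IsSaddleCurve m l₁ l₂ x y n₁ n₂) (a : ℝ) :
    IsSaddleCurve m l₁ l₂ (fun t => x (t + a)) (fun t => y (t + a)) (fun t => n₁ (t + a))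
      (fun t => n₂ (t + a)) :=
  ⟨h.pos, h.re_le, h.le_re, fun t => (h.deriv_x (t + a)).comp_add_const t a,
    fun t => (h.deriv_y (t + a)).comp_add_const t a⟩

lemma hasDerivAt_normSq {f n : ℝ → ℂ} {l : ℂ} {t : ℝ} (h : HasDerivAt f (l * f t + n t) t) :
    HasDerivAt (fun t => ‖f t‖ ^ 2)
      (2 * l.re * ‖f t‖ ^ 2 + 2 * ((f t).re * (n t).re + (f t).im * (n t).im)) t := by
  refine (hasDerivAt_norm_sq h).congr_deriv ?_
  rw [normSq_eq]
  simp
  ring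

/-- The quadratic form which defines the unstable cone grows. -/
lemma hasDerivAt_cone (h : IsSaddleCurve m l₁ l₂ x y n₁ n₂) : ∃ V : ℝ → ℝ,
    (∀ t, HasDerivAt (fun t => ‖y t‖ ^ 2 - ‖x t‖ ^ 2) (V t) t) ∧
    ∀ t, IsSmallAt m x y n₁ n₂ t → m * (‖x t‖ ^ 2 + ‖y t‖ ^ 2) ≤ V t := by
  refine ⟨_, fun t => (hasDerivAt_normSq (h.deriv_y t)).sub (hasDerivAt_normSq (h.deriv_x t)),
    fun t ⟨h1, h2⟩ => ?_⟩
  have hm := h.pos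
  have e1 := le_of_abs_le (abs_inner_le (x t) (n₁ t))
  have e2 := neg_le_of_abs_le (abs_inner_le (y t) (n₂ t))
  have hx := norm_nonneg (x t)
  have hy := norm_nonneg (y t)
  set S := ‖x t‖ ^ 2 + ‖y t‖ ^ 2 with hS
  have hmax : max ‖x t‖ ‖y t‖ ^ 2 ≤ S := by
    rcases max_choice ‖x t‖ ‖y t‖ with e | e <;> rw [e, hS] <;> nlinarith
  have hmx : ‖x t‖ * max ‖x t‖ ‖y t‖ ≤ S := by
    have := le_max_left ‖x t‖ ‖y t‖
    nlinarith
  have hmy : ‖y t‖ * max ‖x t‖ ‖y t‖ ≤ S := by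
    have := le_max_right ‖x t‖ ‖y t‖
    nlinarith
  have a1 : ‖x t‖ * ‖n₁ t‖ ≤ m / 4 * S := by
    have := mul_le_mul_of_nonneg_left h1 hx
    nlinarith
  have a2 : ‖y t‖ * ‖n₂ t‖ ≤ m / 4 * S := by
    have := mul_le_mul_of_nonneg_left h2 hy
    nlinarith
  have b1 := mul_le_mul_of_nonneg_right h.re_le (sq_nonneg ‖x t‖)
  have b2 := mul_le_mul_of_nonneg_right h.le_re (sq_nonneg ‖y t‖)
  nlinarith

/-- A curve which is in the unstable cone `|x| ≤ |y|` remains in it. -/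
lemma cone_le (h : IsSaddleCurve m l₁ l₂ x y n₁ n₂) {a b : ℝ} (hab : a ≤ b)
    (hs : ∀ t ∈ Set.Icc a b, IsSmallAt m x y n₁ n₂ t) :
    ‖y a‖ ^ 2 - ‖x a‖ ^ 2 ≤ ‖y b‖ ^ 2 - ‖x b‖ ^ 2 := by
  obtain ⟨V, hV, hle⟩ := h.hasDerivAt_cone
  have := mul_exp_le_of_le_deriv (k := 0) hab hV fun t ht => by
    have := hle t (hs t ht)
    have hm := h.pos
    have : 0 ≤ m * (‖x t‖ ^ 2 + ‖y t‖ ^ 2) := by positivity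
    linarith
  simpa using this

/-- A bounded curve which starts from the unstable cone vanishes. -/
lemma eq_zero_of_norm_le (h : IsSaddleCurve m l₁ l₂ x y n₁ n₂) {B : ℝ}
    (hs : ∀ t, 0 ≤ t → IsSmallAt m x y n₁ n₂ t) (hB : ∀ t, 0 ≤ t → ‖y t‖ ≤ B)
    (h0 : ‖x 0‖ ≤ ‖y 0‖) : x 0 = 0 ∧ y 0 = 0 := by
  obtain ⟨V, hV, hle⟩ := h.hasDerivAt_cone
  have hm := h.pos
  have hnn : ∀ t, 0 ≤ t → 0 ≤ ‖y t‖ ^ 2 - ‖x t‖ ^ 2 := fun t ht => by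
    have h1 := h.cone_le ht fun τ hτ => hs τ hτ.1
    have h2 : ‖x 0‖ ^ 2 ≤ ‖y 0‖ ^ 2 := by gcongr
    linarith
  have hzero : ∀ t, 0 ≤ t → ‖y t‖ ^ 2 - ‖x t‖ ^ 2 = 0 := by
    intro t ht
    refine le_antisymm ?_ (hnn t ht)
    by_contra! hpos
    have hgrow : ∀ τ, t ≤ τ → (‖y t‖ ^ 2 - ‖x t‖ ^ 2) * exp (m * (τ - t)) ≤ B ^ 2 := by
      intro τ hτ
      refine (mul_exp_le_of_le_deriv (k := m) hτ hV fun r hr => ?_).trans ?_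
      · have := hle r (hs r (ht.trans hr.1))
        nlinarith [mul_nonneg hm.le (sq_nonneg ‖x r‖)]
      · have := hB τ (ht.trans hτ)
        nlinarith [norm_nonneg (y τ), sq_nonneg ‖x τ‖]
    have hlim : Tendsto (fun τ => (‖y t‖ ^ 2 - ‖x t‖ ^ 2) * exp (m * (τ - t))) atTop atTop :=
      (tendsto_exp_atTop.comp ((tendsto_id.atTop_add tendsto_const_nhds).const_mul_atTop
        hm)).const_mul_atTop hpos
    obtain ⟨τ, h1, h2⟩ := ((eventually_ge_atTop t).and
      (hlim.eventually (eventually_gt_atTop (B ^ 2)))).exists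
    exact absurd (hgrow τ h1) (not_le.mpr h2)
  have hS : ∀ t, 0 < t → ‖x t‖ ^ 2 + ‖y t‖ ^ 2 = 0 := by
    intro t ht
    have hev : (fun t => ‖y t‖ ^ 2 - ‖x t‖ ^ 2) =ᶠ[𝓝 t] fun _ => 0 := by
      filter_upwards [lt_mem_nhds ht] with τ hτ using hzero τ hτ.le
    have h1 : V t = 0 := (hV t).unique ((hasDerivAt_const t (0 : ℝ)).congr_of_eventuallyEq hev)
    have h2 := hle t (hs t ht.le)
    rw [h1] at h2
    nlinarith [sq_nonneg ‖x t‖, sq_nonneg ‖y t‖]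
  have hc : ContinuousAt (fun t => ‖x t‖ ^ 2 + ‖y t‖ ^ 2) 0 :=
    ((h.deriv_x 0).continuousAt.norm.pow 2).add ((h.deriv_y 0).continuousAt.norm.pow 2)
  have h0' : ‖x 0‖ ^ 2 + ‖y 0‖ ^ 2 = 0 := by
    refine tendsto_nhds_unique (hc.tendsto.mono_left nhdsWithin_le_nhds :
      Tendsto _ (𝓝[>] (0 : ℝ)) _) ?_
    refine (tendsto_const_nhds (x := (0 : ℝ))).congr' ?_
    filter_upwards [self_mem_nhdsWithin] with t ht using (hS t ht).symm
  constructor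
  · rw [← norm_eq_zero]; nlinarith [sq_nonneg ‖x 0‖, sq_nonneg ‖y 0‖]
  · rw [← norm_eq_zero]; nlinarith [sq_nonneg ‖x 0‖, sq_nonneg ‖y 0‖]

/-- A bounded curve stays in the stable cone. -/
lemma norm_le_norm (h : IsSaddleCurve m l₁ l₂ x y n₁ n₂) {B : ℝ}
    (hs : ∀ t, 0 ≤ t → IsSmallAt m x y n₁ n₂ t) (hB : ∀ t, 0 ≤ t → ‖y t‖ ≤ B) {t : ℝ}
    (ht : 0 ≤ t) : ‖y t‖ ≤ ‖x t‖ := by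
  by_contra! hlt
  obtain ⟨-, h2⟩ := (h.shift t).eq_zero_of_norm_le (B := B)
    (fun τ hτ => hs (τ + t) (by linarith)) (fun τ hτ => hB _ (by linarith))
    (by simpa using hlt.le)
  simp only [zero_add] at h2
  rw [h2, norm_zero] at hlt
  exact absurd hlt (not_lt.mpr (norm_nonneg _))

/-- Exponential decay in the stable cone. -/
lemma normSq_le_mul_exp (h : IsSaddleCurve m l₁ l₂ x y n₁ n₂) {a b : ℝ} (hab : a ≤ b)
    (hs : ∀ t ∈ Set.Icc a b, IsSmallAt m x y n₁ n₂ t)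
    (hc : ∀ t ∈ Set.Icc a b, ‖y t‖ ≤ ‖x t‖) : ‖x b‖ ^ 2 ≤ ‖x a‖ ^ 2 * exp (-m * (b - a)) := by
  refine le_mul_exp_of_deriv_le hab (fun t => hasDerivAt_normSq (h.deriv_x t)) fun t ht => ?_
  have hm := h.pos
  have e1 := le_of_abs_le (abs_inner_le (x t) (n₁ t))
  have h1 := (hs t ht).1
  rw [max_eq_left (hc t ht)] at h1
  have h2 := mul_le_mul_of_nonneg_left h1 (norm_nonneg (x t))
  have b1 := mul_le_mul_of_nonneg_right h.re_le (sq_nonneg ‖x t‖)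
  nlinarith [mul_nonneg hm.le (sq_nonneg ‖x t‖)]

/-- The decay in the stable cone is at most exponential. -/
lemma normSq_mul_exp_le (h : IsSaddleCurve m l₁ l₂ x y n₁ n₂) {a b : ℝ} (hab : a ≤ b)
    (hs : ∀ t ∈ Set.Icc a b, IsSmallAt m x y n₁ n₂ t)
    (hc : ∀ t ∈ Set.Icc a b, ‖y t‖ ≤ ‖x t‖) :
    ‖x a‖ ^ 2 * exp ((2 * l₁.re - m) * (b - a)) ≤ ‖x b‖ ^ 2 := by
  refine mul_exp_le_of_le_deriv hab (fun t => hasDerivAt_normSq (h.deriv_x t)) fun t ht => ?_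
  have hm := h.pos
  have e1 := neg_le_of_abs_le (abs_inner_le (x t) (n₁ t))
  have h1 := (hs t ht).1
  rw [max_eq_left (hc t ht)] at h1
  have h2 := mul_le_mul_of_nonneg_left h1 (norm_nonneg (x t))
  nlinarith [mul_nonneg hm.le (sq_nonneg ‖x t‖)]

/-- On the stable manifold of a quadratic perturbation, the solutions decay exactly like the
stable linear mode, and become tangent to the stable subspace. -/
lemma exists_rate (h : IsSaddleCurve m l₁ l₂ x y n₁ n₂) {C : ℝ}
    (hs : ∀ t, 0 ≤ t → IsSmallAt m x y n₁ n₂ t) (hc : ∀ t, 0 ≤ t → ‖y t‖ ≤ ‖x t‖)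
    (hx : ∀ t, 0 ≤ t → x t ≠ 0)
    (hn : ∀ t, 0 ≤ t → ‖n₁ t‖ ≤ C * ‖x t‖ ^ 2 ∧ ‖n₂ t‖ ≤ C * ‖x t‖ ^ 2) :
    (∃ L : ℝ, 0 < L ∧ Tendsto (fun t => ‖x t‖ ^ 2 * exp (-(2 * l₁.re) * t)) atTop (𝓝 L)) ∧
      Tendsto (fun t => ‖y t‖ ^ 2 / ‖x t‖ ^ 2) atTop (𝓝 0) := by
  have hm := h.pos
  have hpos : ∀ t, 0 ≤ t → 0 < ‖x t‖ := fun t ht => norm_pos_iff.mpr (hx t ht)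
  have hC : 0 ≤ C := by
    have h1 := (norm_nonneg _).trans (hn 0 le_rfl).1
    have h2 := hpos 0 le_rfl
    exact nonneg_of_mul_nonneg_left h1 (by positivity)
  have hdecay : ∀ t, 0 ≤ t → ‖x t‖ ≤ ‖x 0‖ * exp (-(m / 2 * t)) := fun t ht => by
    have h1 := h.normSq_le_mul_exp ht (fun τ hτ => hs τ hτ.1) fun τ hτ => hc τ hτ.1
    have h2 : ‖x 0‖ ^ 2 * exp (-m * (t - 0)) = (‖x 0‖ * exp (-(m / 2 * t))) ^ 2 := by
      rw [mul_pow, ← exp_nat_mul]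
      congr 2
      push_cast; ring
    rw [h2] at h1
    exact (pow_le_pow_iff_left₀ (norm_nonneg _) (by positivity) two_ne_zero).mp h1
  constructor
  · have hd : ∀ t, 0 ≤ t → HasDerivAt (fun t => Real.log (‖x t‖ ^ 2) + -(2 * l₁.re) * t)
        (2 * ((x t).re * (n₁ t).re + (x t).im * (n₁ t).im) / ‖x t‖ ^ 2) t := fun t ht => by
      have h0 := hpos t ht
      refine (((hasDerivAt_normSq (h.deriv_x t)).log (by positivity)).add
        ((hasDerivAt_id t).const_mul (-(2 * l₁.re)))).congr_deriv ?_
      field_simp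
      ring
    obtain ⟨l, hl⟩ := exists_tendsto_of_abs_deriv_le_exp (C := 2 * C * ‖x 0‖) (half_pos hm) hd
      fun t ht => by
        have h0 := hpos t ht
        rw [abs_div, abs_of_pos (by positivity : 0 < ‖x t‖ ^ 2), div_le_iff₀ (by positivity),
          abs_mul, abs_two]
        have h1 := abs_inner_le (x t) (n₁ t)
        have h2 := mul_le_mul_of_nonneg_left (hn t ht).1 h0.le
        have h3 := mul_le_mul_of_nonneg_left (hdecay t ht) (by positivity : 0 ≤ C * ‖x t‖ ^ 2)
        nlinarith
    refine ⟨exp l, exp_pos l, (hl.rexp).congr' ?_⟩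
    filter_upwards [eventually_ge_atTop 0] with t ht
    have h0 := hpos t ht
    rw [exp_add, exp_log (by positivity)]
  · have hx0 : Tendsto (fun t => ‖x t‖) atTop (𝓝 0) := by
      have he : Tendsto (fun t : ℝ => ‖x 0‖ * exp (-(m / 2 * t))) atTop (𝓝 0) := by
        have := (tendsto_exp_neg_atTop_nhds_zero.comp
          (tendsto_id.const_mul_atTop (half_pos hm))).const_mul ‖x 0‖
        rwa [mul_zero] at this
      refine squeeze_zero' (Eventually.of_forall fun t => norm_nonneg _) ?_ he
      filter_upwards [eventually_ge_atTop 0] with t ht using hdecay t ht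
    have hh : Tendsto (fun t => 4 * C * ‖x t‖) atTop (𝓝 0) := by simpa using hx0.const_mul (4 * C)
    refine tendsto_zero_of_le_deriv (c := 2 * m) (B := 1) (by positivity) ?_
      (fun t => by positivity) ?_ ?_ hh (y' := fun t =>
        ((2 * l₂.re * ‖y t‖ ^ 2 + 2 * ((y t).re * (n₂ t).re + (y t).im * (n₂ t).im)) * ‖x t‖ ^ 2 -
        ‖y t‖ ^ 2 * (2 * l₁.re * ‖x t‖ ^ 2 + 2 * ((x t).re * (n₁ t).re + (x t).im * (n₁ t).im))) /
          (‖x t‖ ^ 2) ^ 2)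
    · filter_upwards [eventually_ge_atTop 0] with t ht
      have h0 := hpos t ht
      exact (hasDerivAt_normSq (h.deriv_y t)).div (hasDerivAt_normSq (h.deriv_x t)) (by positivity)
    · filter_upwards [eventually_ge_atTop 0] with t ht
      have h0 := hpos t ht
      rw [div_le_one (by positivity)]
      have := hc t ht
      gcongr
    · filter_upwards [eventually_ge_atTop 0] with t ht
      have h0 := hpos t ht
      have hyx := hc t ht
      have hy0 := norm_nonneg (y t)
      obtain ⟨k1, k2⟩ := hn t ht
      have e1 := le_of_abs_le (abs_inner_le (x t) (n₁ t))
      have e2 := neg_le_of_abs_le (abs_inner_le (y t) (n₂ t))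
      rw [le_div_iff₀ (by positivity)]
      have e3 : (2 * m * (‖y t‖ ^ 2 / ‖x t‖ ^ 2) - 4 * C * ‖x t‖) * (‖x t‖ ^ 2) ^ 2 =
          2 * m * ‖y t‖ ^ 2 * ‖x t‖ ^ 2 - 4 * C * ‖x t‖ ^ 5 := by field_simp
      rw [e3]
      have f1 : (x t).re * (n₁ t).re + (x t).im * (n₁ t).im ≤ C * ‖x t‖ ^ 3 := by
        have := mul_le_mul_of_nonneg_left k1 h0.le
        nlinarith
      have f2 : -(C * ‖x t‖ ^ 3) ≤ (y t).re * (n₂ t).re + (y t).im * (n₂ t).im := by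
        have g1 := mul_le_mul_of_nonneg_left k2 hy0
        have g2 := mul_le_mul_of_nonneg_right hyx (by positivity : 0 ≤ C * ‖x t‖ ^ 2)
        nlinarith
      have g1 := mul_le_mul_of_nonneg_right f2 (sq_nonneg ‖x t‖)
      have g2 := mul_le_mul_of_nonneg_left f1 (sq_nonneg ‖y t‖)
      have hy2 : ‖y t‖ ^ 2 ≤ ‖x t‖ ^ 2 := by gcongr
      have g3 := mul_le_mul_of_nonneg_right hy2 (by positivity : 0 ≤ C * ‖x t‖ ^ 3)
      have g4 := mul_le_mul_of_nonneg_right (add_le_add h.le_re (neg_le_neg h.re_le))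
        (by positivity : 0 ≤ ‖y t‖ ^ 2 * ‖x t‖ ^ 2)
      have g5 : 0 ≤ m * (‖y t‖ ^ 2 * ‖x t‖ ^ 2) := by positivity
      nlinarith

end IsSaddleCurve

end
end DampedSzego
namespace DampedSzego
noncomputable section

/-! ### Linearization along the circle -/

lemma sigma_spec {ν M : ℝ} (α : ℝ) (hν : 0 < ν) (hM : 0 < M) :
    ν < sigma ν α M ∧ sigma ν α M ^ 4 =
      (ν ^ 2 - α ^ 2 - 4 * M * α) * sigma ν α M ^ 2 + ν ^ 2 * (2 * M + α) ^ 2 := by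
  set A := ν ^ 2 - α ^ 2 - 4 * M * α with hA
  set R := √(A ^ 2 + 4 * ν ^ 2 * (2 * M + α) ^ 2) with hR
  have hR2 : R ^ 2 = A ^ 2 + 4 * ν ^ 2 * (2 * M + α) ^ 2 := Real.sq_sqrt (by positivity)
  have hlt : 2 * ν ^ 2 - A < R := by
    refine Real.lt_sqrt_of_sq_lt ?_
    have : 0 < ν ^ 2 * M ^ 2 := by positivity
    have e : A ^ 2 + 4 * ν ^ 2 * (2 * M + α) ^ 2 - (2 * ν ^ 2 - A) ^ 2 = 16 * (ν ^ 2 * M ^ 2) := by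
      rw [hA]; ring
    linarith
  have hsig : sigma ν α M = √((A + R) / 2) := rfl
  have hs2 : sigma ν α M ^ 2 = (A + R) / 2 := by
    rw [hsig, Real.sq_sqrt]
    nlinarith [sq_nonneg ν]
  constructor
  · refine lt_of_pow_lt_pow_left₀ 2 (Real.sqrt_nonneg _) ?_
    rw [hs2]; linarith
  · rw [show sigma ν α M ^ 4 = (sigma ν α M ^ 2) ^ 2 by ring, hs2]
    linear_combination hR2 / 4

/-- The square root `σ + iν(2M + α)/σ` of the discriminant of the linearized system. -/
def saddleGap (ν α M : ℝ) : ℂ :=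
  sigma ν α M + Complex.I * (ν * (2 * M + α) / sigma ν α M : ℝ)

/-- The stable eigenvalue of the linearization of the flow along the circle. -/
def stableEig (ν α M : ℝ) : ℂ :=
  (-(ν + Complex.I * (2 * M + α : ℝ)) - saddleGap ν α M) / 2

/-- The unstable eigenvalue of the linearization of the flow along the circle. -/
def unstableEig (ν α M : ℝ) : ℂ :=
  (-(ν + Complex.I * (2 * M + α : ℝ)) + saddleGap ν α M) / 2

lemma saddleGap_re (ν α M : ℝ) : (saddleGap ν α M).re = sigma ν α M := by
  simp [saddleGap, -Complex.ofReal_div, -Complex.ofReal_mul]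

lemma stableEig_re (ν α M : ℝ) : (stableEig ν α M).re = -((ν + sigma ν α M) / 2) := by
  rw [stableEig, Complex.div_ofNat_re, Complex.sub_re, saddleGap_re]
  simp [-Complex.ofReal_add]
  ring

lemma unstableEig_re (ν α M : ℝ) : (unstableEig ν α M).re = (sigma ν α M - ν) / 2 := by
  rw [unstableEig, Complex.div_ofNat_re, Complex.add_re, saddleGap_re]
  simp [-Complex.ofReal_add]
  ring

lemma unstableEig_sub (ν α M : ℝ) : unstableEig ν α M - stableEig ν α M = saddleGap ν α M := by
  rw [unstableEig, stableEig]; ring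

lemma stableEig_add (ν α M : ℝ) :
    stableEig ν α M + unstableEig ν α M = -(ν + Complex.I * (2 * M + α)) := by
  rw [unstableEig, stableEig]; push_cast; ring

lemma saddleGap_ne_zero {ν M : ℝ} (α : ℝ) (hν : 0 < ν) (hM : 0 < M) : saddleGap ν α M ≠ 0 := by
  intro h
  have := congrArg Complex.re h
  rw [saddleGap_re, Complex.zero_re] at this
  linarith [(sigma_spec α hν hM).1]

lemma stableEig_mul {ν M : ℝ} (α : ℝ) (hν : 0 < ν) (hM : 0 < M) :
    stableEig ν α M * unstableEig ν α M = -(M : ℂ) ^ 2 := by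
  obtain ⟨h1, h2⟩ := sigma_spec α hν hM
  have hs : (sigma ν α M : ℂ) ≠ 0 := by
    exact_mod_cast (hν.trans h1).ne'
  have h2C : (sigma ν α M : ℂ) ^ 4 =
      (ν ^ 2 - α ^ 2 - 4 * M * α) * (sigma ν α M : ℂ) ^ 2 + ν ^ 2 * (2 * M + α) ^ 2 := by
    exact_mod_cast h2
  rw [unstableEig, stableEig, saddleGap]
  push_cast
  generalize (sigma ν α M : ℂ) = s at *
  field_simp
  have hI := Complex.I_sq
  generalize Complex.I = i at *
  linear_combination (-1) * h2C + (s ^ 2 * (2 * M + α) ^ 2 - ν ^ 2 * (2 * M + α) ^ 2) * hI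

/-- The coordinate `q = c p̄ / (√M (1 - |p|²))`, of modulus `|p|` on the level set. -/
def qCoord (M : ℝ) (z : ℂ × ℂ × ℂ) : ℂ := z.2.1 * (starRingEnd ℂ) z.2.2 / (√M * eta z : ℝ)

/-- The coordinate `w = i √M b`. -/
def wCoord (M : ℝ) (z : ℂ × ℂ × ℂ) : ℂ := Complex.I * (√M : ℝ) * z.1

/-- The cubic part of the equation of `q`. -/
def qRem (β M : ℝ) (q w : ℂ) : ℂ :=
  -2 * (q * (starRingEnd ℂ) q * w) + (starRingEnd ℂ) w * q * q
    - 2 * Complex.I / M * (w * (starRingEnd ℂ) w * q)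
    - Complex.I * (1 - β) * M * (q * (starRingEnd ℂ) q * q)

/-- The cubic part of the equation of `w`. -/
def wRem (M : ℝ) (q w : ℂ) : ℂ :=
  -Complex.I / M * (w * (starRingEnd ℂ) w * w) + 2 * Complex.I * M * (q * (starRingEnd ℂ) q * w)
    - (M : ℂ) ^ 2 * (q * (starRingEnd ℂ) q * q)

lemma ofReal_eta (z : ℂ × ℂ × ℂ) : ((eta z : ℝ) : ℂ) = 1 - z.2.2 * (starRingEnd ℂ) z.2.2 := by
  rw [Complex.mul_conj, Complex.normSq_eq_norm_sq, eta]; push_cast; ring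

lemma norm_qCoord {M : ℝ} (hM : 0 < M) {z : ℂ × ℂ × ℂ} (hz : z ∈ levelSet M) :
    ‖qCoord M z‖ = ‖z.2.2‖ := by
  have hη := eta_pos hz.1
  have : 0 < √M := Real.sqrt_pos.mpr hM
  rw [qCoord, norm_div, norm_mul, RCLike.norm_conj, norm_c_of_mem hz, Complex.norm_real,
    Real.norm_of_nonneg (by positivity)]
  field_simp

lemma norm_wCoord {M : ℝ} (z : ℂ × ℂ × ℂ) : ‖wCoord M z‖ = √M * ‖z.1‖ := by
  rw [wCoord, norm_mul, norm_mul, Complex.norm_I, one_mul, Complex.norm_real,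
    Real.norm_of_nonneg (Real.sqrt_nonneg M)]

namespace IsOrbit
variable {ν α β M : ℝ} {γ : ℝ → ℂ × ℂ × ℂ}

lemma hasDerivAt_qCoord (h : IsOrbit ν α β M γ) (hM : 0 < M) (t : ℝ) :
    HasDerivAt (fun t => qCoord M (γ t))
      (wCoord M (γ t) + qRem β M (qCoord M (γ t)) (wCoord M (γ t))) t := by
  obtain ⟨h1, h2, h3⟩ := hasDerivAt_coords (h.deriv t)
  have hη := eta_pos (h.mem t).1
  have hs : 0 < √M := Real.sqrt_pos.mpr hM
  have h3' : HasDerivAt (fun t => (starRingEnd ℂ) (γ t).2.2)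
      ((starRingEnd ℂ) (vf ν α β M (γ t)).2.2) t := h3.star
  have hden : HasDerivAt (fun t => ((√M * eta (γ t) : ℝ) : ℂ))
      ((√M * (2 * (crossTerm (γ t)).im) : ℝ) : ℂ) t :=
    ((h.hasDerivAt_eta t).const_mul √M).ofReal_comp
  have hne : ((√M * eta (γ t) : ℝ) : ℂ) ≠ 0 := by
    exact_mod_cast (mul_pos hs hη).ne'
  refine ((h2.mul h3').div hden hne).congr_deriv ?_
  have hcc := levelSet_mul_conj (h.mem t)
  have hsC : ((√M : ℝ) : ℂ) ≠ 0 := by exact_mod_cast hs.ne'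
  have hs2 : (M : ℂ) = ((√M : ℝ) : ℂ) ^ 2 := by
    rw [← Complex.ofReal_pow, Real.sq_sqrt hM.le]
  have hη0 : ((eta (γ t) : ℝ) : ℂ) ≠ 0 := by exact_mod_cast hη.ne'
  have hpp : (γ t).2.2 * (starRingEnd ℂ) (γ t).2.2 = 1 - ((eta (γ t) : ℝ) : ℂ) := by
    rw [ofReal_eta]; ring
  have hcp : (γ t).2.1 * (starRingEnd ℂ) (γ t).2.2 =
      qCoord M (γ t) * (((√M : ℝ) : ℂ) * (eta (γ t) : ℝ)) := by
    rw [qCoord, Complex.ofReal_mul]; field_simp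
  have hcp' : (starRingEnd ℂ) (γ t).2.1 * (γ t).2.2 =
      (starRingEnd ℂ) (qCoord M (γ t)) * (((√M : ℝ) : ℂ) * (eta (γ t) : ℝ)) := by
    have := congrArg (starRingEnd ℂ) hcp
    simpa only [map_mul, Complex.conj_conj, Complex.conj_ofReal] using this
  have hd : ((√M * (2 * (crossTerm (γ t)).im) : ℝ) : ℂ) = ((√M : ℝ) : ℂ) *
      (-Complex.I * ((γ t).1 * ((starRingEnd ℂ) (γ t).2.1 * (γ t).2.2)
        - (starRingEnd ℂ) (γ t).1 * ((γ t).2.1 * (starRingEnd ℂ) (γ t).2.2))) := by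
    have := Complex.sub_conj (crossTerm (γ t))
    simp only [crossTerm, map_mul, Complex.conj_conj] at this ⊢
    push_cast at this ⊢
    linear_combination (Complex.I * (√M : ℝ)) * this + (2 * (√M : ℝ) *
      (((γ t).1 * (starRingEnd ℂ) (γ t).2.1 * (γ t).2.2).im : ℂ)) * Complex.I_mul_I
  rw [hcp', hcp] at hd
  have hqq : qCoord M (γ t) * (starRingEnd ℂ) (qCoord M (γ t)) = 1 - ((eta (γ t) : ℝ) : ℂ) := by
    rw [Complex.mul_conj, Complex.normSq_eq_norm_sq, norm_qCoord hM (h.mem t), eta]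
    push_cast; ring
  simp only [Pi.mul_apply]
  rw [hcp, hd, Complex.ofReal_mul]
  simp only [vf, qRem, wCoord, map_mul, map_add, map_sub, map_neg, Complex.conj_conj,
    Complex.conj_I, Complex.conj_ofReal, map_one]
  generalize qCoord M (γ t) = q at *
  generalize (starRingEnd ℂ) q = q' at *
  generalize (starRingEnd ℂ) (γ t).2.1 = c' at *
  generalize (starRingEnd ℂ) (γ t).2.2 = p' at *
  generalize (starRingEnd ℂ) (γ t).1 = b' at *
  generalize (γ t).2.1 = c at *
  generalize (γ t).2.2 = p at *
  generalize (γ t).1 = b at *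
  generalize ((√M : ℝ) : ℂ) = s at *
  generalize ((eta (γ t) : ℝ) : ℂ) = η at *
  rw [hs2] at hcc ⊢
  rw [div_eq_iff (pow_ne_zero 2 (mul_ne_zero hsC hη0))]
  have hI := Complex.I_sq
  generalize Complex.I = i at *
  field_simp
  linear_combination (-2 * i * b * b' - i * s ^ 2 * (1 - β) + i * s ^ 2 * (1 - β) * (1 - p * p')) * hcp
    + i * b * hcc + (-2 * i * b * s ^ 2 * (η - p * p') - i * b * s ^ 2 * (1 - p * p' + η)
      - i * s ^ 2 * (1 - β) * (q * (s * η))) * hpp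
    + (3 * i * s ^ 2 * η * b + i * s ^ 3 * η * (1 - β) * q) * hqq
    - 2 * i * b * b' * q * s * η * hI

lemma hasDerivAt_wCoord (h : IsOrbit ν α β M γ) (hM : 0 < M) (t : ℝ) :
    HasDerivAt (fun t => wCoord M (γ t))
      ((M : ℂ) ^ 2 * qCoord M (γ t) - (ν + Complex.I * (2 * M + α)) * wCoord M (γ t)
        + wRem M (qCoord M (γ t)) (wCoord M (γ t))) t := by
  obtain ⟨h1, h2, h3⟩ := hasDerivAt_coords (h.deriv t)
  have hη := eta_pos (h.mem t).1
  have hs : 0 < √M := Real.sqrt_pos.mpr hM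
  have hsC : ((√M : ℝ) : ℂ) ≠ 0 := by exact_mod_cast hs.ne'
  have hs2 : (M : ℂ) = ((√M : ℝ) : ℂ) ^ 2 := by
    rw [← Complex.ofReal_pow, Real.sq_sqrt hM.le]
  have hη0 : ((eta (γ t) : ℝ) : ℂ) ≠ 0 := by exact_mod_cast hη.ne'
  have hcp : (γ t).2.1 * (starRingEnd ℂ) (γ t).2.2 =
      qCoord M (γ t) * (((√M : ℝ) : ℂ) * (eta (γ t) : ℝ)) := by
    rw [qCoord, Complex.ofReal_mul]; field_simp
  have hqq : qCoord M (γ t) * (starRingEnd ℂ) (qCoord M (γ t)) = 1 - ((eta (γ t) : ℝ) : ℂ) := by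
    rw [Complex.mul_conj, Complex.normSq_eq_norm_sq, norm_qCoord hM (h.mem t), eta]
    push_cast; ring
  have hpp : (γ t).2.2 * (starRingEnd ℂ) (γ t).2.2 = 1 - ((eta (γ t) : ℝ) : ℂ) := by
    rw [ofReal_eta]; ring
  refine (h1.const_mul (Complex.I * (√M : ℝ))).congr_deriv ?_
  simp only [vf, wRem, wCoord, map_mul, Complex.conj_I, Complex.conj_ofReal]
  generalize qCoord M (γ t) = q at *
  generalize (starRingEnd ℂ) q = q' at *
  generalize (starRingEnd ℂ) (γ t).2.2 = p' at *
  generalize (starRingEnd ℂ) (γ t).1 = b' at *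
  generalize (γ t).2.1 = c at *
  generalize (γ t).2.2 = p at *
  generalize (γ t).1 = b at *
  generalize ((√M : ℝ) : ℂ) = s at *
  generalize ((eta (γ t) : ℝ) : ℂ) = η at *
  rw [hs2]
  have hI := Complex.I_sq
  generalize Complex.I = i at *
  field_simp
  linear_combination (-i ^ 2 * s ^ 2) * hcp + 2 * i ^ 2 * b * s ^ 2 * hpp
    + (-2 * i ^ 2 * b * s ^ 2 + s ^ 3 * q) * hqq - (i ^ 2 * b ^ 2 * b' + s ^ 3 * q * η) * hI

end IsOrbit

/-- The coordinates `(l₂ q - w, w - l₁ q)`, in which the linearization is diagonal. -/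
def saddleCoord (ν α M : ℝ) (z : ℂ × ℂ × ℂ) : ℂ × ℂ :=
  (unstableEig ν α M * qCoord M z - wCoord M z, wCoord M z - stableEig ν α M * qCoord M z)

/-- The coordinate `q`, as a function of the diagonal coordinates. -/
def qOf (ν α M : ℝ) (ζ : ℂ × ℂ) : ℂ := (ζ.1 + ζ.2) / saddleGap ν α M

/-- The coordinate `w`, as a function of the diagonal coordinates. -/
def wOf (ν α M : ℝ) (ζ : ℂ × ℂ) : ℂ :=
  (stableEig ν α M * ζ.1 + unstableEig ν α M * ζ.2) / saddleGap ν α M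

/-- The cubic part of the equations, in the diagonal coordinates. -/
def saddleRem (ν α β M : ℝ) (ζ : ℂ × ℂ) : ℂ × ℂ :=
  (unstableEig ν α M * qRem β M (qOf ν α M ζ) (wOf ν α M ζ) - wRem M (qOf ν α M ζ) (wOf ν α M ζ),
    wRem M (qOf ν α M ζ) (wOf ν α M ζ) - stableEig ν α M * qRem β M (qOf ν α M ζ) (wOf ν α M ζ))

section
variable {ν α β M : ℝ}

lemma qOf_saddleCoord (hν : 0 < ν) (hM : 0 < M) (z : ℂ × ℂ × ℂ) :
    qOf ν α M (saddleCoord ν α M z) = qCoord M z := by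
  rw [qOf, div_eq_iff (saddleGap_ne_zero α hν hM), ← unstableEig_sub, saddleCoord]
  ring

lemma wOf_saddleCoord (hν : 0 < ν) (hM : 0 < M) (z : ℂ × ℂ × ℂ) :
    wOf ν α M (saddleCoord ν α M z) = wCoord M z := by
  rw [wOf, div_eq_iff (saddleGap_ne_zero α hν hM), ← unstableEig_sub, saddleCoord]
  ring

lemma saddleCoord_of (hν : 0 < ν) (hM : 0 < M) {z : ℂ × ℂ × ℂ} {ζ : ℂ × ℂ}
    (hq : qCoord M z = qOf ν α M ζ) (hw : wCoord M z = wOf ν α M ζ) :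
    saddleCoord ν α M z = ζ := by
  have hΔ := saddleGap_ne_zero α hν hM
  have h := unstableEig_sub ν α M
  rw [saddleCoord, hq, hw, qOf, wOf]
  ext
  · field_simp
    linear_combination ζ.1 * h
  · field_simp
    linear_combination ζ.2 * h

lemma IsOrbit.isSaddleCurve {γ : ℝ → ℂ × ℂ × ℂ} (h : IsOrbit ν α β M γ) (hν : 0 < ν)
    (hM : 0 < M) :
    IsSaddleCurve ((sigma ν α M - ν) / 2) (stableEig ν α M) (unstableEig ν α M)
      (fun t => (saddleCoord ν α M (γ t)).1) (fun t => (saddleCoord ν α M (γ t)).2)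
      (fun t => (saddleRem ν α β M (saddleCoord ν α M (γ t))).1)
      (fun t => (saddleRem ν α β M (saddleCoord ν α M (γ t))).2) := by
  have hs := (sigma_spec α hν hM).1
  have hadd := stableEig_add ν α M
  have hmul := stableEig_mul α hν hM
  refine ⟨by linarith, by rw [stableEig_re]; linarith, by rw [unstableEig_re], fun t => ?_,
    fun t => ?_⟩
  · refine (((h.hasDerivAt_qCoord hM t).const_mul (unstableEig ν α M)).sub
      (h.hasDerivAt_wCoord hM t)).congr_deriv ?_
    simp only [saddleRem, qOf_saddleCoord hν hM, wOf_saddleCoord hν hM]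
    simp only [saddleCoord]
    linear_combination (wCoord M (γ t)) * hadd - qCoord M (γ t) * hmul
  · refine ((h.hasDerivAt_wCoord hM t).sub
      ((h.hasDerivAt_qCoord hM t).const_mul (stableEig ν α M))).congr_deriv ?_
    simp only [saddleRem, qOf_saddleCoord hν hM, wOf_saddleCoord hν hM]
    simp only [saddleCoord]
    linear_combination (-wCoord M (γ t)) * hadd + qCoord M (γ t) * hmul

lemma contDiff_saddleRem (ν α β M : ℝ) : ContDiff ℝ ∞ (saddleRem ν α β M) := by
  have hq : ContDiff ℝ ∞ (qOf ν α M) := by unfold qOf; fun_prop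
  have hw : ContDiff ℝ ∞ (wOf ν α M) := by unfold wOf; fun_prop
  have hq' := contDiff_conj hq
  have hw' := contDiff_conj hw
  unfold saddleRem qRem wRem
  fun_prop

lemma isBigO_saddleRem (ν α β M : ℝ) :
    saddleRem ν α β M =O[𝓝 0] fun ζ => ‖ζ‖ ^ 2 := by
  have h1 : (fun ζ : ℂ × ℂ => ζ.1) =O[𝓝 0] fun ζ => ‖ζ‖ :=
    IsBigO.of_bound 1 (Eventually.of_forall fun ζ => by simpa using norm_fst_le ζ)
  have h2 : (fun ζ : ℂ × ℂ => ζ.2) =O[𝓝 0] fun ζ => ‖ζ‖ :=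
    IsBigO.of_bound 1 (Eventually.of_forall fun ζ => by simpa using norm_snd_le ζ)
  have hq : qOf ν α M =O[𝓝 0] fun ζ => ‖ζ‖ := by
    refine ((h1.add h2).const_mul_left (saddleGap ν α M)⁻¹).congr_left fun ζ => ?_
    rw [qOf]; ring
  have hw : wOf ν α M =O[𝓝 0] fun ζ => ‖ζ‖ := by
    refine (((h1.const_mul_left (stableEig ν α M)).add
      (h2.const_mul_left (unstableEig ν α M))).const_mul_left (saddleGap ν α M)⁻¹).congr_left
      fun ζ => ?_
    rw [wOf]; ring
  have hq' : (fun ζ => (starRingEnd ℂ) (qOf ν α M ζ)) =O[𝓝 0] fun ζ => ‖ζ‖ := by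
    refine hq.norm_left.congr_left (fun ζ => ?_) |>.of_norm_left
    rw [RCLike.norm_conj]
  have hw' : (fun ζ => (starRingEnd ℂ) (wOf ν α M ζ)) =O[𝓝 0] fun ζ => ‖ζ‖ := by
    refine hw.norm_left.congr_left (fun ζ => ?_) |>.of_norm_left
    rw [RCLike.norm_conj]
  have hn : (fun ζ : ℂ × ℂ => ‖ζ‖ * ‖ζ‖ * ‖ζ‖) =O[𝓝 0] fun ζ => ‖ζ‖ ^ 2 := by
    refine IsBigO.of_bound 1 ?_
    filter_upwards [Metric.closedBall_mem_nhds (0 : ℂ × ℂ) one_pos] with ζ hζ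
    rw [mem_closedBall_zero_iff] at hζ
    rw [Real.norm_of_nonneg (by positivity), Real.norm_of_nonneg (by positivity)]
    nlinarith [mul_nonneg (norm_nonneg ζ) (norm_nonneg ζ)]
  have hqr : (fun ζ => qRem β M (qOf ν α M ζ) (wOf ν α M ζ)) =O[𝓝 0] fun ζ => ‖ζ‖ ^ 2 := by
    refine IsBigO.trans ?_ hn
    exact (((((hq.mul hq').mul hw).const_mul_left (-2)).add ((hw'.mul hq).mul hq)).sub
      (((hw.mul hw').mul hq).const_mul_left _)).sub (((hq.mul hq').mul hq).const_mul_left _)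
  have hwr : (fun ζ => wRem M (qOf ν α M ζ) (wOf ν α M ζ)) =O[𝓝 0] fun ζ => ‖ζ‖ ^ 2 := by
    refine IsBigO.trans ?_ hn
    exact ((((hw.mul hw').mul hw).const_mul_left _).add
      (((hq.mul hq').mul hw).const_mul_left _)).sub (((hq.mul hq').mul hq).const_mul_left _)
  exact ((hqr.const_mul_left _).sub hwr).prod_left (hwr.sub (hqr.const_mul_left _))

/-- Near the origin, the cubic part is a small Lipschitz perturbation, of quadratic size. -/
lemma exists_small_saddleRem (α β : ℝ) (hν : 0 < ν) (hM : 0 < M) : ∃ ε C : ℝ, 0 < ε ∧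
    (∀ ζ ζ' : ℂ × ℂ, ‖ζ‖ ≤ ε → ‖ζ'‖ ≤ ε → ‖saddleRem ν α β M ζ - saddleRem ν α β M ζ'‖ ≤
      (sigma ν α M - ν) / 2 / 4 * ‖ζ - ζ'‖) ∧
    (∀ ζ : ℂ × ℂ, ‖ζ‖ ≤ ε → ‖saddleRem ν α β M ζ‖ ≤ C * ‖ζ‖ ^ 2) ∧
    (∀ ζ : ℂ × ℂ, ‖ζ‖ ≤ ε → ‖qOf ν α M ζ‖ ≤ 1 / 2) ∧ saddleRem ν α β M 0 = 0 := by
  have hm : 0 < (sigma ν α M - ν) / 2 / 4 := by linarith [(sigma_spec α hν hM).1]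
  have hO := isBigO_saddleRem ν α β M
  have h0 : saddleRem ν α β M 0 = 0 := by
    simp [saddleRem, qRem, wRem, qOf, wOf]
  have hd : HasFDerivAt (saddleRem ν α β M) (0 : ℂ × ℂ →L[ℝ] ℂ × ℂ) 0 := by
    refine IsBigO.hasFDerivAt (n := 2) ?_ one_lt_two
    simpa using hO
  have hst := (contDiff_saddleRem ν α β M).contDiffAt.hasStrictFDerivAt' hd (by simp)
  obtain ⟨C, hC⟩ := hO.bound
  obtain ⟨ε₁, hε₁, h1⟩ := Metric.eventually_nhds_iff_ball.mp (hst.isLittleO.def hm)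
  obtain ⟨ε₂, hε₂, h2⟩ := Metric.eventually_nhds_iff_ball.mp hC
  have hq : ContinuousAt (fun ζ => ‖qOf ν α M ζ‖) 0 := by unfold qOf; fun_prop
  obtain ⟨ε₃, hε₃, h3⟩ := Metric.eventually_nhds_iff_ball.mp
    (hq.eventually (gt_mem_nhds (show ‖qOf ν α M 0‖ < 1 / 2 by simp [qOf])))
  have hpos : 0 < min ε₁ (min ε₂ ε₃) := by positivity
  have hlt : min ε₁ (min ε₂ ε₃) / 2 < min ε₁ (min ε₂ ε₃) := half_lt_self hpos
  refine ⟨min ε₁ (min ε₂ ε₃) / 2, C, by positivity, fun ζ ζ' hζ hζ' => ?_, fun ζ hζ => ?_,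
    fun ζ hζ => ?_, h0⟩
  · have := h1 (ζ, ζ') (by
      rw [mem_ball_iff_norm]
      simp only [sub_zero, Prod.norm_def, Prod.fst_sub, Prod.snd_sub]
      have hlt' := hlt.trans_le (min_le_left ε₁ _)
      exact max_lt (hζ.trans_lt hlt') (hζ'.trans_lt hlt'))
    simpa using this
  · have := h2 ζ (by
      rw [mem_ball_zero_iff]
      exact (hζ.trans_lt hlt).trans_le ((min_le_right _ _).trans (min_le_left _ _)))
    simpa using this
  · exact (h3 ζ (by
      rw [mem_ball_zero_iff]
      exact (hζ.trans_lt hlt).trans_le ((min_le_right _ _).trans (min_le_right _ _)))).le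

end

end
end DampedSzego
namespace DampedSzego
noncomputable section

/-! ### The orbits which converge to the circle -/

section
variable {ν α β M : ℝ}

lemma eta_rot {a d : ℂ} (hd : ‖d‖ = 1) (z : ℂ × ℂ × ℂ) : eta (rot a d z) = eta z := by
  simp [eta, rot, hd]

lemma rot_rot (a d a' d' : ℂ) (z : ℂ × ℂ × ℂ) :
    rot a d (rot a' d' z) = rot (a * a') (d * d') z := by
  simp only [rot, Prod.mk.injEq]
  refine ⟨by ring, by ring, by ring⟩

lemma rot_one_one (z : ℂ × ℂ × ℂ) : rot 1 1 z = z := by simp [rot]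

lemma saddleCoord_rot {a d : ℂ} (hd : ‖d‖ = 1) (z : ℂ × ℂ × ℂ) :
    saddleCoord ν α M (rot a d z) = a • saddleCoord ν α M z := by
  have h1 : qCoord M (rot a d z) = a * qCoord M z := by
    rw [qCoord, eta_rot hd, qCoord, mul_div_assoc']
    congr 1
    simp only [rot, map_mul]
    linear_combination (a * z.2.1 * (starRingEnd ℂ) z.2.2) * mul_conj_of_norm_one hd
  have h2 : wCoord M (rot a d z) = a * wCoord M z := by
    simp only [wCoord, rot]; ring
  rw [saddleCoord, h1, h2, saddleCoord]
  ext <;> simp only [Prod.smul_mk, smul_eq_mul] <;> ring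

lemma exists_rot_of_saddleCoord_eq (hν : 0 < ν) (hM : 0 < M) {z z' : ℂ × ℂ × ℂ}
    (hz : z ∈ levelSet M) (hz' : z' ∈ levelSet M)
    (h : saddleCoord ν α M z = saddleCoord ν α M z') : ∃ d : ℂ, ‖d‖ = 1 ∧ z' = rot 1 d z := by
  have hq : qCoord M z = qCoord M z' := by
    rw [← qOf_saddleCoord hν hM (α := α), h, qOf_saddleCoord hν hM]
  have hw : wCoord M z = wCoord M z' := by
    rw [← wOf_saddleCoord hν hM (α := α), h, wOf_saddleCoord hν hM]
  have hs : 0 < √M := Real.sqrt_pos.mpr hM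
  have hsC : ((√M : ℝ) : ℂ) ≠ 0 := by exact_mod_cast hs.ne'
  have hη : eta z = eta z' := by
    rw [eta, eta, ← norm_qCoord hM hz, hq, norm_qCoord hM hz']
  have hη0 := eta_pos hz.1
  have hc : ‖z'.2.1‖ = ‖z.2.1‖ := by rw [norm_c_of_mem hz, norm_c_of_mem hz', hη]
  have hc0 : 0 < ‖z.2.1‖ := by rw [norm_c_of_mem hz]; positivity
  have hc1 : z.2.1 ≠ 0 := norm_pos_iff.mp hc0
  have hd : ‖z'.2.1 / z.2.1‖ = 1 := by rw [norm_div, hc, div_self hc0.ne']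
  refine ⟨z'.2.1 / z.2.1, hd, ?_⟩
  have hb : z'.1 = z.1 := by
    have := hw.symm
    rw [wCoord, wCoord] at this
    exact mul_left_cancel₀ (mul_ne_zero Complex.I_ne_zero hsC) this
  have hp : z.2.1 * (starRingEnd ℂ) z.2.2 = z'.2.1 * (starRingEnd ℂ) z'.2.2 := by
    rw [qCoord, qCoord, ← hη] at hq
    have hne : ((√M * eta z : ℝ) : ℂ) ≠ 0 := by exact_mod_cast (mul_pos hs hη0).ne'
    field_simp at hq
    exact hq
  have hp' : (starRingEnd ℂ) z.2.1 * z.2.2 = (starRingEnd ℂ) z'.2.1 * z'.2.2 := by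
    simpa using congrArg (starRingEnd ℂ) hp
  have hcc : z'.2.1 * (starRingEnd ℂ) z'.2.1 = z.2.1 * (starRingEnd ℂ) z.2.1 := by
    rw [Complex.mul_conj, Complex.mul_conj, Complex.normSq_eq_norm_sq, Complex.normSq_eq_norm_sq,
      hc]
  have hc2 : (starRingEnd ℂ) z.2.1 ≠ 0 := (map_ne_zero _).mpr hc1
  refine Prod.ext ?_ (Prod.ext ?_ ?_)
  · simp [rot, hb]
  · simp only [rot]; field_simp
  · simp only [rot]
    rw [div_mul_eq_mul_div, eq_div_iff hc1]
    refine mul_right_cancel₀ hc2 ?_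
    linear_combination (-z'.2.2) * hcc - z'.2.1 * hp'

lemma saddleCoord_eq_zero_iff (hν : 0 < ν) (hM : 0 < M) {z : ℂ × ℂ × ℂ} (hz : z ∈ levelSet M) :
    saddleCoord ν α M z = 0 ↔ z.1 = 0 ∧ z.2.2 = 0 := by
  have hs : 0 < √M := Real.sqrt_pos.mpr hM
  constructor
  · intro h
    have hq := qOf_saddleCoord (α := α) hν hM z
    have hw := wOf_saddleCoord (α := α) hν hM z
    rw [h] at hq hw
    have h1 := norm_qCoord hM hz
    have h2 := norm_wCoord (M := M) z
    rw [← hq] at h1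
    rw [← hw] at h2
    simp only [qOf, wOf, Prod.fst_zero, Prod.snd_zero, add_zero, zero_div, norm_zero,
      mul_zero] at h1 h2
    exact ⟨norm_eq_zero.mp ((mul_eq_zero.mp h2.symm).resolve_left hs.ne'), norm_eq_zero.mp h1.symm⟩
  · rintro ⟨h1, h2⟩
    simp [saddleCoord, qCoord, wCoord, h1, h2]

lemma continuousAt_saddleCoord (hM : 0 < M) {z : ℂ × ℂ × ℂ} (hz : z ∈ levelSet M) :
    ContinuousAt (saddleCoord ν α M) z := by
  have hne : ((√M * eta z : ℝ) : ℂ) ≠ 0 := by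
    exact_mod_cast (mul_pos (Real.sqrt_pos.mpr hM) (eta_pos hz.1)).ne'
  have hq : ContinuousAt (qCoord M) z := by
    unfold qCoord
    refine ContinuousAt.div ?_ ?_ hne
    · have : Continuous fun z : ℂ × ℂ × ℂ => z.2.1 * (starRingEnd ℂ) z.2.2 :=
        (continuous_fst.comp continuous_snd).mul
          (Complex.continuous_conj.comp (continuous_snd.comp continuous_snd))
      exact this.continuousAt
    · unfold eta
      fun_prop
  have hw : ContinuousAt (wCoord M) z := by unfold wCoord; fun_prop
  unfold saddleCoord
  fun_prop

/-- The point of the level set with given coordinates `q`, `w`, and with `c > 0`. -/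
def saddleLift (M : ℝ) (q w : ℂ) : ℂ × ℂ × ℂ :=
  (-Complex.I * w / (√M : ℝ), ((√M * (1 - ‖q‖ ^ 2) : ℝ) : ℂ), (starRingEnd ℂ) q)

lemma saddleLift_mem (hM : 0 < M) {q : ℂ} (w : ℂ) (hq : ‖q‖ < 1) :
    saddleLift M q w ∈ levelSet M := by
  refine ⟨by simpa [saddleLift] using hq, ?_⟩
  simp only [saddleLift, Complex.norm_real, RCLike.norm_conj, Real.norm_eq_abs, sq_abs]
  rw [mul_pow, Real.sq_sqrt hM.le]

lemma qCoord_saddleLift (hM : 0 < M) {q : ℂ} (w : ℂ) (hq : ‖q‖ < 1) :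
    qCoord M (saddleLift M q w) = q := by
  have hη : eta (saddleLift M q w) = 1 - ‖q‖ ^ 2 := by simp [eta, saddleLift]
  have hpos : 0 < 1 - ‖q‖ ^ 2 := by nlinarith [norm_nonneg q]
  have hne : ((√M * (1 - ‖q‖ ^ 2) : ℝ) : ℂ) ≠ 0 := by
    exact_mod_cast (mul_pos (Real.sqrt_pos.mpr hM) hpos).ne'
  rw [qCoord, hη, div_eq_iff hne]
  simp only [saddleLift, Complex.conj_conj]
  ring

lemma wCoord_saddleLift (hM : 0 < M) (q w : ℂ) : wCoord M (saddleLift M q w) = w := by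
  have hsC : ((√M : ℝ) : ℂ) ≠ 0 := by exact_mod_cast (Real.sqrt_pos.mpr hM).ne'
  simp only [wCoord, saddleLift]
  field_simp
  linear_combination (-w) * Complex.I_sq

lemma exists_saddleCoord_eq (hν : 0 < ν) (hM : 0 < M) {ζ : ℂ × ℂ} (hq : ‖qOf ν α M ζ‖ < 1) :
    ∃ z ∈ levelSet M, saddleCoord ν α M z = ζ :=
  ⟨_, saddleLift_mem hM (wOf ν α M ζ) hq,
    saddleCoord_of hν hM (qCoord_saddleLift hM _ hq) (wCoord_saddleLift hM _ _)⟩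

end

namespace IsSaddleCurve

lemma sub {m : ℝ} {l₁ l₂ : ℂ} {x y n₁ n₂ x' y' n₁' n₂' : ℝ → ℂ}
    (h : IsSaddleCurve m l₁ l₂ x y n₁ n₂) (h' : IsSaddleCurve m l₁ l₂ x' y' n₁' n₂') :
    IsSaddleCurve m l₁ l₂ (fun t => x t - x' t) (fun t => y t - y' t) (fun t => n₁ t - n₁' t)
      (fun t => n₂ t - n₂' t) :=
  ⟨h.pos, h.re_le, h.le_re,
    fun t => ((h.deriv_x t).sub (h'.deriv_x t)).congr_deriv (by ring),
    fun t => ((h.deriv_y t).sub (h'.deriv_y t)).congr_deriv (by ring)⟩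

end IsSaddleCurve

namespace IsOrbit
variable {ν α β M : ℝ} {γ δ : ℝ → ℂ × ℂ × ℂ}

lemma continuous_saddleCoord (h : IsOrbit ν α β M γ) (hM : 0 < M) :
    Continuous fun t => saddleCoord ν α M (γ t) :=
  continuous_iff_continuousAt.mpr fun t =>
    (continuousAt_saddleCoord hM (h.mem t)).comp h.continuous.continuousAt

lemma tendsto_saddleCoord (h : IsOrbit ν α β M γ) (hν : 0 < ν) (hM : 0 < M)
    (he : Tendsto (fun t => eta (γ t)) atTop (𝓝 1)) :
    Tendsto (fun t => saddleCoord ν α M (γ t)) atTop (𝓝 0) := by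
  have hw : Tendsto (fun t => wCoord M (γ t)) atTop (𝓝 0) := by
    have := (h.tendsto_b hν hM).const_mul (Complex.I * (√M : ℝ))
    rwa [mul_zero] at this
  have hq : Tendsto (fun t => qCoord M (γ t)) atTop (𝓝 0) := by
    rw [tendsto_zero_iff_norm_tendsto_zero]
    have h1 := (he.const_sub 1).sqrt
    rw [sub_self, Real.sqrt_zero] at h1
    refine h1.congr fun t => ?_
    rw [norm_qCoord hM (h.mem t), eta, sub_sub_cancel, Real.sqrt_sq (norm_nonneg _)]
  have := ((hq.const_mul (unstableEig ν α M)).sub hw).prodMk_nhds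
    (hw.sub (hq.const_mul (stableEig ν α M)))
  rw [mul_zero, mul_zero, sub_zero] at this
  exact this

lemma tendsto_eta_of_saddleCoord (h : IsOrbit ν α β M γ) (hν : 0 < ν) (hM : 0 < M)
    (hc : Tendsto (fun t => saddleCoord ν α M (γ t)) atTop (𝓝 0)) :
    Tendsto (fun t => eta (γ t)) atTop (𝓝 1) := by
  have hq : Tendsto (fun t => qOf ν α M (saddleCoord ν α M (γ t))) atTop (𝓝 (qOf ν α M 0)) :=
    (show Continuous (qOf ν α M) by unfold qOf; fun_prop).continuousAt.tendsto.comp hc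
  have h1 := (hq.norm.pow 2).const_sub 1
  have h2 : (1 : ℝ) - ‖qOf ν α M 0‖ ^ 2 = 1 := by simp [qOf]
  rw [h2] at h1
  refine h1.congr fun t => ?_
  rw [qOf_saddleCoord hν hM, norm_qCoord hM (h.mem t), eta]

/-- The points with `b = p = 0` form an invariant circle. -/
lemma eq_zero_of_eq_zero (h : IsOrbit ν α β M γ) {t : ℝ} (hb : (γ t).1 = 0) (hp : (γ t).2.2 = 0)
    (s : ℝ) : (γ s).1 = 0 ∧ (γ s).2.2 = 0 := by
  set c := (γ t).2.1 with hc
  set k : ℂ := -Complex.I * ((1 - β) * M) with hk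
  have hd : ∀ s : ℝ, HasDerivAt (fun s : ℝ => ((0, Complex.exp (k * s) * c, 0) : ℂ × ℂ × ℂ))
      (vf ν α β M (0, Complex.exp (k * s) * c, 0)) s := by
    intro s
    have h1 : HasDerivAt (fun s : ℝ => Complex.exp (k * s) * c) (Complex.exp (k * s) * k * c) s := by
      have := (((hasDerivAt_id s).ofReal_comp.const_mul k).cexp).mul_const c
      simpa using this
    refine ((hasDerivAt_const s (0 : ℂ)).prodMk
      (h1.prodMk (hasDerivAt_const s (0 : ℂ)))).congr_deriv ?_
    simp [vf, hk]
    ring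
  have e := integralCurve_unique ((contDiff_vf ν α β M).of_le (by simp))
    (h.shift t).deriv hd (t₀ := 0) (by
      simp only [zero_add, Complex.ofReal_zero, mul_zero, Complex.exp_zero, one_mul]
      exact Prod.ext hb (Prod.ext rfl hp))
  have := congrFun e (s - t)
  simp only [sub_add_cancel] at this
  rw [this]
  exact ⟨rfl, rfl⟩

lemma saddleCoord_ne_zero (h : IsOrbit ν α β M γ) (hν : 0 < ν) (hM : 0 < M) {s : ℝ}
    (hs : saddleCoord ν α M (γ s) ≠ 0) (t : ℝ) : saddleCoord ν α M (γ t) ≠ 0 := by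
  intro ht
  rw [saddleCoord_eq_zero_iff hν hM (h.mem t)] at ht
  exact hs ((saddleCoord_eq_zero_iff hν hM (h.mem s)).mpr (h.eq_zero_of_eq_zero ht.1 ht.2 s))

end IsOrbit

/-- The properties of a radius `ε` below which the cubic part of the equations is negligible with
respect to the spectral gap `(σ - ν) / 2`. The last bound on `q` keeps `|p|` away from `1`. -/
structure IsSaddleRadius (ν α β M ε C : ℝ) : Prop where
  pos : 0 < ε
  lipschitz : ∀ ζ ζ' : ℂ × ℂ, ‖ζ‖ ≤ ε → ‖ζ'‖ ≤ ε →
    ‖saddleRem ν α β M ζ - saddleRem ν α β M ζ'‖ ≤ (sigma ν α M - ν) / 2 / 4 * ‖ζ - ζ'‖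
  quadratic : ∀ ζ : ℂ × ℂ, ‖ζ‖ ≤ ε → ‖saddleRem ν α β M ζ‖ ≤ C * ‖ζ‖ ^ 2
  norm_qOf_le : ∀ ζ : ℂ × ℂ, ‖ζ‖ ≤ ε → ‖qOf ν α M ζ‖ ≤ 1 / 2
  zero : saddleRem ν α β M 0 = 0

namespace IsSaddleRadius
variable {ν α β M ε C : ℝ} {γ δ : ℝ → ℂ × ℂ × ℂ}

lemma isSmallAt (hε : IsSaddleRadius ν α β M ε C) {t : ℝ}
    (ht : ‖saddleCoord ν α M (γ t)‖ ≤ ε) :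
    IsSmallAt ((sigma ν α M - ν) / 2) (fun t => (saddleCoord ν α M (γ t)).1)
      (fun t => (saddleCoord ν α M (γ t)).2)
      (fun t => (saddleRem ν α β M (saddleCoord ν α M (γ t))).1)
      (fun t => (saddleRem ν α β M (saddleCoord ν α M (γ t))).2) t := by
  have h := hε.lipschitz _ 0 ht (by simpa using hε.pos.le)
  rw [hε.zero, sub_zero, sub_zero] at h
  exact ⟨(norm_fst_le _).trans h, (norm_snd_le _).trans h⟩

lemma isSmallAt_sub (hε : IsSaddleRadius ν α β M ε C) {t : ℝ}
    (ht : ‖saddleCoord ν α M (γ t)‖ ≤ ε) (ht' : ‖saddleCoord ν α M (δ t)‖ ≤ ε) :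
    IsSmallAt ((sigma ν α M - ν) / 2)
      (fun t => (saddleCoord ν α M (γ t)).1 - (saddleCoord ν α M (δ t)).1)
      (fun t => (saddleCoord ν α M (γ t)).2 - (saddleCoord ν α M (δ t)).2)
      (fun t => (saddleRem ν α β M (saddleCoord ν α M (γ t))).1
        - (saddleRem ν α β M (saddleCoord ν α M (δ t))).1)
      (fun t => (saddleRem ν α β M (saddleCoord ν α M (γ t))).2
        - (saddleRem ν α β M (saddleCoord ν α M (δ t))).2) t := by
  have h := hε.lipschitz _ _ ht ht'
  exact ⟨(norm_fst_le (saddleRem ν α β M _ - saddleRem ν α β M _)).trans h,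
    (norm_snd_le (saddleRem ν α β M _ - saddleRem ν α β M _)).trans h⟩

/-- An orbit which stays in a small neighborhood of the circle stays in the stable cone. -/
lemma norm_snd_le_norm_fst (hε : IsSaddleRadius ν α β M ε C) (hν : 0 < ν) (hM : 0 < M)
    (h : IsOrbit ν α β M γ) (hs : ∀ t, 0 ≤ t → ‖saddleCoord ν α M (γ t)‖ ≤ ε) {t : ℝ}
    (ht : 0 ≤ t) : ‖(saddleCoord ν α M (γ t)).2‖ ≤ ‖(saddleCoord ν α M (γ t)).1‖ :=
  (h.isSaddleCurve hν hM).norm_le_norm (fun τ hτ => hε.isSmallAt (hs τ hτ))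
    (fun τ hτ => (norm_snd_le _).trans (hs τ hτ)) ht

lemma fst_ne_zero (hε : IsSaddleRadius ν α β M ε C) (hν : 0 < ν) (hM : 0 < M)
    (h : IsOrbit ν α β M γ) (hs : ∀ t, 0 ≤ t → ‖saddleCoord ν α M (γ t)‖ ≤ ε)
    (h0 : saddleCoord ν α M (γ 0) ≠ 0) {t : ℝ} (ht : 0 ≤ t) :
    (saddleCoord ν α M (γ t)).1 ≠ 0 := by
  intro hx
  have := hε.norm_snd_le_norm_fst hν hM h hs ht
  rw [hx, norm_zero, norm_le_zero_iff] at this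
  exact h.saddleCoord_ne_zero hν hM h0 t (Prod.ext hx this)

/-- Two orbits which stay in a small neighborhood of the circle and have the same stable coordinate
also have the same unstable coordinate: their difference starts from the unstable cone and is
bounded. -/
lemma eq_of_fst_eq (hε : IsSaddleRadius ν α β M ε C) (hν : 0 < ν) (hM : 0 < M)
    (h : IsOrbit ν α β M γ) (h' : IsOrbit ν α β M δ)
    (hs : ∀ t, 0 ≤ t → ‖saddleCoord ν α M (γ t)‖ ≤ ε)
    (hs' : ∀ t, 0 ≤ t → ‖saddleCoord ν α M (δ t)‖ ≤ ε)
    (e : (saddleCoord ν α M (γ 0)).1 = (saddleCoord ν α M (δ 0)).1) :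
    saddleCoord ν α M (γ 0) = saddleCoord ν α M (δ 0) := by
  have := ((h.isSaddleCurve hν hM).sub (h'.isSaddleCurve hν hM)).eq_zero_of_norm_le (B := ε + ε)
    (fun t ht => hε.isSmallAt_sub (hs t ht) (hs' t ht))
    (fun t ht => (norm_sub_le _ _).trans (add_le_add ((norm_snd_le _).trans (hs t ht))
      ((norm_snd_le _).trans (hs' t ht)))) (by simp [e])
  exact Prod.ext e (sub_eq_zero.mp this.2)

/-- An orbit through a point of the stable axis has to leave the small neighborhood of the circle
backward in time, through the stable cone. -/
lemma exists_exit (hε : IsSaddleRadius ν α β M ε C) (hν : 0 < ν) (hM : 0 < M)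
    (h : IsOrbit ν α β M γ) {r : ℝ} (hr : 0 < r) (hrε : r < ε)
    (h0 : saddleCoord ν α M (γ 0) = ((r : ℂ), 0)) :
    ∃ τ : ℝ, 0 ≤ τ ∧ ‖saddleCoord ν α M (γ (-τ))‖ = ε ∧
      ∀ s ∈ Set.Icc (-τ) 0, ‖saddleCoord ν α M (γ s)‖ ≤ ε ∧
        ‖(saddleCoord ν α M (γ s)).2‖ ≤ ‖(saddleCoord ν α M (γ s)).1‖ := by
  have hsad := h.isSaddleCurve hν hM
  have hm := hsad.pos
  have hcont := (h.continuous_saddleCoord hM).norm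
  have hn0 : ‖saddleCoord ν α M (γ 0)‖ = r := by
    rw [h0, Prod.norm_mk, norm_zero, Complex.norm_real, Real.norm_of_nonneg hr.le,
      max_eq_left hr.le]
  have hcone : ∀ s ≤ 0, (∀ τ ∈ Set.Icc s 0, ‖saddleCoord ν α M (γ τ)‖ ≤ ε) →
      ‖(saddleCoord ν α M (γ s)).2‖ ≤ ‖(saddleCoord ν α M (γ s)).1‖ := by
    intro s hs0 hs
    have h1 := hsad.cone_le hs0 fun τ hτ => hε.isSmallAt (hs τ hτ)
    simp only [h0, norm_zero] at h1
    refine (pow_le_pow_iff_left₀ (norm_nonneg _) (norm_nonneg _) two_ne_zero).mp ?_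
    nlinarith [sq_nonneg ‖(r : ℂ)‖]
  have hex : ∃ s ≤ 0, ε ≤ ‖saddleCoord ν α M (γ s)‖ := by
    by_contra! hno
    have hle : ∀ s ≤ 0, r ^ 2 ≤ ε ^ 2 * exp (-((sigma ν α M - ν) / 2) * (0 - s)) := by
      intro s hs0
      have h1 := hsad.normSq_le_mul_exp hs0 (fun τ hτ => hε.isSmallAt (hno τ hτ.2).le)
        (fun τ hτ => hcone τ hτ.2 fun ρ hρ => (hno ρ hρ.2).le)
      simp only [h0, Complex.norm_real, Real.norm_eq_abs, sq_abs] at h1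
      refine h1.trans (mul_le_mul_of_nonneg_right ?_ (exp_pos _).le)
      have := (norm_fst_le _).trans (hno s hs0).le
      gcongr
    have hlim : Tendsto (fun s : ℝ => ε ^ 2 * exp (-((sigma ν α M - ν) / 2) * (0 - s))) atBot
        (𝓝 (ε ^ 2 * 0)) := by
      refine (tendsto_exp_atBot.comp ?_).const_mul _
      have := tendsto_id.const_mul_atBot hm
      refine this.congr fun s => ?_
      simp
    rw [mul_zero] at hlim
    have := ge_of_tendsto hlim ((eventually_le_atBot 0).mono hle)
    have : 0 < r ^ 2 := by positivity
    linarith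
  obtain ⟨s₀, hs₀, hs₀ε⟩ := hex
  have hivt : ∀ s ≤ 0, ε ≤ ‖saddleCoord ν α M (γ s)‖ →
      ∃ τ ∈ Set.Icc s 0, ‖saddleCoord ν α M (γ τ)‖ = ε := fun s hs0 hs =>
    intermediate_value_Icc' hs0 hcont.continuousOn ⟨by rw [hn0]; exact hrε.le, hs⟩
  have hK : IsCompact (Set.Icc s₀ 0 ∩ {s | ‖saddleCoord ν α M (γ s)‖ = ε}) :=
    isCompact_Icc.inter_right (isClosed_eq hcont continuous_const)
  obtain ⟨t₁, ht₁, ht₁ε⟩ := hivt s₀ hs₀ hs₀ε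
  obtain ⟨τ, ⟨hτ, hτε⟩, hmax⟩ := hK.exists_isGreatest ⟨t₁, ht₁, ht₁ε⟩
  have hin : ∀ s ∈ Set.Icc τ 0, ‖saddleCoord ν α M (γ s)‖ ≤ ε := by
    intro s hs
    rcases eq_or_lt_of_le hs.1 with e | hlt
    · rw [← e]; exact le_of_eq hτε
    · by_contra! hgt
      obtain ⟨s', hs', hs'ε⟩ := hivt s hs.2 hgt.le
      have := hmax ⟨⟨hτ.1.trans (hs.1.trans hs'.1), hs'.2⟩, hs'ε⟩
      linarith [hs'.1]
  refine ⟨-τ, by linarith [hτ.2], by rw [neg_neg]; exact hτε, fun s hs => ?_⟩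
  rw [neg_neg] at hs
  exact ⟨hin s hs, hcone s hs.2 fun ρ hρ => hin ρ ⟨hs.1.trans hρ.1, hρ.2⟩⟩

end IsSaddleRadius

end
end DampedSzego
namespace DampedSzego
noncomputable section

/-! ### Existence and uniqueness of the stable orbit -/

lemma exists_saddleRadius {ν M : ℝ} (α β : ℝ) (hν : 0 < ν) (hM : 0 < M) :
    ∃ ε C, IsSaddleRadius ν α β M ε C := by
  obtain ⟨ε, C, h1, h2, h3, h4, h5⟩ := exists_small_saddleRem α β hν hM
  exact ⟨ε, C, h1, h2, h3, h4, h5⟩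

/-- An orbit which converges to the circle without belonging to it: on `𝓔_M`, the circle is given by
`1 - |p|² = 1`, `b = 0`, that is, by the vanishing of the saddle coordinates. -/
structure IsStableOrbit (ν α β M : ℝ) (γ : ℝ → ℂ × ℂ × ℂ) : Prop where
  isOrbit : IsOrbit ν α β M γ
  tendsto_eta : Tendsto (fun t => eta (γ t)) atTop (𝓝 1)
  ne_zero : ∀ t, saddleCoord ν α M (γ t) ≠ 0

namespace IsStableOrbit
variable {ν α β M ε C : ℝ} {γ δ : ℝ → ℂ × ℂ × ℂ}

lemma eventually_small (h : IsStableOrbit ν α β M γ) (hν : 0 < ν) (hM : 0 < M)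
    (hε : 0 < ε) : ∃ T, ∀ t, T ≤ t → ‖saddleCoord ν α M (γ t)‖ ≤ ε := by
  have h1 := (h.isOrbit.tendsto_saddleCoord hν hM h.tendsto_eta).norm
  rw [norm_zero] at h1
  exact eventually_atTop.mp ((h1.eventually (gt_mem_nhds hε)).mono fun t ht => ht.le)

lemma exists_norm_fst_eq (h : IsStableOrbit ν α β M γ) (hν : 0 < ν) (hM : 0 < M) {T r : ℝ}
    (hr : 0 < r) (hT : r ≤ ‖(saddleCoord ν α M (γ T)).1‖) :
    ∃ t, T ≤ t ∧ ‖(saddleCoord ν α M (γ t)).1‖ = r := by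
  have hc : Continuous fun t => ‖(saddleCoord ν α M (γ t)).1‖ :=
    (h.isOrbit.continuous_saddleCoord hM).fst.norm
  have hlim : Tendsto (fun t => ‖(saddleCoord ν α M (γ t)).1‖) atTop (𝓝 0) := by
    have := ((continuous_fst.tendsto _).comp
      (h.isOrbit.tendsto_saddleCoord hν hM h.tendsto_eta)).norm
    simpa using this
  obtain ⟨T', h1, h2⟩ := ((hlim.eventually (gt_mem_nhds hr)).and (eventually_ge_atTop T)).exists
  obtain ⟨t, ht, e⟩ := intermediate_value_Icc' h2 hc.continuousOn ⟨h1.le, hT⟩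
  exact ⟨t, ht.1, e⟩

lemma rot (h : IsStableOrbit ν α β M γ) {a d : ℂ} (ha : ‖a‖ = 1) (hd : ‖d‖ = 1) :
    IsStableOrbit ν α β M fun t => rot a d (γ t) := by
  refine ⟨h.isOrbit.rot ha hd, by simpa only [eta_rot hd] using h.tendsto_eta, fun t => ?_⟩
  rw [saddleCoord_rot hd]
  exact smul_ne_zero (by rintro rfl; simp at ha) (h.ne_zero t)

lemma shift (h : IsStableOrbit ν α β M γ) (a : ℝ) : IsStableOrbit ν α β M fun t => γ (t + a) :=
  ⟨h.isOrbit.shift a, h.tendsto_eta.comp (tendsto_id.atTop_add tendsto_const_nhds),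
    fun t => h.ne_zero (t + a)⟩

/-- Up to the symmetries and to time translations, there is at most one orbit which converges to
the circle. -/
lemma exists_eq_rot (h : IsStableOrbit ν α β M γ) (h' : IsStableOrbit ν α β M δ) (hν : 0 < ν)
    (hM : 0 < M) :
    ∃ (a d : ℂ) (τ : ℝ), ‖a‖ = 1 ∧ ‖d‖ = 1 ∧ ∀ t, δ t = DampedSzego.rot a d (γ (t + τ)) := by
  obtain ⟨ε, C, hε⟩ := exists_saddleRadius α β hν hM
  obtain ⟨T₁, hT₁⟩ := h.eventually_small hν hM hε.pos
  obtain ⟨T₂, hT₂⟩ := h'.eventually_small hν hM hε.pos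
  have hx : (saddleCoord ν α M (γ T₁)).1 ≠ 0 := by
    have := hε.fst_ne_zero hν hM (h.isOrbit.shift T₁) (fun t ht => hT₁ _ (by linarith))
      (h.ne_zero _) le_rfl
    simpa using this
  have hx' : (saddleCoord ν α M (δ T₂)).1 ≠ 0 := by
    have := hε.fst_ne_zero hν hM (h'.isOrbit.shift T₂) (fun t ht => hT₂ _ (by linarith))
      (h'.ne_zero _) le_rfl
    simpa using this
  -- a time shift equates the moduli of the stable coordinates, and a rotation their arguments
  set r := min ‖(saddleCoord ν α M (γ T₁)).1‖ ‖(saddleCoord ν α M (δ T₂)).1‖ with hr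
  have hr0 : 0 < r := lt_min (norm_pos_iff.mpr hx) (norm_pos_iff.mpr hx')
  obtain ⟨t₁, ht₁, e₁⟩ := h.exists_norm_fst_eq hν hM hr0 (min_le_left _ _)
  obtain ⟨t₂, ht₂, e₂⟩ := h'.exists_norm_fst_eq hν hM hr0 (min_le_right _ _)
  set a := (saddleCoord ν α M (δ t₂)).1 / (saddleCoord ν α M (γ t₁)).1 with ha
  have hne : (saddleCoord ν α M (γ t₁)).1 ≠ 0 := norm_pos_iff.mp (e₁ ▸ hr0)
  have ha1 : ‖a‖ = 1 := by rw [ha, norm_div, e₁, e₂, div_self hr0.ne']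
  have key := hε.eq_of_fst_eq hν hM ((h.isOrbit.shift t₁).rot ha1 norm_one)
    (h'.isOrbit.shift t₂) (fun t ht => by
      rw [saddleCoord_rot norm_one, norm_smul, ha1, one_mul]
      exact hT₁ _ (by linarith)) (fun t ht => hT₂ _ (by linarith)) (by
      rw [saddleCoord_rot norm_one]
      simp only [zero_add, Prod.smul_fst, smul_eq_mul]
      rw [ha, div_mul_cancel₀ _ hne])
  simp only [zero_add] at key
  obtain ⟨d, hd, e⟩ := exists_rot_of_saddleCoord_eq hν hM
    (rot_mem_levelSet ha1 norm_one (h.isOrbit.mem t₁)) (h'.isOrbit.mem t₂) key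
  rw [rot_rot, one_mul, mul_one] at e
  refine ⟨a, d, t₁ - t₂, ha1, hd, fun t => ?_⟩
  have := h'.isOrbit.unique ((h.isOrbit.shift (t₁ - t₂)).rot ha1 hd) (t := t₂) (by
    rw [e, show t₂ + (t₁ - t₂) = t₁ by ring])
  exact congrFun this t

end IsStableOrbit

/-- There is an orbit which converges to the circle: it is a limit of orbits through points of the
stable axis which tend to the origin, when they are followed backward until they leave a fixed
neighborhood of the circle. -/
lemma exists_isStableOrbit {ν M : ℝ} (α β : ℝ) (hν : 0 < ν) (hM : 0 < M) :
    ∃ γ, IsStableOrbit ν α β M γ := by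
  obtain ⟨ε, C, hε⟩ := exists_saddleRadius α β hν hM
  have hε0 := hε.pos
  have hs : 0 < √M := Real.sqrt_pos.mpr hM
  set m := (sigma ν α M - ν) / 2 with hm
  have hm0 : 0 < m := by linarith [(sigma_spec α hν hM).1]
  set r : ℕ → ℝ := fun n => ε / (n + 2) with hr
  have hr0 : ∀ n, 0 < r n := fun n => by positivity
  have hrε : ∀ n, r n < ε := fun n => div_lt_self hε0 (by linarith [(Nat.cast_nonneg n : (0:ℝ) ≤ n)])
  have hnorm : ∀ n, ‖((r n : ℂ), (0 : ℂ))‖ ≤ ε := fun n => by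
    rw [Prod.norm_mk, norm_zero, Complex.norm_real, Real.norm_of_nonneg (hr0 n).le,
      max_eq_left (hr0 n).le]
    exact (hrε n).le
  have hstart : ∀ n, ∃ z ∈ levelSet M, saddleCoord ν α M z = ((r n : ℂ), 0) := fun n =>
    exists_saddleCoord_eq hν hM ((hε.norm_qOf_le _ (hnorm n)).trans_lt (by norm_num))
  choose z hz hzc using hstart
  have horb : ∀ n, ∃ γ, IsOrbit ν α β M γ ∧ γ 0 = z n := fun n => exists_orbit α β hν hM (hz n)
  choose γ hγ hγ0 using horb
  have hexit := fun n => hε.exists_exit hν hM (hγ n) (hr0 n) (hrε n) (by rw [hγ0, hzc])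
  choose τ hτ0 hτε hτ using hexit
  -- the exit times tend to infinity
  have hτlim : ∀ T, ∀ᶠ n in atTop, T ≤ τ n := by
    intro T
    have hrlim : Tendsto (fun n => r n ^ 2) atTop (𝓝 0) := by
      have h1 : Tendsto (fun n : ℕ => ((n : ℝ) + 2)) atTop atTop :=
        tendsto_natCast_atTop_atTop.atTop_add tendsto_const_nhds
      have := ((tendsto_const_nhds (x := ε)).div_atTop h1).pow 2
      simpa using this
    have hev := hrlim.eventually (gt_mem_nhds
      (show 0 < ε ^ 2 * exp ((2 * (stableEig ν α M).re - m) * T) by positivity))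
    filter_upwards [hev] with n hn
    by_contra! hlt
    have h1 := ((hγ n).isSaddleCurve hν hM).normSq_mul_exp_le (a := -τ n) (b := 0)
      (by linarith [hτ0 n]) (fun s hs => hε.isSmallAt (hτ n s hs).1) (fun s hs => (hτ n s hs).2)
    have h2 : ‖(saddleCoord ν α M (γ n (-τ n))).1‖ = ε := by
      rw [← hτε n, Prod.norm_def, max_eq_left (hτ n (-τ n) ⟨le_rfl, by linarith [hτ0 n]⟩).2]
    simp only [h2, hγ0, hzc, Complex.norm_real, Real.norm_eq_abs, sq_abs] at h1
    have hneg : 2 * (stableEig ν α M).re - m < 0 := by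
      rw [stableEig_re]; linarith [(sigma_spec α hν hM).1]
    have h3 : exp ((2 * (stableEig ν α M).re - m) * T) ≤
        exp ((2 * (stableEig ν α M).re - m) * (0 - -τ n)) := by
      rw [exp_le_exp]
      nlinarith
    have h4 := mul_le_mul_of_nonneg_left h3 (sq_nonneg ε)
    linarith
  -- the exit points belong to a compact set
  set R : ℝ := (‖stableEig ν α M‖ + ‖unstableEig ν α M‖) * ε / ‖saddleGap ν α M‖ with hR
  set K : Set (ℂ × ℂ × ℂ) := {z | ‖z.2.2‖ ≤ 1 / 2 ∧ ‖z.2.1‖ ^ 2 = M * (1 - ‖z.2.2‖ ^ 2) ^ 2} ∩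
    Metric.closedBall 0 ((R / √M) ^ 2 + 1 + √M) with hK
  have hKc : IsCompact K := by
    refine (isCompact_closedBall _ _).inter_left ?_
    have h1 : Continuous fun z : ℂ × ℂ × ℂ => ‖z.2.2‖ := by fun_prop
    have h2 : Continuous fun z : ℂ × ℂ × ℂ => ‖z.2.1‖ ^ 2 := by fun_prop
    have h3 : Continuous fun z : ℂ × ℂ × ℂ => M * (1 - ‖z.2.2‖ ^ 2) ^ 2 := by fun_prop
    exact (isClosed_le h1 continuous_const).inter (isClosed_eq h2 h3)
  have hKl : K ⊆ levelSet M := fun z hz => ⟨hz.1.1.trans_lt (by norm_num), hz.1.2⟩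
  have hmemK : ∀ n, γ n (-τ n) ∈ K := by
    intro n
    have hmem := (hγ n).mem (-τ n)
    have hle : ‖saddleCoord ν α M (γ n (-τ n))‖ ≤ ε := (hτε n).le
    have hp : ‖(γ n (-τ n)).2.2‖ ≤ 1 / 2 := by
      rw [← norm_qCoord hM hmem, ← qOf_saddleCoord (α := α) hν hM]
      exact hε.norm_qOf_le _ hle
    refine ⟨⟨hp, hmem.2⟩, ?_⟩
    rw [mem_closedBall_zero_iff]
    have hb : ‖(γ n (-τ n)).1‖ ≤ R / √M := by
      rw [le_div_iff₀ hs, mul_comm, ← norm_wCoord, ← wOf_saddleCoord (α := α) hν hM, wOf,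
        norm_div, hR]
      gcongr
      refine (norm_add_le _ _).trans ?_
      rw [norm_mul, norm_mul, add_mul]
      gcongr
      · exact (norm_fst_le _).trans hle
      · exact (norm_snd_le _).trans hle
    refine norm_le_of_mem hmem ?_
    gcongr
  obtain ⟨zl, hzl, φ, hφ, hlim⟩ := hKc.tendsto_subseq hmemK
  obtain ⟨h, hh, hh0⟩ := exists_orbit α β hν hM (hKl hzl)
  have hconv : ∀ T, 0 ≤ T → Tendsto (fun k => ‖saddleCoord ν α M (γ (φ k) (T + -τ (φ k)))‖) atTop
      (𝓝 ‖saddleCoord ν α M (h T)‖) := by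
    intro T hT
    have h1 := IsOrbit.tendsto_of_tendsto hν hM (fun k => (hγ (φ k)).shift (-τ (φ k))) hh
      (by simpa [hh0, Function.comp_def] using hlim) hT
    exact ((continuousAt_saddleCoord hM (hh.mem T)).tendsto.comp h1).norm
  have hbound : ∀ T, 0 ≤ T → ‖saddleCoord ν α M (h T)‖ ≤ ε * exp (-(m / 2 * T)) := by
    intro T hT
    refine le_of_tendsto (hconv T hT) ?_
    filter_upwards [hφ.tendsto_atTop.eventually (hτlim T)] with k hk
    have hsub : ∀ s ∈ Set.Icc (-τ (φ k)) (T + -τ (φ k)), s ∈ Set.Icc (-τ (φ k)) 0 :=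
      fun s hs => ⟨hs.1, hs.2.trans (by linarith)⟩
    have h1 := ((hγ (φ k)).isSaddleCurve hν hM).normSq_le_mul_exp (a := -τ (φ k))
      (b := T + -τ (φ k)) (by linarith) (fun s hs => hε.isSmallAt (hτ _ s (hsub s hs)).1)
      (fun s hs => (hτ _ s (hsub s hs)).2)
    have h2 := (hτ (φ k) (T + -τ (φ k)) (hsub _ ⟨by linarith, le_rfl⟩)).2
    rw [Prod.norm_def, max_eq_left h2]
    have h3 : ‖(saddleCoord ν α M (γ (φ k) (-τ (φ k)))).1‖ ≤ ε := by
      rw [← hτε (φ k)]; exact norm_fst_le _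
    have h4 : ‖(saddleCoord ν α M (γ (φ k) (T + -τ (φ k)))).1‖ ^ 2 ≤
        (ε * exp (-(m / 2 * T))) ^ 2 := by
      refine h1.trans ?_
      rw [mul_pow, ← exp_nat_mul]
      have e : -m * (T + -τ (φ k) - -τ (φ k)) = ((2 : ℕ) : ℝ) * -(m / 2 * T) := by
        push_cast; ring
      rw [← e]
      gcongr
    exact (pow_le_pow_iff_left₀ (norm_nonneg _) (by positivity) two_ne_zero).mp h4
  have hne : saddleCoord ν α M (h 0) ≠ 0 := by
    have h1 := hconv 0 le_rfl
    simp only [zero_add, hτε] at h1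
    have h2 := tendsto_nhds_unique h1 tendsto_const_nhds
    rw [← norm_pos_iff, h2]
    exact hε0
  refine ⟨h, hh, hh.tendsto_eta_of_saddleCoord hν hM ?_, fun t => hh.saddleCoord_ne_zero hν hM hne t⟩
  have he : Tendsto (fun T : ℝ => ε * exp (-(m / 2 * T))) atTop (𝓝 0) := by
    have := (tendsto_exp_neg_atTop_nhds_zero.comp
      (tendsto_id.const_mul_atTop (half_pos hm0))).const_mul ε
    rwa [mul_zero] at this
  refine squeeze_zero_norm' ?_ he
  filter_upwards [eventually_ge_atTop 0] with T hT using hbound T hT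

end
end DampedSzego
namespace DampedSzego
noncomputable section

/-! ### The rate of convergence to the circle -/

lemma tendsto_weightSum_zero {s : ℝ} (hs : 0 ≤ s) (j : ℕ) {ι : Type*} {l : Filter ι} {r : ι → ℝ}
    (hr0 : ∀ i, 0 ≤ r i) (hr : Tendsto r l (𝓝 0)) :
    Tendsto (fun i => weightSum s j (r i)) l (𝓝 ((1 + (j : ℝ) ^ 2) ^ s)) := by
  have hval : ∑' k : ℕ, (1 + ((k : ℝ) + j) ^ 2) ^ s * (0 : ℝ) ^ k = (1 + (j : ℝ) ^ 2) ^ s := by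
    rw [tsum_eq_single 0 fun k hk => by rw [zero_pow hk, mul_zero]]
    simp
  rw [← hval]
  refine tendsto_tsum_of_dominated_convergence
    (summable_weight hs j (r := 1 / 2) (by norm_num) (by norm_num)) (fun k => ?_) ?_
  · exact (hr.pow k).const_mul _
  · filter_upwards [hr.eventually (ge_mem_nhds (show (0 : ℝ) < 1 / 2 by norm_num))] with i hi k
    rw [Real.norm_of_nonneg (mul_nonneg (by positivity) (pow_nonneg (hr0 i) k))]
    have := hr0 i
    gcongr

namespace IsStableOrbit
variable {ν α β M : ℝ} {γ : ℝ → ℂ × ℂ × ℂ}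

/-- The stable coordinate has an exact exponential rate, and the unstable one is negligible. -/
lemma exists_rate (h : IsStableOrbit ν α β M γ) (hν : 0 < ν) (hM : 0 < M) :
    (∃ L : ℝ, 0 < L ∧ Tendsto (fun t => ‖(saddleCoord ν α M (γ t)).1‖ ^ 2 *
      exp ((ν + sigma ν α M) * t)) atTop (𝓝 L)) ∧
    Tendsto (fun t => (saddleCoord ν α M (γ t)).2 / (saddleCoord ν α M (γ t)).1) atTop (𝓝 0) := by
  obtain ⟨ε, C, hε⟩ := exists_saddleRadius α β hν hM
  obtain ⟨T, hT⟩ := h.eventually_small hν hM hε.pos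
  have h' := h.shift T
  have hs : ∀ t, 0 ≤ t → ‖saddleCoord ν α M (γ (t + T))‖ ≤ ε := fun t ht => hT _ (by linarith)
  have hc := fun t ht => hε.norm_snd_le_norm_fst hν hM h'.isOrbit hs (t := t) ht
  obtain ⟨⟨L, hL, h1⟩, h2⟩ := (h'.isOrbit.isSaddleCurve hν hM).exists_rate (C := C)
    (fun t ht => hε.isSmallAt (hs t ht)) hc
    (fun t ht => hε.fst_ne_zero hν hM h'.isOrbit hs (h'.ne_zero 0) ht) (fun t ht => by
      have h3 := hε.quadratic _ (hs t ht)
      have h4 : ‖saddleCoord ν α M (γ (t + T))‖ = ‖(saddleCoord ν α M (γ (t + T))).1‖ := by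
        rw [Prod.norm_def, max_eq_left (hc t ht)]
      rw [h4] at h3
      exact ⟨(norm_fst_le _).trans h3, (norm_snd_le _).trans h3⟩)
  have hback : Tendsto (fun t : ℝ => t + -T) atTop atTop :=
    tendsto_id.atTop_add tendsto_const_nhds
  constructor
  · refine ⟨L * exp ((ν + sigma ν α M) * T), by positivity, ?_⟩
    refine ((h1.comp hback).mul_const _).congr fun t => ?_
    simp only [Function.comp_apply, neg_add_cancel_right, mul_assoc, ← exp_add]
    rw [stableEig_re]
    congr 2
    ring
  · rw [tendsto_zero_iff_norm_tendsto_zero]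
    have h3 := (h2.comp hback).sqrt
    rw [Real.sqrt_zero] at h3
    refine h3.congr fun t => ?_
    simp only [Function.comp_apply, neg_add_cancel_right]
    rw [← div_pow, Real.sqrt_sq (by positivity), norm_div]

/-- The squared distance to the circle decays like the square of the stable linear mode. -/
lemma exists_tendsto_distSq (h : IsStableOrbit ν α β M γ) (hν : 0 < ν) (hM : 0 < M) {s : ℝ}
    (hs : 0 ≤ s) : ∃ L : ℝ, 0 < L ∧
      Tendsto (fun t => distSq s M (γ t) * exp ((ν + sigma ν α M) * t)) atTop (𝓝 L) := by
  obtain ⟨⟨L, hL, h1⟩, h2⟩ := h.exists_rate hν hM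
  have hsM : 0 < √M := Real.sqrt_pos.mpr hM
  have hΔ := saddleGap_ne_zero α hν hM
  have hΔ' : 0 < ‖saddleGap ν α M‖ := norm_pos_iff.mpr hΔ
  have hp : Tendsto (fun t => ‖(γ t).2.2‖ ^ 2) atTop (𝓝 0) := by
    have := h.tendsto_eta.const_sub 1
    simpa [eta] using this
  -- away from the zeros of the stable coordinate, everything is expressed by the quotient
  have hne : ∀ᶠ t in atTop, (saddleCoord ν α M (γ t)).1 ≠ 0 := by
    filter_upwards [h1.eventually (lt_mem_nhds hL)] with t ht h0
    rw [h0] at ht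
    simp at ht
  set v : ℝ → ℂ := fun t => (saddleCoord ν α M (γ t)).2 / (saddleCoord ν α M (γ t)).1 with hv
  have hq : Tendsto (fun t => ‖1 + v t‖ ^ 2 / ‖saddleGap ν α M‖ ^ 2) atTop
      (𝓝 (1 / ‖saddleGap ν α M‖ ^ 2)) := by
    have := ((h2.const_add 1).norm.pow 2).div_const (‖saddleGap ν α M‖ ^ 2)
    simpa using this
  have hw : Tendsto (fun t => ‖stableEig ν α M + unstableEig ν α M * v t‖ ^ 2 /
      ‖saddleGap ν α M‖ ^ 2 / M) atTop (𝓝 (‖stableEig ν α M‖ ^ 2 / ‖saddleGap ν α M‖ ^ 2 / M)) := by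
    have := ((((h2.const_mul (unstableEig ν α M)).const_add (stableEig ν α M)).norm.pow 2).div_const
      (‖saddleGap ν α M‖ ^ 2)).div_const M
    simpa using this
  have hc : Tendsto (fun t => ‖(γ t).2.1‖ ^ 2) atTop (𝓝 M) := by
    have := ((hp.const_sub 1).pow 2).const_mul M
    rw [sub_zero, one_pow, mul_one] at this
    exact this.congr fun t => ((h.isOrbit.mem t).2).symm
  have hW := tendsto_weightSum_zero hs 2 (fun t => sq_nonneg ‖(γ t).2.2‖) hp
  have hlim := h1.mul ((hw.add ((hq.mul hp).const_mul ((2 : ℝ) ^ s * M))).add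
    (hc.mul (hq.mul hW)))
  refine ⟨_, ?_, hlim.congr' ?_⟩
  · rw [mul_zero, mul_zero, add_zero]
    positivity
  · filter_upwards [hne] with t ht
    have hx : 0 < ‖(saddleCoord ν α M (γ t)).1‖ := norm_pos_iff.mpr ht
    have eq : ‖(γ t).2.2‖ ^ 2 = ‖(saddleCoord ν α M (γ t)).1‖ ^ 2 *
        (‖1 + v t‖ ^ 2 / ‖saddleGap ν α M‖ ^ 2) := by
      rw [← norm_qCoord hM (h.isOrbit.mem t), ← qOf_saddleCoord (α := α) hν hM, qOf, ← div_pow,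
        ← mul_pow, ← norm_div, ← norm_mul]
      congr 2
      rw [hv]; field_simp
    have ew : ‖(γ t).1‖ ^ 2 = ‖(saddleCoord ν α M (γ t)).1‖ ^ 2 *
        (‖stableEig ν α M + unstableEig ν α M * v t‖ ^ 2 / ‖saddleGap ν α M‖ ^ 2 / M) := by
      have e1 : ‖wCoord M (γ t)‖ ^ 2 = ‖(saddleCoord ν α M (γ t)).1‖ ^ 2 *
          (‖stableEig ν α M + unstableEig ν α M * v t‖ ^ 2 / ‖saddleGap ν α M‖ ^ 2) := by
        rw [← wOf_saddleCoord (α := α) hν hM, wOf, ← div_pow, ← mul_pow, ← norm_div, ← norm_mul]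
        congr 2
        rw [hv]; field_simp
      rw [norm_wCoord, mul_pow, Real.sq_sqrt hM.le] at e1
      rw [← mul_div_assoc, ← e1]
      field_simp
    have ec : (‖(γ t).2.1‖ - √M) ^ 2 = M * (‖(γ t).2.2‖ ^ 2) ^ 2 := by
      rw [norm_c_of_mem (h.isOrbit.mem t), eta]
      linear_combination (‖(γ t).2.2‖ ^ 4) * Real.sq_sqrt hM.le
    rw [distSq, ec, ew]
    linear_combination (-(2 ^ s * M * ‖(γ t).2.2‖ ^ 2 * exp ((ν + sigma ν α M) * t))
      - ‖(γ t).2.1‖ ^ 2 * weightSum s 2 (‖(γ t).2.2‖ ^ 2) * exp ((ν + sigma ν α M) * t)) * eq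

lemma hsDist_isEquivalent (h : IsStableOrbit ν α β M γ) (hν : 0 < ν) (hM : 0 < M) {s : ℝ}
    (hs : 0 ≤ s) : ∃ K : ℝ, 0 < K ∧
      (fun t : ℝ => hsDist s (rankOne (γ t)) (circleSet M)) ~[atTop]
        fun t : ℝ => K * exp (-((ν + sigma ν α M) / 2) * t) := by
  obtain ⟨L, hL, h1⟩ := h.exists_tendsto_distSq hν hM hs
  have hK : 0 < √L := Real.sqrt_pos.mpr hL
  refine ⟨√L, hK, (isEquivalent_iff_tendsto_one
    (Eventually.of_forall fun t => by positivity)).mpr ?_⟩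
  have h2 := h1.sqrt.div_const √L
  rw [div_self hK.ne'] at h2
  refine h2.congr fun t => ?_
  have e : exp ((ν + sigma ν α M) * t) = (exp (-((ν + sigma ν α M) / 2) * t))⁻¹ ^ 2 := by
    rw [← exp_neg, ← exp_nat_mul]
    congr 1
    push_cast; ring
  rw [Pi.div_apply, hsDist_circle hs hM.le (levelSet_subset hM (h.isOrbit.mem t)), e,
    Real.sqrt_mul' _ (by positivity), Real.sqrt_sq (by positivity)]
  field_simp

end IsStableOrbit

end
end DampedSzego
namespace DampedSzego
noncomputable section

/-! ### Parametrized submanifolds -/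

/-- A set which, near each of its points, is the homeomorphic image of a neighborhood of the origin
under a smooth immersion, is a submanifold: if `P` is a left inverse of the derivative `A` of the
immersion `G` at the origin, then `y ↦ G (P y) + (y - A (P y))` is a local diffeomorphism which
maps the range of `A` to the set. -/
lemma isSmoothSubmanifold_of_immersion {E X : Type*} [NormedAddCommGroup E] [NormedSpace ℝ E]
    [FiniteDimensional ℝ E] [NormedAddCommGroup X] [NormedSpace ℝ X] [FiniteDimensional ℝ X]
    {N : Set E} (h : ∀ x ∈ N, ∃ (G : X → E) (A : X →L[ℝ] E), ContDiff ℝ ∞ G ∧ G 0 = x ∧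
      (∀ ξ, G ξ ∈ N) ∧ HasFDerivAt G A 0 ∧ (∀ ξ, A ξ = 0 → ξ = 0) ∧
      ∀ U ∈ 𝓝 (0 : X), ∀ᶠ y in 𝓝[N] x, y ∈ G '' U) :
    IsSmoothSubmanifold (Module.finrank ℝ X) N := by
  intro x hx
  obtain ⟨G, A, hG, hG0, hGN, hA, hinj, hprop⟩ := h x hx
  have hker : LinearMap.ker (A : X →ₗ[ℝ] E) = ⊥ := LinearMap.ker_eq_bot'.mpr hinj
  obtain ⟨P₀, hP₀⟩ := LinearMap.exists_leftInverse_of_injective (A : X →ₗ[ℝ] E) hker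
  set P : E →L[ℝ] X := P₀.toContinuousLinearMap with hPdef
  have hPA : ∀ ξ, P (A ξ) = ξ := fun ξ => LinearMap.congr_fun hP₀ ξ
  have hcE : CompleteSpace E := FiniteDimensional.complete ℝ E
  set Ψ : E → E := fun y => G (P y) + (y - A (P y)) with hΨ
  have hΨc : ContDiff ℝ ∞ Ψ := by
    have h1 := hG.comp P.contDiff
    have h2 := (A.comp P).contDiff (n := ∞)
    exact h1.add (contDiff_id.sub h2)
  have hΨd : HasFDerivAt Ψ ((ContinuousLinearEquiv.refl ℝ E : E ≃L[ℝ] E) : E →L[ℝ] E) 0 := by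
    have h1 : HasFDerivAt (fun y => G (P y)) (A.comp P) 0 := by
      refine HasFDerivAt.comp (0 : E) ?_ P.hasFDerivAt
      rw [map_zero]; exact hA
    refine (h1.add ((hasFDerivAt_id (0 : E)).sub (A.comp P).hasFDerivAt)).congr_fderiv ?_
    ext y
    simp
  have hΨA : ∀ ξ, Ψ (A ξ) = G ξ := fun ξ => by simp [hΨ, hPA]
  have hΨ0 : Ψ 0 = x := by rw [← map_zero A, hΨA, hG0]
  -- the points where the derivative is invertible
  set S : Set E := {y | fderiv ℝ Ψ y ∈ Set.range ((↑) : (E ≃L[ℝ] E) → E →L[ℝ] E)} with hS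
  have hSo : IsOpen S :=
    ContinuousLinearEquiv.isOpen.preimage (hΨc.continuous_fderiv (by simp))
  have hS0 : (0 : E) ∈ S := ⟨ContinuousLinearEquiv.refl ℝ E, hΨd.fderiv.symm⟩
  set e₀ := (hΨc.contDiffAt.toOpenPartialHomeomorph Ψ hΨd (by simp)).restrOpen S hSo with he₀
  have he₀c : ∀ y, e₀ y = Ψ y := fun y => rfl
  have h0 : (0 : E) ∈ e₀.source := by
    rw [he₀, OpenPartialHomeomorph.restrOpen_source]
    exact ⟨ContDiffAt.mem_toOpenPartialHomeomorph_source _ hΨd (by simp), hS0⟩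
  set U : Set X := A ⁻¹' e₀.source with hU
  have hUn : U ∈ 𝓝 (0 : X) := (e₀.open_source.preimage A.continuous).mem_nhds (by
    rw [Set.mem_preimage, map_zero]; exact h0)
  obtain ⟨V, hVx, hVo, hV⟩ : ∃ V, x ∈ V ∧ IsOpen V ∧ ∀ y ∈ V, y ∈ N → y ∈ G '' U := by
    have h1 := eventually_nhdsWithin_iff.mp (hprop U hUn)
    obtain ⟨V, h2, h3, h4⟩ := eventually_nhds_iff.mp h1
    exact ⟨V, h4, h3, h2⟩
  set e := e₀.restrOpen (Ψ ⁻¹' V) (hVo.preimage hΨc.continuous) with he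
  have hec : ∀ y, e y = Ψ y := fun y => rfl
  have hes : e.source = e₀.source ∩ Ψ ⁻¹' V := OpenPartialHomeomorph.restrOpen_source _ _ _
  have h0e : (0 : E) ∈ e.source := by
    rw [hes]; exact ⟨h0, by rw [Set.mem_preimage, hΨ0]; exact hVx⟩
  refine ⟨LinearMap.range (A : X →ₗ[ℝ] E), e.symm,
    LinearMap.finrank_range_of_inj (LinearMap.ker_eq_bot.mp hker), ?_, ?_, ?_, ?_⟩
  · rw [OpenPartialHomeomorph.symm_source, ← hΨ0]
    exact e.map_source h0e
  · intro y hy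
    rw [OpenPartialHomeomorph.symm_source] at hy
    have h1 : e.symm y ∈ S := by
      have := e.map_target hy
      rw [hes, he₀, OpenPartialHomeomorph.restrOpen_source] at this
      exact this.1.2
    obtain ⟨f, hf⟩ := h1
    refine (e.contDiffAt_symm hy (f₀' := f) ?_ hΨc.contDiffAt).contDiffWithinAt
    rw [hf]
    exact (hΨc.differentiable (by simp) _).hasFDerivAt
  · exact hΨc.contDiffOn
  · intro y hy
    rw [OpenPartialHomeomorph.symm_source] at hy
    have hsrc := e.map_target hy
    have hy' : Ψ (e.symm y) = y := e.right_inv hy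
    rw [hes] at hsrc
    constructor
    · intro hyN
      obtain ⟨ξ, hξ, hξy⟩ := hV y (by rw [← hy']; exact hsrc.2) hyN
      have := e₀.injOn hsrc.1 hξ (by rw [he₀c, he₀c, hy', hΨA, hξy])
      rw [this]
      exact ⟨ξ, rfl⟩
    · rintro ⟨ξ, hξ⟩
      rw [← hy', ← hξ]
      change Ψ (A ξ) ∈ N
      rw [hΨA]
      exact hGN ξ

/-! ### The stable manifold -/

section
variable {ν α β M : ℝ} {γ : ℝ → ℂ × ℂ × ℂ}

/-- The union of the orbits which converge to the circle without belonging to it. -/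
def stableSet (ν α β M : ℝ) : Set (ℂ × ℂ × ℂ) := {z | ∃ γ, IsStableOrbit ν α β M γ ∧ γ 0 = z}

lemma lyap_rot {a d : ℂ} (ha : ‖a‖ = 1) (hd : ‖d‖ = 1) (z : ℂ × ℂ × ℂ) :
    lyap M (rot a d z) = lyap M z := by
  rw [lyap, lyap, eta_rot hd]
  simp [rot, ha]

namespace IsStableOrbit

lemma mem_stableSet (h : IsStableOrbit ν α β M γ) (t : ℝ) : γ t ∈ stableSet ν α β M :=
  ⟨_, h.shift t, by simp⟩

lemma ne_zero_or (h : IsStableOrbit ν α β M γ) (hν : 0 < ν) (hM : 0 < M) (t : ℝ) :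
    (γ t).1 ≠ 0 ∨ (γ t).2.2 ≠ 0 := by
  by_contra! hc
  exact h.ne_zero t ((saddleCoord_eq_zero_iff hν hM (h.isOrbit.mem t)).mpr hc)

lemma c_ne_zero (h : IsStableOrbit ν α β M γ) (hM : 0 < M) (t : ℝ) : (γ t).2.1 ≠ 0 :=
  (levelSet_subset hM (h.isOrbit.mem t)).1

/-- The first component of the vector field does not vanish where `b` does. -/
lemma vf_fst_ne_zero (h : IsStableOrbit ν α β M γ) (hν : 0 < ν) (hM : 0 < M) {t : ℝ}
    (hb : (γ t).1 = 0) : (vf ν α β M (γ t)).1 ≠ 0 := by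
  have hp := (h.ne_zero_or hν hM t).resolve_left (not_not.mpr hb)
  have hMC : (M : ℂ) ≠ 0 := by exact_mod_cast hM.ne'
  simp [vf, hb, hMC, hp, h.c_ne_zero hM t]

/-- The Lyapunov function is stationary only where `b` vanishes, and `b` cannot vanish on an
interval. -/
lemma strictAnti_lyap (h : IsStableOrbit ν α β M γ) (hν : 0 < ν) (hM : 0 < M) :
    StrictAnti fun t => lyap M (γ t) := by
  have hanti := h.isOrbit.antitone_lyap hν
  intro s t hst
  refine lt_of_le_of_ne (hanti hst.le) fun e => ?_
  have hconst : ∀ r ∈ Set.Ioo s t, lyap M (γ r) = lyap M (γ s) := fun r hr =>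
    le_antisymm (hanti hr.1.le) (e.symm.le.trans (hanti hr.2.le))
  have hb : ∀ r ∈ Set.Ioo s t, (γ r).1 = 0 := by
    intro r hr
    have hev : (fun r => lyap M (γ r)) =ᶠ[𝓝 r] fun _ => lyap M (γ s) := by
      filter_upwards [Ioo_mem_nhds hr.1 hr.2] with r' hr' using hconst r' hr'
    have h1 := (h.isOrbit.hasDerivAt_lyap r).unique
      ((hasDerivAt_const r (lyap M (γ s))).congr_of_eventuallyEq hev)
    have h2 : ‖(γ r).1‖ ^ 2 = 0 := by
      refine (mul_eq_zero.mp h1).resolve_left ?_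
      linarith
    exact norm_eq_zero.mp (pow_eq_zero_iff two_ne_zero |>.mp h2)
  have hmid : (s + t) / 2 ∈ Set.Ioo s t := ⟨by linarith, by linarith⟩
  have hev : (fun r => (γ r).1) =ᶠ[𝓝 ((s + t) / 2)] fun _ => 0 := by
    filter_upwards [Ioo_mem_nhds hmid.1 hmid.2] with r' hr' using hb r' hr'
  exact h.vf_fst_ne_zero hν hM (hb _ hmid) ((hasDerivAt_coords (h.isOrbit.deriv _)).1.unique
    ((hasDerivAt_const _ (0 : ℂ)).congr_of_eventuallyEq hev))

end IsStableOrbit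

/-- The parametrization of the stable set by the time and by the two angles of the symmetries. -/
def stableParam (γ : ℝ → ℂ × ℂ × ℂ) (ξ : ℝ × ℝ × ℝ) : ℂ × ℂ × ℂ :=
  rot (Complex.exp (ξ.2.1 * Complex.I)) (Complex.exp (ξ.2.2 * Complex.I)) (γ ξ.1)

lemma contDiff_stableParam (h : IsOrbit ν α β M γ) : ContDiff ℝ ∞ (stableParam γ) := by
  have h1 : ContDiff ℝ ∞ fun ξ : ℝ × ℝ × ℝ => γ ξ.1 := h.contDiff.comp contDiff_fst
  have hb := h1.fst
  have hc := h1.snd.fst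
  have hp := h1.snd.snd
  have he : ∀ f : ℝ × ℝ × ℝ → ℝ, ContDiff ℝ ∞ f →
      ContDiff ℝ ∞ fun ξ => Complex.exp (f ξ * Complex.I) := fun f hf =>
    ((Complex.ofRealCLM.contDiff.comp hf).mul contDiff_const).cexp
  have h2 := he (fun ξ => ξ.2.1) (contDiff_fst.comp contDiff_snd)
  have h3 := he (fun ξ => ξ.2.2) (contDiff_snd.comp contDiff_snd)
  exact (h2.mul hb).prodMk (((h2.mul h3).mul hc).prodMk (h3.mul hp))

namespace IsStableOrbit

lemma stableParam_mem (h : IsStableOrbit ν α β M γ) (ξ : ℝ × ℝ × ℝ) :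
    stableParam γ ξ ∈ stableSet ν α β M :=
  (h.rot (Complex.norm_exp_ofReal_mul_I _) (Complex.norm_exp_ofReal_mul_I _)).mem_stableSet ξ.1

/-- In the kernel of the derivative, the time component vanishes because of the Lyapunov function, and
the two angles because `c ≠ 0` and one of `b`, `p` does not vanish. -/
lemma fderiv_stableParam_injective (h : IsStableOrbit ν α β M γ) (hν : 0 < ν) (hM : 0 < M)
    {A : ℝ × ℝ × ℝ →L[ℝ] ℂ × ℂ × ℂ} (hA : HasFDerivAt (stableParam γ) A 0) (ξ : ℝ × ℝ × ℝ)
    (hξ : A ξ = 0) : ξ = 0 := by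
  obtain ⟨τ, θ, φ⟩ := ξ
  -- the derivative along the line through `ξ`
  have hline : HasDerivAt (fun s : ℝ => stableParam γ (s • (τ, θ, φ))) 0 0 := by
    have h1 : HasDerivAt (fun s : ℝ => s • (τ, θ, φ)) ((1 : ℝ) • (τ, θ, φ)) 0 :=
      (hasDerivAt_id (0 : ℝ)).smul_const _
    rw [one_smul] at h1
    have h2 : HasFDerivAt (stableParam γ) A ((0 : ℝ) • (τ, θ, φ)) := by rwa [zero_smul]
    have := h2.comp_hasDerivAt (0 : ℝ) h1
    rwa [hξ] at this
  have hγ : HasDerivAt (fun s : ℝ => γ (s * τ)) (τ • vf ν α β M (γ 0)) 0 := by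
    have h1 : HasDerivAt (fun s : ℝ => s * τ) τ 0 := by
      simpa using (hasDerivAt_id (0 : ℝ)).mul_const τ
    have h2 : HasDerivAt γ (vf ν α β M (γ 0)) ((0 : ℝ) * τ) := by
      rw [zero_mul]; exact h.isOrbit.deriv 0
    exact h2.scomp (0 : ℝ) h1
  have hexp : ∀ k : ℝ, HasDerivAt (fun s : ℝ => Complex.exp ((s * k : ℝ) * Complex.I))
      (k * Complex.I) 0 := by
    intro k
    have h1 : HasDerivAt (fun s : ℝ => ((s * k : ℝ) : ℂ) * Complex.I) (k * Complex.I) 0 := by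
      have h2 : HasDerivAt (fun s : ℝ => s * k) k 0 := by
        simpa using (hasDerivAt_id (0 : ℝ)).mul_const k
      exact h2.ofReal_comp.mul_const _
    have := h1.cexp
    simpa using this
  obtain ⟨g1, g2, g3⟩ := hasDerivAt_coords hγ
  obtain ⟨k1, k2, k3⟩ := hasDerivAt_coords hline
  have e1 := k1.unique ((hexp θ).mul g1)
  have e2 := k2.unique (((hexp θ).mul (hexp φ)).mul g2)
  have e3 := k3.unique ((hexp φ).mul g3)
  simp only [Prod.fst_zero, Prod.snd_zero, Pi.mul_apply, zero_mul, Complex.ofReal_zero,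
    Complex.exp_zero, one_mul, mul_one, Prod.smul_fst, Prod.smul_snd, zero_smul] at e1 e2 e3
  -- `lyap` is invariant under the symmetries, and decreases along the orbit
  have hlyap : τ * ‖(γ 0).1‖ ^ 2 = 0 := by
    have hl : DifferentiableAt ℝ (lyap M) (stableParam γ ((0 : ℝ) • (τ, θ, φ))) := by
      have h1 : ContDiff ℝ 1 fun z : ℂ × ℂ × ℂ => ‖z.1‖ ^ 2 := contDiff_fst.norm_sq ℝ
      have h2 : ContDiff ℝ 1 fun z : ℂ × ℂ × ℂ => ‖z.2.2‖ ^ 2 :=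
        (contDiff_snd.comp contDiff_snd).norm_sq ℝ
      have : ContDiff ℝ 1 (lyap M) := h1.add (contDiff_const.mul (contDiff_const.sub h2))
      exact this.differentiable one_ne_zero _
    have h1 := hl.hasFDerivAt.comp_hasDerivAt (0 : ℝ) hline
    rw [map_zero] at h1
    have h2 : HasDerivAt (fun s : ℝ => lyap M (γ (s * τ)))
        (-(2 * ν) * ‖(γ 0).1‖ ^ 2 * τ) 0 := by
      have h3 : HasDerivAt (fun s : ℝ => s * τ) τ 0 := by
        simpa using (hasDerivAt_id (0 : ℝ)).mul_const τ
      have h4 : HasDerivAt (fun t => lyap M (γ t)) (-(2 * ν) * ‖(γ 0).1‖ ^ 2) ((0 : ℝ) * τ) := by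
        rw [zero_mul]; exact h.isOrbit.hasDerivAt_lyap 0
      exact h4.comp (0 : ℝ) h3
    have h5 : (lyap M ∘ fun s : ℝ => stableParam γ (s • (τ, θ, φ))) =
        fun s : ℝ => lyap M (γ (s * τ)) := by
      funext s
      exact lyap_rot (Complex.norm_exp_ofReal_mul_I _) (Complex.norm_exp_ofReal_mul_I _) _
    rw [h5] at h1
    have h6 := h1.unique h2
    have : -(2 * ν) * (τ * ‖(γ 0).1‖ ^ 2) = 0 := by linarith
    exact (mul_eq_zero.mp this).resolve_left (by linarith)
  have hτ : τ = 0 := by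
    by_contra hτ
    have hb : (γ 0).1 = 0 :=
      norm_eq_zero.mp (pow_eq_zero_iff two_ne_zero |>.mp ((mul_eq_zero.mp hlyap).resolve_left hτ))
    rw [hb, mul_zero, zero_add] at e1
    exact h.vf_fst_ne_zero hν hM hb ((smul_eq_zero.mp e1.symm).resolve_left hτ)
  subst hτ
  simp only [zero_smul, add_zero] at e1 e2 e3
  have hc := h.c_ne_zero hM 0
  have hsum : (θ : ℂ) + φ = 0 := by
    have h1 : ((θ : ℂ) + φ) * (Complex.I * (γ 0).2.1) = 0 := by linear_combination -e2
    exact (mul_eq_zero.mp h1).resolve_right (mul_ne_zero Complex.I_ne_zero hc)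
  have hsum' : θ + φ = 0 := by exact_mod_cast hsum
  have hz : θ = 0 ∨ φ = 0 := by
    rcases h.ne_zero_or hν hM 0 with hb | hp
    · left
      have h1 := (mul_eq_zero.mp e1.symm).resolve_right hb
      exact_mod_cast (mul_eq_zero.mp h1).resolve_right Complex.I_ne_zero
    · right
      have h1 := (mul_eq_zero.mp e3.symm).resolve_right hp
      exact_mod_cast (mul_eq_zero.mp h1).resolve_right Complex.I_ne_zero
  rcases hz with rfl | rfl
  · rw [zero_add] at hsum'; rw [hsum']; rfl
  · rw [add_zero] at hsum'; rw [hsum']; rfl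

/-- The points of the stable set near `γ 0` have parameters near zero: the time is controlled by the
Lyapunov function, and the angles by the arguments of the coordinates. -/
lemma eventually_mem_image_stableParam (h : IsStableOrbit ν α β M γ) (hν : 0 < ν) (hM : 0 < M)
    {U : Set (ℝ × ℝ × ℝ)} (hU : U ∈ 𝓝 0) :
    ∀ᶠ y in 𝓝[stableSet ν α β M] (γ 0), y ∈ stableParam γ '' U := by
  have hex : ∀ y : ℂ × ℂ × ℂ, ∃ (a d : ℂ) (τ : ℝ), ‖a‖ = 1 ∧ ‖d‖ = 1 ∧
      (y ∈ stableSet ν α β M → y = DampedSzego.rot a d (γ τ)) := by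
    intro y
    by_cases hy : y ∈ stableSet ν α β M
    · obtain ⟨δ, hδ, rfl⟩ := hy
      obtain ⟨a, d, τ, ha, hd, e⟩ := h.exists_eq_rot hδ hν hM
      exact ⟨a, d, τ, ha, hd, fun _ => by simpa using e 0⟩
    · exact ⟨1, 1, 0, norm_one, norm_one, fun h => absurd h hy⟩
  choose a d τ ha hd hy using hex
  set l := 𝓝[stableSet ν α β M] (γ 0) with hl
  have hmem : ∀ᶠ y in l, y = DampedSzego.rot (a y) (d y) (γ (τ y)) := by
    filter_upwards [self_mem_nhdsWithin] with y hyN using hy y hyN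
  have hid : Tendsto (fun y => DampedSzego.rot (a y) (d y) (γ (τ y))) l (𝓝 (γ 0)) :=
    (tendsto_id.mono_left nhdsWithin_le_nhds).congr' hmem
  have hanti := h.strictAnti_lyap hν hM
  have hτ : Tendsto τ l (𝓝 0) := by
    have hlc : Continuous (lyap M) := by unfold lyap eta; fun_prop
    have h1 : Tendsto (fun y => lyap M (γ (τ y))) l (𝓝 (lyap M (γ 0))) :=
      ((hlc.tendsto _).comp hid).congr fun y => lyap_rot (ha y) (hd y) _
    rw [Metric.tendsto_nhds]
    intro ε hε
    filter_upwards [h1.eventually (lt_mem_nhds (hanti hε)),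
      h1.eventually (gt_mem_nhds (hanti (neg_lt_zero.mpr hε)))] with y h2 h3
    rw [Real.dist_eq, sub_zero, abs_lt]
    exact ⟨hanti.lt_iff_gt.mp h3, hanti.lt_iff_gt.mp h2⟩
  have hγ : Tendsto (fun y => γ (τ y)) l (𝓝 (γ 0)) :=
    (h.isOrbit.continuous.tendsto 0).comp hτ
  -- a factor which multiplies a convergent nonzero quantity converges
  have hfac : ∀ (u f g : ℂ × ℂ × ℂ → ℂ) (w : ℂ), w ≠ 0 → Tendsto f l (𝓝 w) → Tendsto g l (𝓝 w) →
      (∀ y, g y = u y * f y) → Tendsto u l (𝓝 1) := by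
    intro u f g w hw hf hg hgf
    have h1 := hg.div hf hw
    rw [div_self hw] at h1
    refine h1.congr' ?_
    filter_upwards [hf.eventually_ne hw] with y hy
    rw [Pi.div_apply, hgf, mul_div_cancel_right₀ _ hy]
  have hb1 := (continuous_fst.tendsto _).comp hid
  have hb2 := (continuous_fst.tendsto _).comp hγ
  have hc1 := ((continuous_fst.comp continuous_snd).tendsto _).comp hid
  have hc2 := ((continuous_fst.comp continuous_snd).tendsto _).comp hγ
  have hp1 := ((continuous_snd.comp continuous_snd).tendsto _).comp hid
  have hp2 := ((continuous_snd.comp continuous_snd).tendsto _).comp hγ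
  have had : Tendsto (fun y => a y * d y) l (𝓝 1) :=
    hfac _ _ _ _ (h.c_ne_zero hM 0) hc2 hc1 fun y => rfl
  have hane : ∀ y, a y ≠ 0 := fun y e => by have := ha y; rw [e] at this; simp at this
  have hdne : ∀ y, d y ≠ 0 := fun y e => by have := hd y; rw [e] at this; simp at this
  have hboth : Tendsto a l (𝓝 1) ∧ Tendsto d l (𝓝 1) := by
    rcases h.ne_zero_or hν hM 0 with hb | hp
    · have h1 : Tendsto a l (𝓝 1) := hfac _ _ _ _ hb hb2 hb1 fun y => rfl
      have h2 := had.div h1 one_ne_zero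
      rw [div_one] at h2
      exact ⟨h1, h2.congr fun y => mul_div_cancel_left₀ _ (hane y)⟩
    · have h1 : Tendsto d l (𝓝 1) := hfac _ _ _ _ hp hp2 hp1 fun y => rfl
      have h2 := had.div h1 one_ne_zero
      rw [div_one] at h2
      exact ⟨h2.congr fun y => mul_div_cancel_right₀ _ (hdne y), h1⟩
  have harg : ∀ u : ℂ × ℂ × ℂ → ℂ, Tendsto u l (𝓝 1) →
      Tendsto (fun y => Complex.arg (u y)) l (𝓝 0) := by
    intro u hu
    have h1 := (Complex.continuousAt_arg Complex.one_mem_slitPlane).tendsto.comp hu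
    rwa [Complex.arg_one] at h1
  have hξ : Tendsto (fun y => (τ y, Complex.arg (a y), Complex.arg (d y))) l
      (𝓝 (0 : ℝ × ℝ × ℝ)) := hτ.prodMk_nhds ((harg a hboth.1).prodMk_nhds (harg d hboth.2))
  filter_upwards [hmem, hξ hU] with y h1 h2
  refine ⟨_, h2, ?_⟩
  have hexp : ∀ u : ℂ, ‖u‖ = 1 → Complex.exp (Complex.arg u * Complex.I) = u := fun u hu => by
    have := Complex.norm_mul_exp_arg_mul_I u
    rwa [hu, Complex.ofReal_one, one_mul] at this
  rw [stableParam]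
  simp only [hexp _ (ha y), hexp _ (hd y)]
  exact h1.symm

end IsStableOrbit

lemma isSmoothSubmanifold_stableSet (hν : 0 < ν) (hM : 0 < M) :
    IsSmoothSubmanifold 3 (stableSet ν α β M) := by
  have hdim : Module.finrank ℝ (ℝ × ℝ × ℝ) = 3 := by simp
  rw [← hdim]
  refine isSmoothSubmanifold_of_immersion ?_
  rintro _ ⟨γ, h, rfl⟩
  have hc := contDiff_stableParam h.isOrbit
  have hd := (hc.differentiable (by simp) 0).hasFDerivAt
  refine ⟨stableParam γ, _, hc, ?_, h.stableParam_mem, hd,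
    h.fderiv_stableParam_injective hν hM hd,
    fun U hU => h.eventually_mem_image_stableParam hν hM hU⟩
  simp [stableParam, rot_one_one]

end

end
end DampedSzego
namespace DampedSzego
noncomputable section

/-! ### The stable set in the space of functions -/

section
variable {ν α β M : ℝ} {γ : ℝ → ℂ × ℂ × ℂ}

lemma stableSet_subset_levelSet : stableSet ν α β M ⊆ levelSet M := by
  rintro _ ⟨γ, h, rfl⟩
  exact h.isOrbit.mem 0

lemma isStableOrbit_iff (h : IsOrbit ν α β M γ) :
    IsStableOrbit ν α β M γ ↔ γ 0 ∈ stableSet ν α β M := by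
  refine ⟨fun h' => h'.mem_stableSet 0, ?_⟩
  rintro ⟨δ, hδ, e⟩
  rwa [h.unique hδ.isOrbit e.symm]

lemma rankOne_mem_image_stableSet_iff (hM : 0 < M) {z : ℂ × ℂ × ℂ} (hz : z ∈ paramDomain) :
    rankOne z ∈ rankOne '' stableSet ν α β M ↔ z ∈ stableSet ν α β M := by
  refine ⟨?_, fun h => ⟨z, h, rfl⟩⟩
  rintro ⟨z', hz', e⟩
  rwa [rankOne_injOn hz (levelSet_subset hM (stableSet_subset_levelSet hz')) e.symm]

lemma coords_image_stableSet (hM : 0 < M) :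
    coords (rankOne '' stableSet ν α β M) = stableSet ν α β M := by
  ext z
  constructor
  · rintro ⟨h1, h2⟩
    exact (rankOne_mem_image_stableSet_iff hM h1).mp h2
  · intro h
    exact ⟨levelSet_subset hM (stableSet_subset_levelSet h), z, h, rfl⟩

/-- An orbit which does not blow up either belongs to the circle or converges to it. -/
lemma tendsto_eta_one_iff (h : IsOrbit ν α β M γ) (hν : 0 < ν) (hM : 0 < M) :
    Tendsto (fun t => eta (γ t)) atTop (𝓝 1) ↔
      γ 0 ∈ stableSet ν α β M ∨ ((γ 0).1 = 0 ∧ (γ 0).2.2 = 0) := by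
  constructor
  · intro he
    rcases eq_or_ne (saddleCoord ν α M (γ 0)) 0 with h0 | h0
    · exact Or.inr ((saddleCoord_eq_zero_iff hν hM (h.mem 0)).mp h0)
    · exact Or.inl ⟨γ, ⟨h, he, fun t => h.saddleCoord_ne_zero hν hM h0 t⟩, rfl⟩
  · rintro (h0 | ⟨h1, h2⟩)
    · exact ((isStableOrbit_iff h).mpr h0).tendsto_eta
    · refine tendsto_const_nhds.congr fun t => ?_
      rw [eta, (h.eq_zero_of_eq_zero h1 h2 t).2]
      simp

lemma rankOne_mem_union_iff (hM : 0 < M) {z : ℂ × ℂ × ℂ} (hz : z ∈ paramDomain) :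
    rankOne z ∈ rankOne '' stableSet ν α β M ∪ circleSet M ↔
      z ∈ levelSet M ∧ (z ∈ stableSet ν α β M ∨ (z.1 = 0 ∧ z.2.2 = 0)) := by
  rw [Set.mem_union, rankOne_mem_image_stableSet_iff hM hz, rankOne_mem_circleSet_iff hM hz]
  constructor
  · rintro (h | ⟨h1, h2, h3⟩)
    · exact ⟨stableSet_subset_levelSet h, Or.inl h⟩
    · exact ⟨⟨hz.2, by rw [h3, h2]; simp⟩, Or.inr ⟨h1, h2⟩⟩
  · rintro ⟨hl, h | ⟨h1, h2⟩⟩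
    · exact Or.inl h
    · refine Or.inr ⟨h1, h2, ?_⟩
      rw [hl.2, h2]; simp

/-- The stable set and the circle make up a closed set, characterized by the inequality
`lyap ≥ M` along the forward orbit, which passes to the limit: the Lyapunov function decreases to
`M` along the orbits which converge to the circle, and to `0` along the others. -/
lemma isClosed_stable_union_circle (hν : 0 < ν) (hM : 0 < M) :
    IsClosed {z : paramDomain | rankOne z ∈ rankOne '' stableSet ν α β M ∪ circleSet M} := by
  refine IsSeqClosed.isClosed fun z zl hz hlim => ?_
  simp only [Set.mem_ofPred_eq] at hz ⊢
  have hz' := fun n => (rankOne_mem_union_iff hM (z n).2).mp (hz n)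
  have hlimc : Tendsto (fun n => (z n : ℂ × ℂ × ℂ)) atTop (𝓝 (zl : ℂ × ℂ × ℂ)) :=
    (continuous_subtype_val.tendsto zl).comp hlim
  have hzl : (zl : ℂ × ℂ × ℂ) ∈ levelSet M := by
    refine ⟨zl.2.2, ?_⟩
    have h1 : Continuous fun z : ℂ × ℂ × ℂ => ‖z.2.1‖ ^ 2 := by fun_prop
    have h2 : Continuous fun z : ℂ × ℂ × ℂ => M * (1 - ‖z.2.2‖ ^ 2) ^ 2 := by fun_prop
    refine tendsto_nhds_unique ((h1.tendsto _).comp hlimc) ?_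
    exact ((h2.tendsto _).comp hlimc).congr fun n => ((hz' n).1.2).symm
  rw [rankOne_mem_union_iff hM zl.2]
  refine ⟨hzl, ?_⟩
  have horb : ∀ n, ∃ γ, IsOrbit ν α β M γ ∧ γ 0 = z n := fun n => exists_orbit α β hν hM (hz' n).1
  choose γ hγ hγ0 using horb
  obtain ⟨γl, hγl, hγl0⟩ := exists_orbit α β hν hM hzl
  rw [← hγl0, ← tendsto_eta_one_iff hγl hν hM]
  refine (hγl.eta_dichotomy hν hM).resolve_left fun h0 => ?_
  have hlyap : ∀ t, 0 ≤ t → M ≤ lyap M (γl t) := by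
    intro t ht
    have h1 := IsOrbit.tendsto_of_tendsto hν hM hγ hγl (by simpa only [hγ0, hγl0] using hlimc) ht
    have hlc : Continuous (lyap M) := by unfold lyap eta; fun_prop
    refine ge_of_tendsto' ((hlc.tendsto _).comp h1) fun n => ?_
    have h2 := (tendsto_eta_one_iff (hγ n) hν hM).mpr (by rw [hγ0]; exact (hz' n).2)
    have h3 := (hγ n).tendsto_lyap hν hM h2
    rw [mul_one] at h3
    exact ((hγ n).antitone_lyap hν).le_of_tendsto h3 t
  have h1 := hγl.tendsto_lyap hν hM h0
  rw [mul_zero] at h1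
  have := ge_of_tendsto h1 ((eventually_ge_atTop 0).mono hlyap)
  linarith

end

end
end DampedSzego

theorem theorem4p1 (ν α β M : ℝ) (hν : 0 < ν) (hM : 0 < M) :
    -- the flow is well defined on `𝓔_M`, globally in time, and preserves it
    (∀ u₀ ∈ DampedSzego.energyLevel M,
      ∃! u : ℝ → DampedSzego.Torus → ℂ, DampedSzego.IsSolution ν α β u ∧ u 0 = u₀) ∧
    (∀ u : ℝ → DampedSzego.Torus → ℂ, DampedSzego.IsSolution ν α β u →
      u 0 ∈ DampedSzego.energyLevel M → ∀ t : ℝ, u t ∈ DampedSzego.energyLevel M) ∧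
    ∃ Sig : Set (DampedSzego.Torus → ℂ),
      -- a (nonempty) three-dimensional submanifold of `𝓔_M`, disjoint from `𝓒_M`
      Sig ⊆ DampedSzego.energyLevel M ∧
      Sig.Nonempty ∧
      DampedSzego.IsSmoothSubmanifold 3 (DampedSzego.coords Sig) ∧
      Disjoint Sig (DampedSzego.circleSet M) ∧
      -- invariant under the flow
      (∀ u : ℝ → DampedSzego.Torus → ℂ, DampedSzego.IsSolution ν α β u →
        u 0 ∈ Sig → ∀ t : ℝ, u t ∈ Sig) ∧
      -- its union with `𝓒_M` is closed (in the manifold `𝓦`)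
      IsClosed {z : DampedSzego.paramDomain |
        DampedSzego.rankOne z ∈ Sig ∪ DampedSzego.circleSet M} ∧
      -- blow-up
      (∀ u : ℝ → DampedSzego.Torus → ℂ, DampedSzego.IsSolution ν α β u →
        u 0 ∈ DampedSzego.energyLevel M \ (Sig ∪ DampedSzego.circleSet M) →
        ∀ s : ℝ, 1 / 2 < s →
          (fun t : ℝ => DampedSzego.hsNorm s (u t) ^ 2) ~[atTop]
            fun t : ℝ => (Real.Gamma (2 * s + 1) * M ^ (4 * s - 1) *
              ((ν ^ 2 + ((1 - β) * M - α) ^ 2) / (2 * ν)) ^ (1 - 2 * s)) * t ^ (2 * s - 1)) ∧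
      -- convergence to the circle
      (∀ u : ℝ → DampedSzego.Torus → ℂ, DampedSzego.IsSolution ν α β u → u 0 ∈ Sig →
        ∀ s : ℝ, 0 ≤ s →
          Tendsto (fun t : ℝ => DampedSzego.hsDist s (u t) (DampedSzego.circleSet M))
            atTop (𝓝 0) ∧
          ∃ K : ℝ, 0 < K ∧
            (fun t : ℝ => DampedSzego.hsDist s (u t) (DampedSzego.circleSet M)) ~[atTop]
              fun t : ℝ => K * Real.exp (-((ν + DampedSzego.sigma ν α M) / 2) * t)) ∧
      ν ≤ DampedSzego.sigma ν α M := by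
  refine ⟨fun u₀ hu₀ => ?_, fun u hu h0 t => ?_,
    DampedSzego.rankOne '' DampedSzego.stableSet ν α β M, ?_, ?_, ?_, ?_, ?_,
    DampedSzego.isClosed_stable_union_circle hν hM, ?_, ?_,
    (DampedSzego.sigma_spec α hν hM).1.le⟩
  · obtain ⟨z, hz, rfl⟩ := (DampedSzego.mem_energyLevel_iff hM).mp hu₀
    obtain ⟨γ, hγ, rfl⟩ := DampedSzego.exists_orbit α β hν hM hz
    have h1 := DampedSzego.isSolution_rankOne hγ.deriv hγ.mem
    exact ⟨_, ⟨h1, rfl⟩, fun v hv => hv.1.unique h1 hv.2⟩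
  · obtain ⟨γ, hγ, rfl⟩ := hu.exists_orbit hν hM h0
    exact (DampedSzego.mem_energyLevel_iff hM).mpr ⟨_, hγ.mem t, rfl⟩
  · rintro _ ⟨z, hz, rfl⟩
    exact (DampedSzego.mem_energyLevel_iff hM).mpr
      ⟨z, DampedSzego.stableSet_subset_levelSet hz, rfl⟩
  · obtain ⟨γ, hγ⟩ := DampedSzego.exists_isStableOrbit α β hν hM
    exact ⟨_, γ 0, hγ.mem_stableSet 0, rfl⟩
  · rw [DampedSzego.coords_image_stableSet hM]
    exact DampedSzego.isSmoothSubmanifold_stableSet hν hM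
  · rw [Set.disjoint_left]
    rintro _ ⟨_, ⟨γ, hγ, rfl⟩, rfl⟩ hc
    obtain ⟨h1, h2, -⟩ := (DampedSzego.rankOne_mem_circleSet_iff hM
      (DampedSzego.levelSet_subset hM (hγ.isOrbit.mem 0))).mp hc
    exact (hγ.ne_zero_or hν hM 0).elim (fun h => h h1) fun h => h h2
  · intro u hu h0 t
    obtain ⟨_, ⟨γ, hγ, rfl⟩, e⟩ := h0
    have h1 := hu.unique (DampedSzego.isSolution_rankOne hγ.isOrbit.deriv hγ.isOrbit.mem) e.symm
    rw [h1]
    exact ⟨_, hγ.mem_stableSet t, rfl⟩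
  · intro u hu h0 s hs
    obtain ⟨γ, hγ, rfl⟩ := hu.exists_orbit hν hM h0.1
    refine hγ.hsNorm_sq_isEquivalent hν hM
      ((hγ.eta_dichotomy hν hM).resolve_right fun h1 => h0.2 ?_) hs
    exact (DampedSzego.rankOne_mem_union_iff hM (DampedSzego.levelSet_subset hM (hγ.mem 0))).mpr
      ⟨hγ.mem 0, (DampedSzego.tendsto_eta_one_iff hγ hν hM).mp h1⟩
  · intro u hu h0 s hs
    obtain ⟨_, ⟨γ, hγ, rfl⟩, e⟩ := h0
    have h1 := hu.unique (DampedSzego.isSolution_rankOne hγ.isOrbit.deriv hγ.isOrbit.mem) e.symm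
    rw [h1]
    obtain ⟨K, hK, h2⟩ := hγ.hsDist_isEquivalent hν hM hs
    refine ⟨h2.symm.tendsto_nhds ?_, K, hK, h2⟩
    have hrate : 0 < (ν + DampedSzego.sigma ν α M) / 2 := by
      linarith [(DampedSzego.sigma_spec α hν hM).1]
    have h3 := (Real.tendsto_exp_neg_atTop_nhds_zero.comp
      (tendsto_id.const_mul_atTop hrate)).const_mul K
    rw [mul_zero] at h3
    refine h3.congr fun t => ?_
    simp only [Function.comp_apply, id, neg_mul]
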